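/- Let $\Omega\subset\mathbb R^3$ be a bounded open set with boundary $\Gamma$ of class $C^1$ ($\Omega$ being locally on one side of $\Gamma$), let $k\ge 2$, $\sigma>0$ and $s<1$. Then there is $h_0>0$, depending only on $\Omega,k,\sigma,s$, such that the following holds for all meshes $\mathcal T_h$, skin directions $\nu$ and data $f,g$ as described below, provided $h=\max_{T}h_T\le h_0$, where $h_T$ is the diameter of $T$. *Mesh.* $\mathcal T_h$ is a finite set of closed nondegenerate straight-edged tetrahedra, any two of which intersect in the convex hull of their common vertices. $\Omega_h$ is the interior of $\bigcup_{T\in\mathcal T_h}T$ and $\Gamma_h=\partial\Omega_h$. All mesh vertices lie in $\overline\Omega$, and those located on $\Gamma_h$ lie on $\Gamma$. Every $T\in\mathcal T_h$ contains a ball of diameter $h_T/\sigma$. Every $T$ has at most one edge, or else exactly one face together with the three edges of that face and no other edge, contained in $\Gamma_h$. *Skins.* With every edge $e\subset\Gamma_h$ is associated a plane through $e$, spanned by $e$ and a unit vector $\nu_e\perp e$. Whenever $e$ is common to two distinct faces contained in $\Gamma_h$, the sine of the angle between $\nu_e$ and the plane bisecting these two faces is at most $s$ ($s=0$ being the bisecting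 plane itself). *Lagrangian nodes.* The Lagrangian nodes (of order $k$) of a simplex are its points whose barycentric coordinates are integer multiples of $1/k$. *Spaces.* $V_h$ is the space of continuous functions on $\overline{\Omega}_h$ that vanish on $\Gamma_h$ and are polynomials of degree at most $k$ on every $T\in\mathcal T_h$. $W_h^g$ is the set of families $w=(w_T)_{T\in\mathcal T_h}$ of polynomials of degree at most $k$ (possibly discontinuous piecewise polynomial functions) such that: 1. if $x$ is a Lagrangian node of both $T$ and $T'$ and either $x\notin\Gamma_h$ or $x$ is a mesh vertex, then $w_T(x)=w_{T'}(x)$; 2. $w_T(S)=g(S)$ for every vertex $S$ of $T$ located on $\Gamma_h$; 3. if a face $F$ of $T$ is contained in $\Gamma_h$ and $O$ is the opposite vertex, then for every Lagrangian node $M$ in the relative interior of $F$, $w_T(P)=g(P)$, where $P$ is the intersection with $\Gamma$, nearest to $M$, of the line through $O$ and $M$; 4. if an edge $e$ of $T$ is contained in $\Gamma_h$, then for every Lagrangian node $M$ in the relative interior of $e$, $w_T(Q)=g(Q)$, where $Q$ is the intersection with $\Gamma$, nearest to $M$, of the line through $M$ with direction $\nu_e$. In 3 and 4, $w_T$ is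 evaluated, if necessary, outside $T$ by polynomial extension; should a nearest intersection not exist the condition is void, and should it not be unique the condition is imposed at each of them. *Conclusion.* For every $f\in L^2(\Omega)$, extended by zero outside $\Omega$, and every continuous $g:\Gamma\to\mathbb R$, there is exactly one $u_h\in W_h^g$ such that $$\int_{\Omega_h}\mathbf{grad}_h\,u_h\cdot\mathbf{grad}\,v=\int_{\Omega_h}f\,v\qquad\forall v\in V_h,$$ where $(\mathbf{grad}_h w)_{|T}=\mathbf{grad}\,w_T$ for all $T\in\mathcal T_h$. -/

import Mathlib

noncomputable section

namespace CurvedFEM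

/-- Three-dimensional Euclidean space. -/
abbrev Pt : Type := EuclideanSpace ℝ (Fin 3)

/-- The function on `ℝ³` given by a polynomial in three variables. -/
def polyFun (p : MvPolynomial (Fin 3) ℝ) (x : Pt) : ℝ :=
  MvPolynomial.eval (fun i => x i) p

/-- The closed simplex with vertex set `s`. -/
def cell (s : Finset Pt) : Set Pt := convexHull ℝ (s : Set Pt)

/-- `Ω` has a boundary of class `C¹`: near each boundary point, `Ω` is the set where a `C¹` function
with nonzero derivative at that point is negative. -/
def HasC1Boundary (Ω : Set Pt) : Prop :=
  ∀ x ∈ frontier Ω, ∃ (U : Set Pt) (ψ : Pt → ℝ), IsOpen U ∧ x ∈ U ∧ ContDiffOn ℝ 1 ψ U ∧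
    fderiv ℝ ψ x ≠ 0 ∧ Ω ∩ U = {y ∈ U | ψ y < 0}

/-- A finite mesh of straight-edged, nondegenerate tetrahedra, each given by its set of vertices,
with the usual compatibility condition: any two tetrahedra meet in the simplex spanned by their
common vertices (a common face, edge or vertex, or nothing). -/
structure TetMesh where
  elems : Finset (Finset Pt)
  card_eq : ∀ T ∈ elems, T.card = 4
  affineIndep : ∀ T ∈ elems, AffineIndependent ℝ ((↑) : T → Pt)
  compatible : ∀ S ∈ elems, ∀ T ∈ elems,
    cell S ∩ cell T ⊆ convexHull ℝ ((S : Set Pt) ∩ (T : Set Pt))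

namespace TetMesh

variable (M : TetMesh)

/-- The polyhedron covered by the mesh, a closed set. -/
def polyhedron : Set Pt := ⋃ T ∈ M.elems, cell T

/-- The open set `Ω_h`. -/
def dom : Set Pt := interior M.polyhedron

/-- The boundary `Γ_h` of `Ω_h`. -/
def bdry : Set Pt := frontier M.dom

/-- The set of mesh vertices. -/
def vertices : Set Pt := {x | ∃ T ∈ M.elems, x ∈ T}

/-- The mesh size `h`, the largest diameter of a tetrahedron. -/
def meshSize : ℝ := ⨆ T : M.elems, Metric.diam (cell (T : Finset Pt))

/-- `F` is a face of the tetrahedron `T` that is contained in `Γ_h`. -/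
def IsBdryFace (T F : Finset Pt) : Prop :=
  T ∈ M.elems ∧ F ⊆ T ∧ F.card = 3 ∧ cell F ⊆ M.bdry

/-- `e` is an edge of the tetrahedron `T` that is contained in `Γ_h`. -/
def IsBdryEdge (T e : Finset Pt) : Prop :=
  T ∈ M.elems ∧ e ⊆ T ∧ e.card = 2 ∧ cell e ⊆ M.bdry

/-- The mesh fits `Ω`: its vertices lie in the closure of `Ω`, and those located on `Γ_h` lie on the
boundary of `Ω`. -/
def Fits (Ω : Set Pt) : Prop :=
  M.vertices ⊆ closure Ω ∧ M.vertices ∩ M.bdry ⊆ frontier Ω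

/-- Regularity with shape parameter `σ`: every tetrahedron `T` contains a ball whose
diameter is `h_T / σ`. -/
def ShapeRegular (σ : ℝ) : Prop :=
  ∀ T ∈ M.elems, ∃ c : Pt, Metric.closedBall c (Metric.diam (cell T) / (2 * σ)) ⊆ cell T

/-- A tetrahedron has at most either one edge or one face in `Γ_h`: either it has at most one edge
in `Γ_h`, or it has a face in `Γ_h` and its edges in `Γ_h` are those of that face. -/
def OneEdgeOrFace : Prop :=
  ∀ T ∈ M.elems,
    (∀ e e', M.IsBdryEdge T e → M.IsBdryEdge T e' → e = e') ∨
    (∃ F, M.IsBdryFace T F ∧ ∀ e, M.IsBdryEdge T e → e ⊆ F)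

/-- The unit vector orthogonal to the edge `[a, b]`, in the plane of `a, b, c`, pointing from the
edge towards `c`. -/
def inward (a b c : Pt) : Pt :=
  let q : Pt := (c - a) - (inner ℝ (c - a) (b - a) / ‖b - a‖ ^ 2) • (b - a)
  ‖q‖⁻¹ • q

/-- A choice of the plane skins `δ_e`. The plane of `δ_e` is the plane through `e` spanned by `e`
and the unit vector `ν e`, which is orthogonal to `e`. This plane is close to the bisector of
the two boundary faces meeting at `e`: the sine of the angle between `ν e` and the bisecting plane
(which is orthogonal to `inward a b c - inward a b c'`) is at most `s`. -/
def IsSkinChoice (s : ℝ) (ν : Finset Pt → Pt) : Prop :=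
  (∀ T e, M.IsBdryEdge T e → ‖ν e‖ = 1 ∧ ∀ a ∈ e, ∀ b ∈ e, inner ℝ (ν e) (b - a) = 0) ∧
  (∀ T T' F F' e, M.IsBdryFace T F → M.IsBdryFace T' F' → F ≠ F' → e ⊆ F → e ⊆ F' → e.card = 2 →
    ∀ a ∈ e, ∀ b ∈ e, a ≠ b → ∀ c ∈ F, c ∉ e → ∀ c' ∈ F', c' ∉ e →
      |inner ℝ (ν e) (inward a b c - inward a b c')| ≤ s * ‖inward a b c - inward a b c'‖)

end TetMesh

/-- The Lagrangian nodes of order `k` of the simplex with vertex set `s`: the points whose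
barycentric coordinates are integer multiples of `1 / k`. -/
def lagrangeNodes (k : ℕ) (s : Finset Pt) : Set Pt :=
  {x | ∃ α : Pt → ℕ, ∑ y ∈ s, α y = k ∧ x = ∑ y ∈ s, ((α y : ℝ) / (k : ℝ)) • y}

/-- The Lagrangian nodes of order `k` in the relative interior of the simplex with vertex set `s`. -/
def innerNodes (k : ℕ) (s : Finset Pt) : Set Pt :=
  {x | ∃ α : Pt → ℕ, (∀ y ∈ s, 0 < α y) ∧ ∑ y ∈ s, α y = k ∧
    x = ∑ y ∈ s, ((α y : ℝ) / (k : ℝ)) • y}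

/-- `P` is the nearest intersection, as seen from `x`, of the set `Γ` with the line through `x`
with direction `d`. -/
def IsNearestIntersection (Γ : Set Pt) (x d P : Pt) : Prop :=
  (P ∈ Γ ∧ ∃ t : ℝ, P = x + t • d) ∧
    ∀ P' ∈ Γ, (∃ t : ℝ, P' = x + t • d) → dist x P ≤ dist x P'

namespace TetMesh

variable (M : TetMesh)

/-- The test space `V_h`: continuous functions on the closed polyhedron that vanish on `Γ_h` (and
are extended by zero outside `Ω_h`) and are polynomials of degree at most `k` on every
tetrahedron. -/
def testSpace (k : ℕ) : Set (Pt → ℝ) :=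
  {v | ContinuousOn v M.polyhedron ∧ (∀ x, x ∉ M.dom → v x = 0) ∧
    ∀ T ∈ M.elems, ∃ p : MvPolynomial (Fin 3) ℝ, p.totalDegree ≤ k ∧
      ∀ x ∈ cell T, v x = polyFun p x}

/-- The trial manifold `W_h^g`. Its elements may be discontinuous across faces, so an element is the
family of its polynomial expressions in the tetrahedra; evaluating such an expression at a point of
`Γ` outside the tetrahedron is meant in the sense of polynomial extension. -/
structure IsTrial (Ω : Set Pt) (k : ℕ) (ν : Finset Pt → Pt) (g : Pt → ℝ)
    (w : M.elems → MvPolynomial (Fin 3) ℝ) : Prop where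
  degree_le : ∀ T, (w T).totalDegree ≤ k
  /-- `w` is single-valued at all Lagrangian nodes except those on `Γ_h` that are not vertices. -/
  single_valued : ∀ T T' : M.elems, ∀ x ∈ lagrangeNodes k T.1 ∩ lagrangeNodes k T'.1,
    (x ∉ M.bdry ∨ x ∈ M.vertices) → polyFun (w T) x = polyFun (w T') x
  /-- `w` takes the value of `g` at the vertices on `Γ_h`. -/
  vertex_value : ∀ T : M.elems, ∀ S ∈ T.1, S ∈ M.bdry → polyFun (w T) S = g S
  /-- `w = g` at the points of `Γ` associated with the nodes inside the boundary face `F` of `T`,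
  on the lines through these nodes and the vertex `O` opposite to `F`. -/
  face_value : ∀ (T : M.elems) (F : Finset Pt), M.IsBdryFace T F → ∀ O ∈ T.1, O ∉ F →
    ∀ x ∈ innerNodes k F, ∀ P, IsNearestIntersection (frontier Ω) x (x - O) P →
      polyFun (w T) P = g P
  /-- `w = g` at the points of `Γ` associated with the nodes inside the edge `e` of `T` on `Γ_h`,
  on the lines through these nodes that are orthogonal to `e` in the plane of the skin. -/
  edge_value : ∀ (T : M.elems) (e : Finset Pt), M.IsBdryEdge T e →
    ∀ x ∈ innerNodes k e, ∀ Q, IsNearestIntersection (frontier Ω) x (ν e) Q →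
      polyFun (w T) Q = g Q

/-- The broken gradient of a piecewise polynomial function. -/
def brokenGrad (w : M.elems → MvPolynomial (Fin 3) ℝ) (x : Pt) : Pt :=
  ∑ T : M.elems, (interior (cell T.1)).indicator (gradient (polyFun (w T))) x

/-- The bilinear form `a_h`. -/
def aForm (w : M.elems → MvPolynomial (Fin 3) ℝ) (v : Pt → ℝ) : ℝ :=
  ∫ x in M.dom, inner ℝ (M.brokenGrad w x) (gradient v x)

/-- The linear form `L_h`, with `f` extended by zero outside `Ω`. -/
def lForm (Ω : Set Pt) (f : Pt → ℝ) (v : Pt → ℝ) : ℝ :=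
  ∫ x in M.dom, Ω.indicator f x * v x

/-- `u` solves the discrete Poisson problem. -/
def IsDiscreteSolution (Ω : Set Pt) (k : ℕ) (ν : Finset Pt → Pt) (f g : Pt → ℝ)
    (u : M.elems → MvPolynomial (Fin 3) ℝ) : Prop :=
  M.IsTrial Ω k ν g u ∧ ∀ v ∈ M.testSpace k, M.aForm u v = M.lForm Ω f v

end TetMesh

end CurvedFEM

end

noncomputable section

namespace CurvedFEM

open MvPolynomial MeasureTheory
open scoped Classical

/-! A trial polynomial on `T` is fixed by its values at displaced nodes: the Lagrangian nodes, with
those inside boundary faces and edges moved onto `Γ`. A test polynomial is fixed by its values at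
the Lagrangian nodes themselves. Matching values at corresponding nodes therefore identifies
homogeneous trial families with test functions, and the discrete problem becomes a square linear
system, for which injectivity is enough.

Analysis. If every node of `T` moves by at most `ε * diam T`, with `ε` depending on `k` and `σ`
only, then a polynomial `p` and the polynomial `q` whose nodal values are those of `p` at the
displaced nodes satisfy `energy T (p - q) ≤ 1 / 4 * energy T p` (`exists_displacement_bound`). This
is continuity in a finite-dimensional space on one reference tetrahedron, carried over by affine
maps that shape regularity controls. With `q = 0` it makes the displaced nodes unisolvent; in
general it gives `∫ ∇p · ∇q ≥ 1 / 2 * energy T p`. A solution of the homogeneous system is thus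
constant on each tetrahedron. Its vertex values are single-valued and vanish on `Γ_h`, so it is zero
(`TetMesh.eq_zero_of_vertex_values`): otherwise the union of the cells carrying one nonzero value
would be compact, open and nonempty in space.

Geometry. It remains to bound the displacements (`TetMesh.exists_nearest`). A compact `C¹` boundary
is, at a uniform small scale, within a slope `δ` of a plane with normal `n`. Boundary faces are then
almost orthogonal to `n`, while shape regularity puts the opposite vertex at a depth comparable with
the diameter, so lines from that vertex cross `Γ` once near the face. For skins, a boundary edge
lies in two boundary faces (`TetMesh.exists_two_bdryFaces`). Their inward directions are almost
tangent to `Γ`, and they are well apart because the tetrahedra do not overlap. The normalised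
difference of these directions and the edge thus span an almost tangent plane, and a vector
orthogonal to the edge whose component along that difference is at most `s < 1` is transversal to
`Γ`. -/

/-! ### Polynomial functions, their gradients and affine substitutions. -/

theorem polyFun_add (p q : MvPolynomial (Fin 3) ℝ) (x : Pt) :
    polyFun (p + q) x = polyFun p x + polyFun q x := by simp [polyFun]

theorem polyFun_sub (p q : MvPolynomial (Fin 3) ℝ) (x : Pt) :
    polyFun (p - q) x = polyFun p x - polyFun q x := by simp [polyFun]

theorem polyFun_smul (c : ℝ) (p : MvPolynomial (Fin 3) ℝ) (x : Pt) :
    polyFun (c • p) x = c * polyFun p x := by simp [polyFun, smul_eval]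

theorem polyFun_C (c : ℝ) (x : Pt) : polyFun (C c) x = c := by simp [polyFun]

theorem polyFun_zero (x : Pt) : polyFun 0 x = 0 := by simp [polyFun]

theorem polyFun_sum {ι : Type*} (s : Finset ι) (p : ι → MvPolynomial (Fin 3) ℝ) (x : Pt) :
    polyFun (∑ i ∈ s, p i) x = ∑ i ∈ s, polyFun (p i) x := by simp [polyFun, map_sum]

theorem polyFun_prod {ι : Type*} (s : Finset ι) (p : ι → MvPolynomial (Fin 3) ℝ) (x : Pt) :
    polyFun (∏ i ∈ s, p i) x = ∏ i ∈ s, polyFun (p i) x := by simp [polyFun, map_prod]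

theorem polyFun_contDiff (p : MvPolynomial (Fin 3) ℝ) : ContDiff ℝ ⊤ (polyFun p) := by
  have h := AnalyticOnNhd.eval_continuousLinearMap' (𝕜 := ℝ) (E := Pt) (B := ℝ)
    (fun i : Fin 3 => EuclideanSpace.proj i) p
  exact contDiffOn_univ.1 (h.contDiffOn uniqueDiffOn_univ)

theorem polyFun_continuous (p : MvPolynomial (Fin 3) ℝ) : Continuous (polyFun p) :=
  (polyFun_contDiff p).continuous

theorem polyFun_differentiable (p : MvPolynomial (Fin 3) ℝ) : Differentiable ℝ (polyFun p) :=
  (polyFun_contDiff p).differentiable (by simp)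

theorem norm_gradient (f : Pt → ℝ) (x : Pt) : ‖gradient f x‖ = ‖fderiv ℝ f x‖ := by
  simp [gradient]

theorem continuous_fderiv_polyFun (p : MvPolynomial (Fin 3) ℝ) :
    Continuous (fderiv ℝ (polyFun p)) :=
  (polyFun_contDiff p).continuous_fderiv WithTop.top_ne_zero

theorem continuous_gradient_polyFun (p : MvPolynomial (Fin 3) ℝ) :
    Continuous (gradient (polyFun p)) := by
  unfold gradient
  exact (LinearIsometryEquiv.continuous _).comp (continuous_fderiv_polyFun p)

theorem gradient_polyFun_add (p q : MvPolynomial (Fin 3) ℝ) (x : Pt) :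
    gradient (polyFun (p + q)) x = gradient (polyFun p) x + gradient (polyFun q) x := by
  have : polyFun (p + q) = polyFun p + polyFun q := by
    funext x
    rw [Pi.add_apply, polyFun_add]
  rw [this]
  simp only [gradient]
  rw [fderiv_add (polyFun_differentiable p x) (polyFun_differentiable q x), map_add]

theorem gradient_polyFun_smul (c : ℝ) (p : MvPolynomial (Fin 3) ℝ) (x : Pt) :
    gradient (polyFun (c • p)) x = c • gradient (polyFun p) x := by
  have : polyFun (c • p) = c • polyFun p := by
    funext x
    rw [Pi.smul_apply, polyFun_smul, smul_eq_mul]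
  rw [this]
  simp only [gradient]
  rw [fderiv_const_smul (polyFun_differentiable p x)]
  simp

theorem gradient_polyFun_sub (p q : MvPolynomial (Fin 3) ℝ) (x : Pt) :
    gradient (polyFun (p - q)) x = gradient (polyFun p) x - gradient (polyFun q) x := by
  have h := gradient_polyFun_add (p - q) q x
  rw [sub_add_cancel] at h
  rw [h, add_sub_cancel_right]

/-- The polynomial of degree at most one whose function is a given affine function. -/
def affPoly (l : Pt →ᵃ[ℝ] ℝ) : MvPolynomial (Fin 3) ℝ :=
  C (l 0) + ∑ i, C (l.linear (EuclideanSpace.single i 1)) * X i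

theorem polyFun_affPoly (l : Pt →ᵃ[ℝ] ℝ) (x : Pt) : polyFun (affPoly l) x = l x := by
  have hx : x = ∑ i, x i • EuclideanSpace.single i (1 : ℝ) := by
    ext j
    simp [Finset.sum_apply, Pi.single_apply]
  have h := l.map_vadd 0 x
  simp only [vadd_eq_add, add_zero] at h
  rw [h]
  conv_rhs => rw [hx]
  simp only [affPoly, polyFun, map_add, eval_C, map_sum, map_mul, eval_X, map_smul, smul_eq_mul]
  rw [add_comm]
  congr 1
  exact Finset.sum_congr rfl fun i _ => mul_comm _ _

theorem totalDegree_affPoly (l : Pt →ᵃ[ℝ] ℝ) : (affPoly l).totalDegree ≤ 1 := by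
  refine (totalDegree_add _ _).trans (max_le (by simp) ?_)
  refine totalDegree_finsetSum_le fun i _ => (totalDegree_mul _ _).trans ?_
  simp

theorem totalDegree_aeval_le (p : MvPolynomial (Fin 3) ℝ)
    (q : Fin 3 → MvPolynomial (Fin 3) ℝ) (hq : ∀ i, (q i).totalDegree ≤ 1) :
    (aeval q p).totalDegree ≤ p.totalDegree := by
  rw [aeval_def, eval₂_eq]
  refine totalDegree_finsetSum_le fun d hd => ?_
  refine (totalDegree_mul _ _).trans ?_
  rw [algebraMap_eq, totalDegree_C, zero_add]
  refine (totalDegree_finsetProd _ _).trans ?_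
  refine le_trans (Finset.sum_le_sum (g := fun i => d i) fun i _ => ?_) (le_totalDegree hd)
  refine (totalDegree_pow _ _).trans ?_
  calc d i * (q i).totalDegree ≤ d i * 1 := Nat.mul_le_mul_left _ (hq i)
    _ = d i := mul_one _

/-- The coordinate functions of an affine self-map of space. -/
def affCoord (A : Pt →ᵃ[ℝ] Pt) (i : Fin 3) : Pt →ᵃ[ℝ] ℝ :=
  ((EuclideanSpace.proj i : Pt →L[ℝ] ℝ) : Pt →ₗ[ℝ] ℝ).toAffineMap.comp A

/-- The composition of a polynomial with an affine map. -/
def compAffine (p : MvPolynomial (Fin 3) ℝ) (A : Pt →ᵃ[ℝ] Pt) : MvPolynomial (Fin 3) ℝ :=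
  aeval (fun i => affPoly (affCoord A i)) p

theorem totalDegree_compAffine_le (p : MvPolynomial (Fin 3) ℝ) (A : Pt →ᵃ[ℝ] Pt) :
    (compAffine p A).totalDegree ≤ p.totalDegree :=
  totalDegree_aeval_le p _ fun _ => totalDegree_affPoly _

theorem polyFun_compAffine (p : MvPolynomial (Fin 3) ℝ) (A : Pt →ᵃ[ℝ] Pt) (x : Pt) :
    polyFun (compAffine p A) x = polyFun p (A x) := by
  have h : ∀ i, eval (fun i => x i) (affPoly (affCoord A i)) = (A x) i := fun i =>
    polyFun_affPoly (affCoord A i) x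
  unfold polyFun compAffine
  induction p using MvPolynomial.induction_on with
  | C a => simp
  | add p q hp hq => rw [map_add, map_add, map_add, hp, hq]
  | mul_X p i hp => rw [map_mul, map_mul, map_mul, hp, aeval_X, h, eval_X]

/-- The space of polynomials of degree at most `k`. -/
abbrev PolyLE (k : ℕ) : Submodule ℝ (MvPolynomial (Fin 3) ℝ) := restrictTotalDegree (Fin 3) ℝ k

theorem mem_polyLE {k : ℕ} {p : MvPolynomial (Fin 3) ℝ} : p ∈ PolyLE k ↔ p.totalDegree ≤ k :=
  mem_restrictTotalDegree _ _ _

/-- The dimension of the space of polynomials of degree at most `k`. -/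
theorem finrank_polyLE (k : ℕ) :
    Module.finrank ℝ (PolyLE k) = Nat.card {m : Fin 3 →₀ ℕ | (m.sum fun _ e => e) ≤ k} :=
  Module.finrank_eq_nat_card_basis (basisRestrictSupport ℝ _)

/-! ### Barycentric coordinates of a tetrahedron. -/

/-- `T` is the vertex set of a nondegenerate tetrahedron. -/
def IsTet (T : Finset Pt) : Prop := T.card = 4 ∧ AffineIndependent ℝ ((↑) : T → Pt)

/-- The vertices of a nondegenerate tetrahedron form an affine basis. -/
def IsTet.basis {T : Finset Pt} (h : IsTet T) : AffineBasis T ℝ Pt :=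
  ⟨(↑), h.2, by
    rw [h.2.affineSpan_eq_top_iff_card_eq_finrank_add_one]
    simp [h.1]⟩

/-- The barycentric coordinate of the tetrahedron `T` associated with its vertex `y`. -/
def bary (T : Finset Pt) (y : Pt) : Pt →ᵃ[ℝ] ℝ :=
  -- The default `0` makes the coordinate total in `T` and `y`, so that different tetrahedra can be
  -- compared without carrying membership proofs.
  if h : IsTet T ∧ y ∈ T then h.1.basis.coord ⟨y, h.2⟩ else 0

section Tet

variable {T : Finset Pt} (h : IsTet T)
include h

theorem IsTet.bary_eq (y : T) : bary T y = h.basis.coord y := by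
  unfold bary
  rw [dif_pos ⟨h, y.2⟩]

theorem IsTet.sum_bary (x : Pt) : ∑ y ∈ T, bary T y x = 1 := by
  rw [← Finset.sum_coe_sort]
  simp only [h.bary_eq]
  exact h.basis.sum_coord_apply_eq_one x

theorem IsTet.sum_bary_smul (x : Pt) : ∑ y ∈ T, bary T y x • y = x := by
  rw [← Finset.sum_coe_sort]
  simp only [h.bary_eq]
  exact h.basis.linear_combination_coord_eq_self x

theorem IsTet.bary_self {y : Pt} (hy : y ∈ T) : bary T y y = 1 := by
  have := h.basis.coord_apply_eq ⟨y, hy⟩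
  rw [← h.bary_eq] at this
  exact this

theorem IsTet.bary_ne {y z : Pt} (hy : y ∈ T) (hz : z ∈ T) (hyz : y ≠ z) : bary T y z = 0 := by
  have := h.basis.coord_apply_ne (i := ⟨y, hy⟩) (j := ⟨z, hz⟩) (by simpa using hyz)
  rw [← h.bary_eq] at this
  exact this

theorem IsTet.bary_apply_sum (c : Pt → ℝ) (hc : ∑ y ∈ T, c y = 1) {y : Pt} (hy : y ∈ T) :
    bary T y (∑ z ∈ T, c z • z) = c y := by
  have h1 : ∑ z ∈ T, c z • z = T.affineCombination ℝ id c := by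
    rw [T.affineCombination_eq_linear_combination _ _ hc]
    rfl
  rw [h1, Finset.map_affineCombination _ _ _ hc,
    T.affineCombination_eq_linear_combination _ _ hc]
  rw [Finset.sum_eq_single y]
  · simp [h.bary_self hy]
  · intro z hz hzy
    simp [h.bary_ne hy hz hzy.symm]
  · exact fun hh => absurd hy hh

end Tet

theorem bary_combo (T : Finset Pt) (y x z : Pt) {a b : ℝ} (hab : a + b = 1) :
    bary T y (a • x + b • z) = a * bary T y x + b * bary T y z := by
  have := Convex.combo_affine_apply (f := bary T y) (x := x) (y := z) hab
  simpa using this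

theorem bary_add (T : Finset Pt) (y x u : Pt) :
    bary T y (x + u) = bary T y x + (bary T y).linear u := by
  have := (bary T y).map_vadd x u
  simp only [vadd_eq_add] at this
  rw [add_comm x u, this, add_comm]

theorem bary_sub (T : Finset Pt) (y x z : Pt) :
    (bary T y).linear (x - z) = bary T y x - bary T y z :=
  (bary T y).linearMap_vsub x z

theorem continuous_bary (T : Finset Pt) (y : Pt) : Continuous (bary T y) :=
  (bary T y).continuous_of_finiteDimensional

/-- The face combinatorics rests on this description of faces by signs and zeros of coordinates.
Conversely, vanishing coordinates drop out of `∑ bary T y x • y = x`, which leaves a convex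
combination of points of `S`. -/
theorem IsTet.mem_convexHull_iff {T : Finset Pt} (h : IsTet T) {S : Set Pt} (hS : S ⊆ T) {x : Pt} :
    x ∈ convexHull ℝ S ↔ (∀ y ∈ T, 0 ≤ bary T y x) ∧ ∀ y ∈ T, y ∉ S → bary T y x = 0 := by
  classical
  constructor
  · intro hx
    have hconv : Convex ℝ
        {x : Pt | (∀ y ∈ T, 0 ≤ bary T y x) ∧ ∀ y ∈ T, y ∉ S → bary T y x = 0} := by
      rintro u ⟨hu1, hu2⟩ v ⟨hv1, hv2⟩ a b ha hb hab
      refine ⟨fun y hy => ?_, fun y hy hyS => ?_⟩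
      · rw [bary_combo _ _ _ _ hab]
        exact add_nonneg (mul_nonneg ha (hu1 y hy)) (mul_nonneg hb (hv1 y hy))
      · rw [bary_combo _ _ _ _ hab, hu2 y hy hyS, hv2 y hy hyS]
        simp
    refine convexHull_min (fun z hz => ?_) hconv hx
    refine ⟨fun y hy => ?_, fun y hy hyS => ?_⟩
    · by_cases hyz : y = z
      · subst hyz
        rw [h.bary_self hy]
        exact zero_le_one
      · rw [h.bary_ne hy (hS hz) hyz]
    · exact h.bary_ne hy (hS hz) fun hyz => hyS (hyz ▸ hz)
  · rintro ⟨h1, h2⟩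
    have hsum : ∑ y ∈ T with y ∈ S, bary T y x = 1 := by
      rw [← h.sum_bary x, Finset.sum_filter_of_ne]
      intro y hy hne
      by_contra hyS
      exact hne (h2 y hy hyS)
    have hx : x = ∑ y ∈ T with y ∈ S, bary T y x • y := by
      rw [Finset.sum_filter_of_ne, h.sum_bary_smul x]
      intro y hy hne
      by_contra hyS
      exact hne (by rw [h2 y hy hyS, zero_smul])
    rw [hx]
    refine (convex_convexHull ℝ S).sum_mem (fun y hy => h1 y (Finset.mem_filter.1 hy).1) hsum
      fun y hy => subset_convexHull ℝ S (Finset.mem_filter.1 hy).2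

theorem IsTet.mem_cell_iff {T : Finset Pt} (h : IsTet T) {x : Pt} :
    x ∈ cell T ↔ ∀ y ∈ T, 0 ≤ bary T y x := by
  unfold cell
  rw [h.mem_convexHull_iff subset_rfl]
  constructor
  · exact fun hx => hx.1
  · exact fun hx => ⟨hx, fun y hy hyT => absurd hy hyT⟩

theorem IsTet.mem_subcell_iff {T S : Finset Pt} (h : IsTet T) (hS : S ⊆ T) {x : Pt} :
    x ∈ cell S ↔ (∀ y ∈ T, 0 ≤ bary T y x) ∧ ∀ y ∈ T, y ∉ S → bary T y x = 0 :=
  h.mem_convexHull_iff (S := (S : Set Pt)) (by exact_mod_cast hS)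

theorem IsTet.interior_cell {T : Finset Pt} (h : IsTet T) :
    interior (cell T) = {x | ∀ y ∈ T, 0 < bary T y x} := by
  have h1 : Set.range h.basis = T := Subtype.range_coe
  have h2 := h.basis.interior_convexHull
  rw [h1] at h2
  unfold cell
  rw [h2]
  ext x
  simp only [← h.bary_eq, Set.mem_ofPred_eq, Subtype.forall]

theorem isCompact_cell (T : Finset Pt) : IsCompact (cell T) :=
  T.finite_toSet.isCompact_convexHull (𝕜 := ℝ)

theorem isClosed_cell (T : Finset Pt) : IsClosed (cell T) := (isCompact_cell T).isClosed

theorem mem_cell_of_mem {T : Finset Pt} {y : Pt} (hy : y ∈ T) : y ∈ cell T :=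
  subset_convexHull ℝ _ (by exact_mod_cast hy)

theorem cell_mono {S T : Finset Pt} (h : S ⊆ T) : cell S ⊆ cell T :=
  convexHull_mono (by exact_mod_cast h)

theorem dist_le_diam_cell {T : Finset Pt} {x y : Pt} (hx : x ∈ cell T) (hy : y ∈ cell T) :
    dist x y ≤ Metric.diam (cell T) :=
  Metric.dist_le_diam_of_mem (isCompact_cell T).isBounded hx hy

theorem IsTet.exists_interior_point {T : Finset Pt} (h : IsTet T) :
    (interior (cell T)).Nonempty := by
  rw [h.interior_cell]
  refine ⟨∑ z ∈ T, (1 / 4 : ℝ) • z, fun y hy => ?_⟩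
  rw [h.bary_apply_sum (fun _ => 1 / 4) (by simp [h.1]) hy]
  norm_num

theorem IsTet.closure_interior_cell {T : Finset Pt} (h : IsTet T) :
    closure (interior (cell T)) = cell T := by
  have h1 : Convex ℝ (cell T) := convex_convexHull ℝ _
  rw [h1.closure_interior_eq_closure_of_nonempty_interior h.exists_interior_point]
  exact (isClosed_cell T).closure_eq

theorem IsTet.diam_pos {T : Finset Pt} (h : IsTet T) : 0 < Metric.diam (cell T) := by
  obtain ⟨a, ha, b, hb, hab⟩ := Finset.one_lt_card.1 (by rw [h.1]; norm_num : 1 < T.card)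
  exact (dist_pos.2 hab).trans_le (dist_le_diam_cell (mem_cell_of_mem ha) (mem_cell_of_mem hb))

theorem IsTet.bary_le_one {T : Finset Pt} (h : IsTet T) {x y : Pt} (hx : x ∈ cell T) (hy : y ∈ T) :
    bary T y x ≤ 1 := by
  rw [← h.sum_bary x]
  exact Finset.single_le_sum (fun z hz => h.mem_cell_iff.1 hx z hz) hy

/-- The barycentric coordinates of a shape regular tetrahedron are Lipschitz with a constant
proportional to the inverse of its diameter. -/
theorem IsTet.abs_bary_linear_le {T : Finset Pt} (h : IsTet T) {σ : ℝ} (hσ : 0 < σ) {c : Pt}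
    (hc : Metric.closedBall c (Metric.diam (cell T) / (2 * σ)) ⊆ cell T) {y : Pt} (hy : y ∈ T)
    (u : Pt) : |(bary T y).linear u| ≤ σ / Metric.diam (cell T) * ‖u‖ := by
  have hd := h.diam_pos
  set D := Metric.diam (cell T)
  by_cases hu : u = 0
  · simp [hu]
  have hu' : 0 < ‖u‖ := norm_pos_iff.2 hu
  -- With this scaling `c ± t • u` both lie in the inscribed ball, and the coordinate, which stays
  -- in `[0, 1]` on the cell, changes by `2 * t * L` between them.
  set t : ℝ := D / (2 * σ) / ‖u‖ with ht
  have htp : 0 < t := by positivity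
  have htu : ‖t • u‖ = D / (2 * σ) := by
    rw [norm_smul, Real.norm_of_nonneg htp.le, ht]
    field_simp
  have h1 : c + t • u ∈ cell T := hc (by simp [htu])
  have h2 : c + -(t • u) ∈ cell T := hc (by simp [htu])
  have e1 := bary_add T y c (t • u)
  have e2 := bary_add T y c (-(t • u))
  rw [map_neg] at e2
  rw [map_smul, smul_eq_mul] at e1 e2
  have b1 := h.mem_cell_iff.1 h1 y hy
  have b2 := h.mem_cell_iff.1 h2 y hy
  have b3 := h.bary_le_one h1 hy
  have b4 := h.bary_le_one h2 hy
  set L := (bary T y).linear u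
  have h3 : t * |L| ≤ 1 / 2 := by
    have h5 : t * |L| = |t * L| := by rw [abs_mul, abs_of_pos htp]
    rw [h5, abs_le]
    constructor <;> linarith
  have h4 : σ / D * ‖u‖ = 1 / 2 / t := by
    rw [ht]
    field_simp
  rw [h4, le_div_iff₀ htp]
  linarith

/-- The coordinates sum to one, so their linear parts sum to zero; hence the base point `a` is
arbitrary. -/
theorem sum_bary_linear_smul {T : Finset Pt} (h : IsTet T) (a u : Pt) :
    ∑ y ∈ T, (bary T y).linear u • (y - a) = u := by
  have h1 := h.sum_bary_smul (a + u)
  have h2 := h.sum_bary_smul a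
  have h3 := h.sum_bary (a + u)
  have h4 := h.sum_bary a
  simp only [bary_add, add_smul, Finset.sum_add_distrib] at h1 h3
  rw [h2] at h1
  rw [h4] at h3
  simp only [smul_sub, Finset.sum_sub_distrib, ← Finset.sum_smul]
  have h5 : ∑ y ∈ T, (bary T y).linear u = 0 := by linarith
  rw [h5, zero_smul, sub_zero]
  exact add_left_cancel h1

/-! ### Lagrange interpolation of order `k`. -/

/-- The binomial coefficient `t(t-1)⋯(t-n+1)/n!` as a polynomial expression in `t`. -/
def binom (t : ℝ) (n : ℕ) : ℝ := ∏ j ∈ Finset.range n, (t - j) / (j + 1)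

theorem binom_of_lt {m n : ℕ} (h : m < n) : binom m n = 0 :=
  Finset.prod_eq_zero (Finset.mem_range.2 h) (by simp)

theorem binom_self (n : ℕ) : binom n n = 1 := by
  unfold binom
  rw [Finset.prod_div_distrib, ← Finset.prod_range_reflect]
  rw [div_eq_one_iff_eq (Finset.prod_ne_zero_iff.2 fun j _ => by positivity)]
  refine Finset.prod_congr rfl fun j hj => ?_
  have := Finset.mem_range.1 hj
  rw [Nat.cast_sub (by omega), Nat.cast_sub (by omega)]
  push_cast
  ring

/-- The Lagrangian node of order `k` with barycentric coordinates `α / k`. -/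
def node (k : ℕ) (T : Finset Pt) (α : Pt → ℕ) : Pt := ∑ y ∈ T, ((α y : ℝ) / (k : ℝ)) • y

theorem sum_div_eq_one {k : ℕ} (hk : k ≠ 0) {T : Finset Pt} {α : Pt → ℕ} (hα : ∑ y ∈ T, α y = k) :
    ∑ y ∈ T, (α y : ℝ) / (k : ℝ) = 1 := by
  rw [← Finset.sum_div, ← Nat.cast_sum, hα, div_self]
  exact_mod_cast hk

theorem IsTet.bary_node {T : Finset Pt} (h : IsTet T) {k : ℕ} (hk : k ≠ 0) {α : Pt → ℕ}
    (hα : α ∈ T.piAntidiag k) {y : Pt} (hy : y ∈ T) : bary T y (node k T α) = α y / k :=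
  h.bary_apply_sum _ (sum_div_eq_one hk (Finset.mem_piAntidiag.1 hα).1) hy

theorem IsTet.node_mem_cell {T : Finset Pt} (h : IsTet T) {k : ℕ} (hk : k ≠ 0) {α : Pt → ℕ}
    (hα : α ∈ T.piAntidiag k) : node k T α ∈ cell T := by
  rw [h.mem_cell_iff]
  intro y hy
  rw [h.bary_node hk hα hy]
  positivity

/-- The Lagrange basis polynomial of order `k` associated with the node `node k T α`. -/
def lagrangePoly (k : ℕ) (T : Finset Pt) (α : Pt → ℕ) : MvPolynomial (Fin 3) ℝ :=
  ∏ y ∈ T, ∏ j ∈ Finset.range (α y),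
    C (1 / ((j : ℝ) + 1)) * (C (k : ℝ) * affPoly (bary T y) - C (j : ℝ))

theorem polyFun_lagrangePoly (k : ℕ) (T : Finset Pt) (α : Pt → ℕ) (x : Pt) :
    polyFun (lagrangePoly k T α) x = ∏ y ∈ T, binom (k * bary T y x) (α y) := by
  unfold lagrangePoly binom
  simp only [polyFun_prod]
  refine Finset.prod_congr rfl fun y _ => Finset.prod_congr rfl fun j _ => ?_
  have h := polyFun_affPoly (bary T y) x
  unfold polyFun at h ⊢
  simp only [map_mul, map_sub, eval_C, h]
  ring

theorem totalDegree_lagrangePoly_le {k : ℕ} {T : Finset Pt} {α : Pt → ℕ}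
    (hα : α ∈ T.piAntidiag k) : (lagrangePoly k T α).totalDegree ≤ k := by
  have h1 : ∀ y ∈ T, (∏ j ∈ Finset.range (α y), C (1 / ((j : ℝ) + 1)) *
      (C (k : ℝ) * affPoly (bary T y) - C (j : ℝ))).totalDegree ≤ α y := by
    intro y _
    refine (totalDegree_finsetProd _ _).trans ?_
    refine (Finset.sum_le_card_nsmul _ _ 1 fun j _ => ?_).trans (by simp)
    refine (totalDegree_mul _ _).trans ?_
    rw [totalDegree_C, zero_add]
    refine (totalDegree_sub _ _).trans (max_le ?_ ((totalDegree_C _).trans_le zero_le_one))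
    refine (totalDegree_mul _ _).trans ?_
    rw [totalDegree_C, zero_add]
    exact totalDegree_affPoly _
  refine (totalDegree_finsetProd _ _).trans ((Finset.sum_le_sum h1).trans ?_)
  exact (Finset.mem_piAntidiag.1 hα).1.le

theorem IsTet.lagrangePoly_node_self {T : Finset Pt} (h : IsTet T) {k : ℕ} (hk : k ≠ 0)
    {α : Pt → ℕ} (hα : α ∈ T.piAntidiag k) :
    polyFun (lagrangePoly k T α) (node k T α) = 1 := by
  rw [polyFun_lagrangePoly]
  refine Finset.prod_eq_one fun y hy => ?_
  have hk' : (k : ℝ) ≠ 0 := by exact_mod_cast hk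
  rw [h.bary_node hk hα hy, mul_div_cancel₀ _ hk', binom_self]

/-- Distinct multi-indices of equal sum satisfy `β y < α y` for some `y`, and the binomial factor at
`y` then vanishes at the node of `β`. -/
theorem IsTet.lagrangePoly_node_ne {T : Finset Pt} (h : IsTet T) {k : ℕ} (hk : k ≠ 0)
    {α β : Pt → ℕ} (hα : α ∈ T.piAntidiag k) (hβ : β ∈ T.piAntidiag k) (hαβ : α ≠ β) :
    polyFun (lagrangePoly k T α) (node k T β) = 0 := by
  rw [polyFun_lagrangePoly]
  have hk' : (k : ℝ) ≠ 0 := by exact_mod_cast hk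
  obtain ⟨y, hy, hlt⟩ : ∃ y ∈ T, β y < α y := by
    by_contra! hcon
    refine hαβ (funext fun y => ?_)
    rw [Finset.mem_piAntidiag] at hα hβ
    by_cases hy : y ∈ T
    · exact (Finset.sum_eq_sum_iff_of_le hcon).1 (hα.1.trans hβ.1.symm) y hy
    · rw [not_imp_comm.1 (hα.2 y) hy, not_imp_comm.1 (hβ.2 y) hy]
  refine Finset.prod_eq_zero hy ?_
  rw [h.bary_node hk hβ hy, mul_div_cancel₀ _ hk', binom_of_lt hlt]

theorem lagrangePoly_eq_zero (k : ℕ) {T : Finset Pt} {α : Pt → ℕ} {x y : Pt} (hy : y ∈ T)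
    (hx : bary T y x = 0) (hα : α y ≠ 0) : polyFun (lagrangePoly k T α) x = 0 := by
  rw [polyFun_lagrangePoly]
  refine Finset.prod_eq_zero hy ?_
  rw [hx, mul_zero]
  exact_mod_cast binom_of_lt (m := 0) (Nat.pos_of_ne_zero hα)

/-- The Lagrange interpolation polynomial of order `k` with given values at the nodes of `T`. -/
def interp (k : ℕ) (T : Finset Pt) (c : (Pt → ℕ) → ℝ) : MvPolynomial (Fin 3) ℝ :=
  ∑ α ∈ T.piAntidiag k, c α • lagrangePoly k T α

theorem polyFun_interp (k : ℕ) (T : Finset Pt) (c : (Pt → ℕ) → ℝ) (x : Pt) :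
    polyFun (interp k T c) x =
      ∑ α ∈ T.piAntidiag k, c α * polyFun (lagrangePoly k T α) x := by
  simp only [interp, polyFun_sum, polyFun_smul]

theorem totalDegree_interp_le (k : ℕ) (T : Finset Pt) (c : (Pt → ℕ) → ℝ) :
    (interp k T c).totalDegree ≤ k :=
  totalDegree_finsetSum_le fun _ hα =>
    (totalDegree_smul_le _ _).trans (totalDegree_lagrangePoly_le hα)

theorem IsTet.interp_node {T : Finset Pt} (h : IsTet T) {k : ℕ} (hk : k ≠ 0)
    (c : (Pt → ℕ) → ℝ) {β : Pt → ℕ} (hβ : β ∈ T.piAntidiag k) :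
    polyFun (interp k T c) (node k T β) = c β := by
  rw [polyFun_interp, Finset.sum_eq_single β]
  · rw [h.lagrangePoly_node_self hk hβ, mul_one]
  · intro α hα hαβ
    rw [h.lagrangePoly_node_ne hk hα hβ hαβ, mul_zero]
  · exact fun hh => absurd hβ hh

/-- Evaluation of polynomials of degree at most `k` at points indexed by the nodes of `T`. -/
def evalAt (k : ℕ) (T : Finset Pt) (X : (Pt → ℕ) → Pt) :
    PolyLE k →ₗ[ℝ] (T.piAntidiag k → ℝ) where
  toFun p α := polyFun p.1 (X α)
  map_add' p q := by
    funext α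
    exact polyFun_add _ _ _
  map_smul' c p := by
    funext α
    exact polyFun_smul _ _ _

theorem IsTet.evalAt_node_surjective {T : Finset Pt} (h : IsTet T) {k : ℕ} (hk : k ≠ 0) :
    Function.Surjective (evalAt k T (node k T)) := by
  intro c
  refine ⟨⟨interp k T fun α => if hα : α ∈ T.piAntidiag k then c ⟨α, hα⟩ else 0,
    mem_polyLE.2 (totalDegree_interp_le _ _ _)⟩, ?_⟩
  funext β
  have := h.interp_node hk (fun α => if hα : α ∈ T.piAntidiag k then c ⟨α, hα⟩ else 0) β.2
  simp only [β.2, dif_pos] at this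
  exact this

/-- One inequality is surjectivity of nodal evaluation. For the other, exponents of degree at most
`k` inject into nodes: the slack `k - |m|` goes to one vertex and the exponents to the other three.
-/
theorem IsTet.finrank_polyLE_eq {T : Finset Pt} (h : IsTet T) {k : ℕ} (hk : k ≠ 0) :
    Module.finrank ℝ (PolyLE k) = Module.finrank ℝ (T.piAntidiag k → ℝ) := by
  refine le_antisymm ?_ (LinearMap.finrank_le_finrank_of_surjective
    (h.evalAt_node_surjective hk))
  rw [finrank_polyLE, Module.finrank_fintype_fun_eq_card, ← Nat.card_eq_fintype_card]
  let e : T ≃ Fin 4 := Finset.equivFinOfCardEq h.1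
  let f : (Fin 3 →₀ ℕ) → Pt → ℕ := fun m y =>
    if hy : y ∈ T then (Fin.cons (k - m.sum fun _ e => e) m : Fin 4 → ℕ) (e ⟨y, hy⟩) else 0
  have hf : ∀ m : {m : Fin 3 →₀ ℕ | (m.sum fun _ e => e) ≤ k}, f m ∈ T.piAntidiag k := by
    rintro ⟨m, hm⟩
    rw [Finset.mem_piAntidiag]
    constructor
    · rw [← Finset.sum_coe_sort]
      have h1 : ∀ y : T, f m y = (Fin.cons (k - m.sum fun _ e => e) m : Fin 4 → ℕ) (e y) := by
        intro y
        simp only [f, y.2, dif_pos]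
      rw [Finset.sum_congr rfl fun y _ => h1 y,
        e.sum_comp (Fin.cons (k - m.sum fun _ e => e) m : Fin 4 → ℕ), Fin.sum_univ_succ]
      simp only [Fin.cons_zero, Fin.cons_succ]
      rw [Set.mem_ofPred_eq, Finsupp.sum_fintype _ _ (by simp)] at hm
      rw [Finsupp.sum_fintype _ _ (by simp)]
      omega
    · intro y hy
      by_contra hyT
      exact hy (by simp only [f, hyT, dif_neg, not_false_eq_true])
  refine Nat.card_le_card_of_injective (fun m => (⟨f m, hf m⟩ : T.piAntidiag k)) ?_
  intro m m' hmm
  have h2 : f m = f m' := congrArg Subtype.val hmm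
  refine Subtype.ext (Finsupp.ext fun i => ?_)
  have h3 := congrFun h2 (e.symm i.succ)
  simpa [f] using h3

theorem IsTet.evalAt_bijective_of_injective {T : Finset Pt} (h : IsTet T) {k : ℕ} (hk : k ≠ 0)
    {X : (Pt → ℕ) → Pt} (hX : Function.Injective (evalAt k T X)) :
    Function.Bijective (evalAt k T X) :=
  ⟨hX, (LinearMap.injective_iff_surjective_of_finrank_eq_finrank (h.finrank_polyLE_eq hk)).1 hX⟩

theorem IsTet.evalAt_node_injective {T : Finset Pt} (h : IsTet T) {k : ℕ} (hk : k ≠ 0) :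
    Function.Injective (evalAt k T (node k T)) :=
  (LinearMap.injective_iff_surjective_of_finrank_eq_finrank (h.finrank_polyLE_eq hk)).2
    (h.evalAt_node_surjective hk)

/-- Polynomials of degree at most `k` are determined by their values at the Lagrangian nodes. -/
theorem IsTet.eq_of_node {T : Finset Pt} (h : IsTet T) {k : ℕ} (hk : k ≠ 0)
    {p q : MvPolynomial (Fin 3) ℝ} (hp : p.totalDegree ≤ k) (hq : q.totalDegree ≤ k)
    (hpq : ∀ α ∈ T.piAntidiag k, polyFun p (node k T α) = polyFun q (node k T α)) : p = q := by
  have := @h.evalAt_node_injective _ k hk ⟨p, mem_polyLE.2 hp⟩ ⟨q, mem_polyLE.2 hq⟩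
    (funext fun α => hpq α α.2)
  exact congrArg Subtype.val this

/-! ### Dirichlet energy and displacement of nodes on a fixed tetrahedron. -/

/-- The Dirichlet energy of a polynomial on the tetrahedron `T`. -/
def energy (T : Finset Pt) (p : MvPolynomial (Fin 3) ℝ) : ℝ :=
  ∫ x in interior (cell T), ‖gradient (polyFun p) x‖ ^ 2

theorem integrableOn_cell_of_continuous (T : Finset Pt) {f : Pt → ℝ} (hf : Continuous f) :
    IntegrableOn f (interior (cell T)) :=
  (hf.continuousOn.integrableOn_compact (isCompact_cell T)).mono_set interior_subset

theorem integrableOn_inner_gradient (T : Finset Pt) (p q : MvPolynomial (Fin 3) ℝ) :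
    IntegrableOn (fun x => inner ℝ (gradient (polyFun p) x) (gradient (polyFun q) x))
      (interior (cell T)) :=
  integrableOn_cell_of_continuous T
    ((continuous_gradient_polyFun p).inner (continuous_gradient_polyFun q))

theorem integrableOn_norm_gradient_sq (T : Finset Pt) (p : MvPolynomial (Fin 3) ℝ) :
    IntegrableOn (fun x => ‖gradient (polyFun p) x‖ ^ 2) (interior (cell T)) :=
  integrableOn_cell_of_continuous T ((continuous_gradient_polyFun p).norm.pow 2)

theorem energy_nonneg (T : Finset Pt) (p : MvPolynomial (Fin 3) ℝ) : 0 ≤ energy T p :=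
  integral_nonneg fun _ => by positivity

theorem gradient_polyFun_C (c : ℝ) (x : Pt) : gradient (polyFun (C c)) x = 0 := by
  have : polyFun (C c) = fun _ => c := by
    funext x
    exact polyFun_C c x
  rw [this]
  simp [gradient]

/-- A polynomial with zero energy is constant. -/
theorem IsTet.eq_C_of_energy_eq_zero {T : Finset Pt} (h : IsTet T) {p : MvPolynomial (Fin 3) ℝ}
    (hp : energy T p = 0) : ∃ c : ℝ, p = C c := by
  have h1 : (fun x => ‖gradient (polyFun p) x‖ ^ 2) =ᵐ[volume.restrict (interior (cell T))] 0 :=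
    (setIntegral_eq_zero_iff_of_nonneg_ae (ae_of_all _ fun _ => by positivity)
      (integrableOn_norm_gradient_sq T p)).1 hp
  have h2 : Set.EqOn (fun x => ‖gradient (polyFun p) x‖ ^ 2) 0 (interior (cell T)) :=
    Measure.eqOn_open_of_ae_eq h1 isOpen_interior
      ((continuous_gradient_polyFun p).norm.pow 2).continuousOn continuousOn_const
  have hconv : Convex ℝ (interior (cell T)) := (convex_convexHull ℝ _).interior
  have h3 : Set.EqOn (fderiv ℝ (polyFun p)) 0 (interior (cell T)) := by
    intro x hx
    have h4 := h2 hx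
    simp only [Pi.zero_apply] at h4
    rw [norm_gradient] at h4
    simpa using h4
  obtain ⟨x0, hx0⟩ := h.exists_interior_point
  -- Interpolation needs a nonzero order, hence the `+ 1`, in case `p` already has degree zero.
  refine ⟨polyFun p x0, h.eq_of_node (k := p.totalDegree + 1) (by omega) (by omega) (by simp)
    fun α hα => ?_⟩
  rw [polyFun_C]
  have h5 : Set.EqOn (polyFun p) (fun _ => polyFun p x0) (interior (cell T)) := fun x hx =>
    isOpen_interior.is_const_of_fderiv_eq_zero hconv.isPreconnected
      (polyFun_differentiable p).differentiableOn h3 hx hx0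
  have h6 := h5.closure (polyFun_continuous p) continuous_const
  rw [h.closure_interior_cell] at h6
  exact h6 (h.node_mem_cell (by omega) hα)

/-- The Dirichlet form on the space of polynomials of degree at most `k`. -/
def dirichletForm (k : ℕ) (T : Finset Pt) : LinearMap.BilinForm ℝ (PolyLE k) :=
  LinearMap.mk₂ ℝ
    (fun p q => ∫ x in interior (cell T),
      inner ℝ (gradient (polyFun p.1) x) (gradient (polyFun q.1) x))
    (fun p p' q => by
      simp only [Submodule.coe_add, gradient_polyFun_add, inner_add_left]
      rw [integral_add (integrableOn_inner_gradient T _ _) (integrableOn_inner_gradient T _ _)])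
    (fun c p q => by
      simp only [Submodule.coe_smul, gradient_polyFun_smul, real_inner_smul_left]
      rw [integral_const_mul, smul_eq_mul])
    (fun p q q' => by
      simp only [Submodule.coe_add, gradient_polyFun_add, inner_add_right]
      rw [integral_add (integrableOn_inner_gradient T _ _) (integrableOn_inner_gradient T _ _)])
    (fun c p q => by
      simp only [Submodule.coe_smul, gradient_polyFun_smul, real_inner_smul_right]
      rw [integral_const_mul, smul_eq_mul])

theorem dirichletForm_apply (k : ℕ) (T : Finset Pt) (p q : PolyLE k) :
    dirichletForm k T p q = ∫ x in interior (cell T),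
      inner ℝ (gradient (polyFun p.1) x) (gradient (polyFun q.1) x) := rfl

/-- The inner product on polynomials given by the Dirichlet form and the value at a point. -/
def energyForm (k : ℕ) (T : Finset Pt) (x0 : Pt) : LinearMap.BilinForm ℝ (PolyLE k) :=
  LinearMap.mk₂ ℝ
    (fun p q => dirichletForm k T p q + polyFun p.1 x0 * polyFun q.1 x0)
    (fun p p' q => by
      simp only [map_add, LinearMap.add_apply, Submodule.coe_add, polyFun_add]
      ring)
    (fun c p q => by
      simp only [map_smul, LinearMap.smul_apply, Submodule.coe_smul, polyFun_smul, smul_eq_mul]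
      ring)
    (fun p q q' => by
      simp only [map_add, Submodule.coe_add, polyFun_add]
      ring)
    (fun c p q => by
      simp only [map_smul, Submodule.coe_smul, polyFun_smul, smul_eq_mul]
      ring)

theorem energyForm_self (k : ℕ) (T : Finset Pt) (x0 : Pt) (p : PolyLE k) :
    energyForm k T x0 p p = energy T p.1 + polyFun p.1 x0 ^ 2 := by
  simp only [energyForm, LinearMap.mk₂_apply, dirichletForm_apply, energy, real_inner_self_eq_norm_sq, sq]

theorem energyForm_comm (k : ℕ) (T : Finset Pt) (x0 : Pt) (p q : PolyLE k) :
    energyForm k T x0 p q = energyForm k T x0 q p := by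
  simp only [energyForm, LinearMap.mk₂_apply, dirichletForm_apply, mul_comm, real_inner_comm]

/-- Linear functionals are bounded with respect to the energy inner product. -/
theorem IsTet.exists_functional_bound {T : Finset Pt} (h : IsTet T) (k : ℕ) (x0 : Pt)
    (l : PolyLE k →ₗ[ℝ] ℝ) :
    ∃ K : ℝ, 0 ≤ K ∧ ∀ p : PolyLE k, l p ^ 2 ≤ K * (energy T p.1 + polyFun p.1 x0 ^ 2) := by
  set B := energyForm k T x0 with hB
  have hnn : ∀ p, 0 ≤ B p p := fun p => by
    rw [energyForm_self]
    exact add_nonneg (energy_nonneg _ _) (sq_nonneg _)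
  -- The form is definite: zero energy forces a constant, and the value at `x0` forces this constant
  -- to be zero.
  have hinj : Function.Injective (B : PolyLE k →ₗ[ℝ] (PolyLE k →ₗ[ℝ] ℝ)) := by
    rw [← LinearMap.ker_eq_bot, LinearMap.ker_eq_bot']
    intro p hp
    have h0 : B p p = 0 := by rw [hp, LinearMap.zero_apply]
    rw [energyForm_self] at h0
    have h1 := energy_nonneg T p.1
    have h2 := sq_nonneg (polyFun p.1 x0)
    obtain ⟨c, hc⟩ := h.eq_C_of_energy_eq_zero (p := p.1) (by linarith)
    have h3 : polyFun p.1 x0 ^ 2 = 0 := by linarith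
    rw [hc, polyFun_C] at h3
    apply Subtype.ext
    rw [hc, pow_eq_zero_iff two_ne_zero |>.1 h3]
    simp
  have hsurj := (LinearMap.injective_iff_surjective_of_finrank_eq_finrank
    (Subspace.dual_finrank_eq (K := ℝ) (V := PolyLE k)).symm).1 hinj
  -- The Riesz representative of `l`; Cauchy–Schwarz gives the constant `B z z`.
  obtain ⟨z, hz⟩ := hsurj l
  refine ⟨B z z, hnn z, fun p => ?_⟩
  have h1 := LinearMap.BilinForm.apply_mul_apply_le_of_forall_zero_le B hnn z p
  rw [← energyForm_self, ← hB, ← hz, sq]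
  rwa [energyForm_comm k T x0 p z] at h1

theorem energy_sub_C (T : Finset Pt) (p : MvPolynomial (Fin 3) ℝ) (c : ℝ) :
    energy T (p - C c) = energy T p := by
  simp only [energy, gradient_polyFun_sub, gradient_polyFun_C, sub_zero]

/-- Polynomials of bounded energy and degree are equicontinuous. -/
theorem IsTet.exists_eval_sub_le {T : Finset Pt} (h : IsTet T) (k : ℕ) (x : Pt) {η : ℝ}
    (hη : 0 < η) : ∃ δ > 0, ∀ p : MvPolynomial (Fin 3) ℝ, p.totalDegree ≤ k → ∀ X : Pt,
      dist X x < δ → |polyFun p x - polyFun p X| ≤ η * √(energy T p) := by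
  let b := Module.finBasis ℝ (PolyLE k)
  choose K hK0 hK using fun i => h.exists_functional_bound k x (b.coord i)
  -- `F X` bounds the change of value from `x` to `X` per unit of `√(energy T p)`. It is continuous
  -- and vanishes at `x`, which yields `δ`.
  set F : Pt → ℝ := fun X => ∑ i, √(K i) * |polyFun (b i).1 x - polyFun (b i).1 X| with hF
  have hFc : Continuous F := by
    refine continuous_finsetSum _ fun i _ => ?_
    exact continuous_const.mul (continuous_const.sub (polyFun_continuous _)).abs
  have hF0 : F x = 0 := by simp [hF]
  obtain ⟨δ, hδ, hball⟩ := Metric.continuous_iff.1 hFc x η hη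
  refine ⟨δ, hδ, fun p hp X hX => ?_⟩
  have h1 : F X ≤ η := by
    have := hball X hX
    rw [hF0, Real.dist_eq, sub_zero] at this
    exact (le_abs_self _).trans this.le
  -- Removing the value at `x` changes neither the energy nor differences of values, and leaves only
  -- the energy in the bound on coefficients.
  set q : PolyLE k := ⟨p - C (polyFun p x), mem_polyLE.2
    ((totalDegree_sub_C_le _ _).trans hp)⟩ with hq
  have hqE : energy T q.1 = energy T p := energy_sub_C T p _
  have hqx : polyFun q.1 x = 0 := by simp [hq, polyFun_sub, polyFun_C]
  have hc : ∀ i, |b.coord i q| ≤ √(K i) * √(energy T p) := by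
    intro i
    rw [← Real.sqrt_mul (hK0 i)]
    refine Real.le_sqrt_of_sq_le ?_
    have := hK i q
    rw [hqE, hqx] at this
    simpa using this
  have hsum : ∀ y, polyFun q.1 y = ∑ i, b.coord i q * polyFun (b i).1 y := by
    intro y
    have h2 := congrArg Subtype.val (b.sum_repr q)
    rw [← h2]
    simp only [Submodule.coe_sum, Submodule.coe_smul, polyFun_sum, polyFun_smul,
      Module.Basis.coord_apply]
  have h3 : polyFun p x - polyFun p X =
      ∑ i, b.coord i q * (polyFun (b i).1 x - polyFun (b i).1 X) := by
    simp only [mul_sub, Finset.sum_sub_distrib, ← hsum]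
    simp [hq, polyFun_sub, polyFun_C]
  rw [h3]
  calc |∑ i, b.coord i q * (polyFun (b i).1 x - polyFun (b i).1 X)|
      ≤ ∑ i, |b.coord i q * (polyFun (b i).1 x - polyFun (b i).1 X)| :=
        Finset.abs_sum_le_sum_abs _ _
    _ ≤ ∑ i, √(K i) * |polyFun (b i).1 x - polyFun (b i).1 X| * √(energy T p) := by
        refine Finset.sum_le_sum fun i _ => ?_
        rw [abs_mul]
        calc _ ≤ (√(K i) * √(energy T p)) * |polyFun (b i).1 x - polyFun (b i).1 X| :=
              mul_le_mul_of_nonneg_right (hc i) (abs_nonneg _)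
          _ = _ := by ring
    _ = F X * √(energy T p) := by rw [← Finset.sum_mul]
    _ ≤ η * √(energy T p) := mul_le_mul_of_nonneg_right h1 (Real.sqrt_nonneg _)

theorem gradient_polyFun_sum {ι : Type*} (s : Finset ι) (p : ι → MvPolynomial (Fin 3) ℝ) (x : Pt) :
    gradient (polyFun (∑ i ∈ s, p i)) x = ∑ i ∈ s, gradient (polyFun (p i)) x := by
  induction s using Finset.induction_on with
  | empty =>
    have := gradient_polyFun_C 0 x
    rw [map_zero] at this
    simpa using this
  | insert i s hi ih => rw [Finset.sum_insert hi, Finset.sum_insert hi, gradient_polyFun_add, ih]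

/-- Polynomials whose nodal values at slightly displaced nodes agree are close in energy; version
with constants depending on the tetrahedron. -/
theorem IsTet.exists_energy_sub_le {T : Finset Pt} (h : IsTet T) {k : ℕ} (hk : k ≠ 0) {η : ℝ}
    (hη : 0 < η) : ∃ δ > 0, ∀ p q : MvPolynomial (Fin 3) ℝ, p.totalDegree ≤ k →
      q.totalDegree ≤ k → ∀ X : (Pt → ℕ) → Pt,
      (∀ α ∈ T.piAntidiag k, dist (X α) (node k T α) < δ) →
      (∀ α ∈ T.piAntidiag k, polyFun q (node k T α) = polyFun p (X α)) →
      energy T (p - q) ≤ η * energy T p := by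
  set G : Pt → ℝ := fun x => ∑ α ∈ T.piAntidiag k, ‖gradient (polyFun (lagrangePoly k T α)) x‖
    with hG
  have hGc : Continuous G :=
    continuous_finsetSum _ fun i _ => (continuous_gradient_polyFun _).norm
  set I : ℝ := ∫ x in interior (cell T), G x ^ 2 with hI
  have hI0 : 0 ≤ I := integral_nonneg fun _ => by positivity
  -- Chosen so that `η' ^ 2 * I ≤ η`; the `+ 1` avoids dividing by zero.
  set η' : ℝ := √(η / (I + 1)) with hη'
  have hη'0 : 0 < η' := Real.sqrt_pos.2 (by positivity)
  have hη'I : η' ^ 2 * I ≤ η := by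
    rw [hη', Real.sq_sqrt (by positivity), div_mul_eq_mul_div, div_le_iff₀ (by positivity)]
    nlinarith
  choose δ hδ0 hδ using fun α => h.exists_eval_sub_le k (node k T α) hη'0
  obtain ⟨δ', hδ'0, hδ'⟩ : ∃ δ' > 0, ∀ α ∈ T.piAntidiag k, δ' ≤ δ α := by
    by_cases hne : (T.piAntidiag k).Nonempty
    · exact ⟨(T.piAntidiag k).inf' hne δ, (Finset.lt_inf'_iff hne).2 fun α _ => hδ0 α,
        fun α hα => Finset.inf'_le _ hα⟩
    · exact ⟨1, one_pos, fun α hα => absurd ⟨α, hα⟩ hne⟩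
  refine ⟨δ', hδ'0, fun p q hp hq X hX hpq => ?_⟩
  set E := energy T p with hE
  have hE0 : 0 ≤ E := energy_nonneg T p
  set c : (Pt → ℕ) → ℝ := fun α => polyFun p (node k T α) - polyFun p (X α) with hc
  have hcle : ∀ α ∈ T.piAntidiag k, |c α| ≤ η' * √E := fun α hα =>
    hδ α p hp (X α) ((hX α hα).trans_le (hδ' α hα))
  -- The difference interpolates the defects `c α`, so its gradient is bounded by these defects
  -- times the gradients of the basis polynomials.
  have hr : p - q = interp k T c := by
    refine h.eq_of_node hk ((totalDegree_sub _ _).trans (max_le hp hq))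
      (totalDegree_interp_le _ _ _) fun α hα => ?_
    rw [h.interp_node hk c hα, polyFun_sub, hpq α hα]
  have hbound : ∀ x, ‖gradient (polyFun (p - q)) x‖ ^ 2 ≤ η' ^ 2 * E * G x ^ 2 := by
    intro x
    have h1 : ‖gradient (polyFun (p - q)) x‖ ≤ η' * √E * G x := by
      rw [hr, interp, gradient_polyFun_sum, hG, Finset.mul_sum]
      refine (norm_sum_le _ _).trans (Finset.sum_le_sum fun α hα => ?_)
      rw [gradient_polyFun_smul, norm_smul]
      exact mul_le_mul_of_nonneg_right (hcle α hα) (norm_nonneg _)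
    calc ‖gradient (polyFun (p - q)) x‖ ^ 2 ≤ (η' * √E * G x) ^ 2 :=
          pow_le_pow_left₀ (norm_nonneg _) h1 2
      _ = η' ^ 2 * E * G x ^ 2 := by rw [mul_pow, mul_pow, Real.sq_sqrt hE0]
  calc energy T (p - q) ≤ ∫ x in interior (cell T), η' ^ 2 * E * G x ^ 2 :=
        setIntegral_mono (integrableOn_norm_gradient_sq T _)
          (integrableOn_cell_of_continuous T (by fun_prop)) hbound
    _ = η' ^ 2 * E * I := integral_const_mul _ _
    _ = η' ^ 2 * I * E := by ring
    _ ≤ η * E := mul_le_mul_of_nonneg_right hη'I hE0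

/-! ### Affine transfer and the uniform displacement bound. -/

/-- The affine map carrying the barycentric coordinates of `S` to those of `T`, where the vertex
`y` of `T` corresponds to the vertex `ψ y` of `S`. -/
def transfer (S T : Finset Pt) (ψ : Pt → Pt) : Pt →ᵃ[ℝ] Pt where
  toFun x := ∑ y ∈ T, bary S (ψ y) x • y
  linear := ∑ y ∈ T, (bary S (ψ y)).linear.smulRight y
  map_vadd' x u := by
    simp only [vadd_eq_add, add_comm u x, bary_add, add_smul, Finset.sum_add_distrib,
      LinearMap.sum_apply, LinearMap.smulRight_apply]
    rw [add_comm]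

theorem transfer_apply (S T : Finset Pt) (ψ : Pt → Pt) (x : Pt) :
    transfer S T ψ x = ∑ y ∈ T, bary S (ψ y) x • y := rfl

theorem transfer_linear_apply (S T : Finset Pt) (ψ : Pt → Pt) (u : Pt) :
    (transfer S T ψ).linear u = ∑ y ∈ T, (bary S (ψ y)).linear u • y := by
  simp [transfer]

theorem sum_comp_bijOn {S T : Finset Pt} {ψ : Pt → Pt} (hψ : Set.BijOn ψ T S)
    {M : Type*} [AddCommMonoid M] (f : Pt → M) : ∑ y ∈ T, f (ψ y) = ∑ y ∈ S, f y := by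
  refine Finset.sum_bij (fun y _ => ψ y) (fun y hy => ?_) (fun y hy z hz hyz => ?_)
    (fun z hz => ?_) fun _ _ => rfl
  · exact_mod_cast hψ.mapsTo (by exact_mod_cast hy)
  · exact hψ.injOn (by exact_mod_cast hy) (by exact_mod_cast hz) hyz
  · obtain ⟨y, hy, hyz⟩ := hψ.surjOn (by exact_mod_cast hz)
    exact ⟨y, by exact_mod_cast hy, hyz⟩

theorem bary_transfer {S T : Finset Pt} (hS : IsTet S) (hT : IsTet T) {ψ : Pt → Pt}
    (hψ : Set.BijOn ψ T S) {y : Pt} (hy : y ∈ T) (x : Pt) :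
    bary T y (transfer S T ψ x) = bary S (ψ y) x :=
  hT.bary_apply_sum (fun y => bary S (ψ y) x)
    ((sum_comp_bijOn hψ fun y => bary S y x).trans (hS.sum_bary x)) hy

theorem transfer_transfer {S T : Finset Pt} (hS : IsTet S) (hT : IsTet T) {φ ψ : Pt → Pt}
    (hψ : Set.BijOn ψ T S) (hφ : Set.BijOn φ S T) (hinv : ∀ y ∈ S, ψ (φ y) = y) (x : Pt) :
    transfer T S φ (transfer S T ψ x) = x := by
  rw [transfer_apply T S φ]
  conv_rhs => rw [← hS.sum_bary_smul x]
  refine Finset.sum_congr rfl fun y hy => ?_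
  have h1 : φ y ∈ T := by exact_mod_cast hφ.mapsTo (by exact_mod_cast hy)
  rw [bary_transfer hS hT hψ h1, hinv y hy]

/-- The coefficients of the vertices sum to zero, so the vertices may be replaced by differences, of
length at most the diameter. -/
theorem norm_transfer_linear_le {S T : Finset Pt} (hS : IsTet S) (hT : IsTet T) {ψ : Pt → Pt}
    (hψ : Set.BijOn ψ T S) {K : ℝ} (hK : ∀ y ∈ S, ∀ u, |(bary S y).linear u| ≤ K * ‖u‖) (u : Pt) :
    ‖(transfer S T ψ).linear u‖ ≤ 4 * K * Metric.diam (cell T) * ‖u‖ := by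
  obtain ⟨y0, hy0⟩ : T.Nonempty := Finset.card_pos.1 (by rw [hT.1]; norm_num)
  have h0 : ∑ y ∈ T, (bary S (ψ y)).linear u = 0 := by
    rw [sum_comp_bijOn hψ fun y => (bary S y).linear u]
    have h1 := hS.sum_bary (0 + u)
    simp only [bary_add, Finset.sum_add_distrib, hS.sum_bary] at h1
    linarith
  have h1 : (transfer S T ψ).linear u = ∑ y ∈ T, (bary S (ψ y)).linear u • (y - y0) := by
    rw [transfer_linear_apply]
    simp only [smul_sub, Finset.sum_sub_distrib, ← Finset.sum_smul, h0, zero_smul, sub_zero]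
  rw [h1]
  refine (norm_sum_le _ _).trans ((Finset.sum_le_card_nsmul T _
    (K * ‖u‖ * Metric.diam (cell T)) fun y hy => ?_).trans (le_of_eq ?_))
  · rw [norm_smul, ← dist_eq_norm, Real.norm_eq_abs]
    have h2 : ψ y ∈ S := by exact_mod_cast hψ.mapsTo (by exact_mod_cast hy)
    exact mul_le_mul (hK _ h2 u) (dist_le_diam_cell (mem_cell_of_mem hy) (mem_cell_of_mem hy0))
      dist_nonneg ((abs_nonneg _).trans (hK _ h2 u))
  · rw [hT.1, nsmul_eq_mul]
    push_cast
    ring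

theorem hasFDerivAt_affine (A : Pt →ᵃ[ℝ] Pt) (x : Pt) :
    HasFDerivAt A (LinearMap.toContinuousLinearMap A.linear) x := by
  have h1 : (A : Pt → Pt) = fun x => LinearMap.toContinuousLinearMap A.linear x + A 0 := by
    funext z
    have := A.map_vadd 0 z
    simpa using this
  rw [h1]
  exact (ContinuousLinearMap.hasFDerivAt _).add_const _

theorem norm_gradient_compAffine_le (p : MvPolynomial (Fin 3) ℝ) (A : Pt →ᵃ[ℝ] Pt) {a : ℝ}
    (ha : 0 ≤ a) (hA : ∀ u, ‖A.linear u‖ ≤ a * ‖u‖) (x : Pt) :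
    ‖gradient (polyFun (compAffine p A)) x‖ ≤ a * ‖gradient (polyFun p) (A x)‖ := by
  have h1 : polyFun (compAffine p A) = polyFun p ∘ A := by
    funext z
    exact polyFun_compAffine p A z
  rw [norm_gradient, norm_gradient, h1,
    fderiv_comp x (polyFun_differentiable p _) (hasFDerivAt_affine A x).differentiableAt,
    (hasFDerivAt_affine A x).fderiv]
  refine (ContinuousLinearMap.opNorm_comp_le _ _).trans ?_
  rw [mul_comm]
  exact mul_le_mul_of_nonneg_right (ContinuousLinearMap.opNorm_le_bound _ ha hA) (norm_nonneg _)

/-- Integrals on the interiors of two tetrahedra are proportional under the affine transfer map. -/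
theorem exists_integral_transfer {S T : Finset Pt} (hS : IsTet S) (hT : IsTet T) {φ ψ : Pt → Pt}
    (hψ : Set.BijOn ψ T S) (hφ : Set.BijOn φ S T) (hinv : ∀ y ∈ S, ψ (φ y) = y)
    (hinv' : ∀ y ∈ T, φ (ψ y) = y) :
    ∃ D : ℝ, 0 ≤ D ∧ ∀ f : Pt → ℝ, ∫ x in interior (cell T), f x =
      D * ∫ x in interior (cell S), f (transfer S T ψ x) := by
  set A := transfer S T ψ with hA
  have himg : interior (cell T) = A '' interior (cell S) := by
    rw [hS.interior_cell, hT.interior_cell]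
    ext x
    constructor
    · intro hx
      refine ⟨transfer T S φ x, fun y hy => ?_, transfer_transfer hT hS hφ hψ hinv' x⟩
      rw [bary_transfer hT hS hφ hy]
      exact hx _ (by exact_mod_cast hφ.mapsTo (by exact_mod_cast hy))
    · rintro ⟨z, hz, rfl⟩ y hy
      rw [hA, bary_transfer hS hT hψ hy]
      exact hz _ (by exact_mod_cast hψ.mapsTo (by exact_mod_cast hy))
  refine ⟨|(LinearMap.toContinuousLinearMap A.linear).det|, abs_nonneg _, fun f => ?_⟩
  rw [himg, integral_image_eq_integral_abs_det_fderiv_smul volume isOpen_interior.measurableSet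
    (fun x _ => (hasFDerivAt_affine A x).hasFDerivWithinAt)
    (Set.LeftInvOn.injOn (f₁' := transfer T S φ)
      fun x _ => transfer_transfer hS hT hψ hφ hinv x)]
  simp only [smul_eq_mul]
  exact integral_const_mul _ _

theorem transfer_node {S T : Finset Pt} (hS : IsTet S) {ψ : Pt → Pt}
    (hψ : Set.BijOn ψ T S) {k : ℕ} (hk : k ≠ 0) {α β : Pt → ℕ} (hα : α ∈ S.piAntidiag k)
    (hαβ : ∀ y ∈ T, β y = α (ψ y)) : transfer S T ψ (node k S α) = node k T β := by
  rw [transfer_apply]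
  refine Finset.sum_congr rfl fun y hy => ?_
  have h1 : ψ y ∈ S := by exact_mod_cast hψ.mapsTo (by exact_mod_cast hy)
  rw [hS.bary_node hk hα h1, hαβ y hy]

theorem IsTet.exists_bary_linear_bound {T : Finset Pt} :
    ∃ K : ℝ, 0 < K ∧ ∀ y ∈ T, ∀ u, |(bary T y).linear u| ≤ K * ‖u‖ := by
  refine ⟨∑ y ∈ T, ‖LinearMap.toContinuousLinearMap (bary T y).linear‖ + 1, by positivity,
    fun y hy u => ?_⟩
  have h1 := (LinearMap.toContinuousLinearMap (bary T y).linear).le_opNorm u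
  rw [LinearMap.coe_toContinuousLinearMap', Real.norm_eq_abs] at h1
  refine h1.trans (mul_le_mul_of_nonneg_right ?_ (norm_nonneg u))
  have := Finset.single_le_sum (f := fun y => ‖LinearMap.toContinuousLinearMap (bary T y).linear‖)
    (fun _ _ => norm_nonneg _) hy
  linarith

theorem exists_bijOn_of_isTet {S T : Finset Pt} (hS : IsTet S) (hT : IsTet T) :
    ∃ φ ψ : Pt → Pt, Set.BijOn φ S T ∧ Set.BijOn ψ T S ∧ (∀ y ∈ S, ψ (φ y) = y) ∧
      ∀ y ∈ T, φ (ψ y) = y := by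
  let e : S ≃ T := Finset.equivOfCardEq (hS.1.trans hT.1.symm)
  have key : ∀ (S T : Finset Pt) (e : S ≃ T), ∃ φ : Pt → Pt, ∀ y : S, φ y = e y := by
    intro S T e
    refine ⟨fun y => if hy : y ∈ S then e ⟨y, hy⟩ else 0, fun y => ?_⟩
    simp
  obtain ⟨φ, hφ⟩ := key S T e
  obtain ⟨ψ, hψ⟩ := key T S e.symm
  have h1 : ∀ y ∈ S, ψ (φ y) = y := fun y hy => by rw [hφ ⟨y, hy⟩, hψ, e.symm_apply_apply]
  have h2 : ∀ y ∈ T, φ (ψ y) = y := fun y hy => by rw [hψ ⟨y, hy⟩, hφ, e.apply_symm_apply]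
  have h3 : Set.MapsTo φ S T := fun y hy => by
    have := (e ⟨y, hy⟩).2
    rw [← hφ] at this
    exact this
  have h4 : Set.MapsTo ψ T S := fun y hy => by
    have := (e.symm ⟨y, hy⟩).2
    rw [← hψ] at this
    exact this
  exact ⟨φ, ψ, Set.InvOn.bijOn ⟨h1, h2⟩ h3 h4, Set.InvOn.bijOn ⟨h2, h1⟩ h4 h3, h1, h2⟩

/-- On shape regular tetrahedra, two polynomials of degree at most `k` such that the nodal values
of the second are the values of the first at slightly displaced nodes are close in energy. -/
theorem exists_displacement_bound {k : ℕ} (hk : k ≠ 0) {σ : ℝ} (hσ : 0 < σ) :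
    ∃ ε > 0, ∀ T : Finset Pt, IsTet T →
      (∃ c : Pt, Metric.closedBall c (Metric.diam (cell T) / (2 * σ)) ⊆ cell T) →
      ∀ p q : MvPolynomial (Fin 3) ℝ, p.totalDegree ≤ k → q.totalDegree ≤ k →
      ∀ X : (Pt → ℕ) → Pt,
      (∀ α ∈ T.piAntidiag k, dist (X α) (node k T α) ≤ ε * Metric.diam (cell T)) →
      (∀ α ∈ T.piAntidiag k, polyFun q (node k T α) = polyFun p (X α)) →
      energy T (p - q) ≤ 1 / 4 * energy T p := by
  -- Any tetrahedron can serve as the reference one; if there were none, nothing would have to be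
  -- proved.
  by_cases hex : ∃ S : Finset Pt, IsTet S
  swap
  · exact ⟨1, one_pos, fun T hT => absurd ⟨T, hT⟩ hex⟩
  obtain ⟨S, hS⟩ := hex
  obtain ⟨K, hK0, hK⟩ := IsTet.exists_bary_linear_bound (T := S)
  have hdS := hS.diam_pos
  -- The product of the Lipschitz bounds `a` and `a'` of the two transfer maps, in which the
  -- diameter of `T` cancels. The tolerance `1 / 4 / C ^ 2` on `S` becomes `1 / 4` on `T`.
  set C : ℝ := 16 * K * σ * Metric.diam (cell S) with hC
  have hC0 : 0 < C := by positivity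
  obtain ⟨δ, hδ0, hδ⟩ := hS.exists_energy_sub_le hk (η := 1 / 4 / C ^ 2) (by positivity)
  -- The map back to `S` multiplies lengths by at most `a'`, which turns the allowed displacement
  -- into `δ / 2`.
  refine ⟨δ / (8 * σ * Metric.diam (cell S)), by positivity,
    fun T hT hball p q hp hq X hX hpq => ?_⟩
  obtain ⟨c, hc⟩ := hball
  obtain ⟨φ, ψ, hφ, hψ, hi1, hi2⟩ := exists_bijOn_of_isTet hS hT
  have hdT := hT.diam_pos
  set A := transfer S T ψ with hA
  set A' := transfer T S φ with hA'
  have hAA' : ∀ x, A (A' x) = x := transfer_transfer hT hS hφ hψ hi2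
  have hA'A : ∀ x, A' (A x) = x := transfer_transfer hS hT hψ hφ hi1
  set a : ℝ := 4 * K * Metric.diam (cell T) with ha
  set a' : ℝ := 4 * (σ / Metric.diam (cell T)) * Metric.diam (cell S) with ha'
  have ha0 : 0 < a := by positivity
  have ha'0 : 0 < a' := by positivity
  have haa' : a' * a = C := by
    rw [ha, ha', hC]
    field_simp
    norm_num
  have hAn : ∀ u, ‖A.linear u‖ ≤ a * ‖u‖ := norm_transfer_linear_le hS hT hψ hK
  have hA'n : ∀ u, ‖A'.linear u‖ ≤ a' * ‖u‖ :=
    norm_transfer_linear_le hT hS hφ fun y hy => hT.abs_bary_linear_le hσ hc hy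
  set P := compAffine p A with hP
  set Q := compAffine q A with hQ
  let push : (Pt → ℕ) → Pt → ℕ := fun α y => if y ∈ T then α (ψ y) else 0
  have hpush : ∀ α ∈ S.piAntidiag k, push α ∈ T.piAntidiag k := by
    intro α hα
    rw [Finset.mem_piAntidiag] at hα ⊢
    constructor
    · rw [← hα.1, ← sum_comp_bijOn hψ]
      exact Finset.sum_congr rfl fun y hy => if_pos hy
    · intro y hy
      by_contra hyT
      exact hy (if_neg hyT)
  have hnode : ∀ α ∈ S.piAntidiag k, A (node k S α) = node k T (push α) := fun α hα =>
    transfer_node hS hψ hk hα fun y hy => if_pos hy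
  have hmain : energy S (P - Q) ≤ 1 / 4 / C ^ 2 * energy S P := by
    refine hδ P Q ((totalDegree_compAffine_le p A).trans hp)
      ((totalDegree_compAffine_le q A).trans hq) (fun α => A' (X (push α))) (fun α hα => ?_)
      fun α hα => ?_
    · have h1 : node k S α = A' (node k T (push α)) := by rw [← hnode α hα, hA'A]
      have h3 := A'.linearMap_vsub (X (push α)) (node k T (push α))
      simp only [vsub_eq_sub] at h3
      rw [h1, dist_eq_norm, ← h3]
      refine (hA'n _).trans_lt ?_
      have h2 := hX _ (hpush α hα)
      rw [dist_eq_norm] at h2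
      calc a' * ‖X (push α) - node k T (push α)‖
          ≤ a' * (δ / (8 * σ * Metric.diam (cell S)) * Metric.diam (cell T)) :=
            mul_le_mul_of_nonneg_left h2 ha'0.le
        _ = δ / 2 := by
            rw [ha']
            field_simp
            norm_num
        _ < δ := half_lt_self hδ0
    · rw [hP, hQ, polyFun_compAffine, polyFun_compAffine, hAA', hnode α hα]
      exact hpq _ (hpush α hα)
  -- The Jacobian `D` needs no estimate: it is a factor of both energies.
  obtain ⟨D, hD0, hD⟩ := exists_integral_transfer hS hT hψ hφ hi1 hi2
  have hint : ∀ r : MvPolynomial (Fin 3) ℝ, IntegrableOn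
      (fun x => ‖gradient (polyFun r) (A x)‖ ^ 2) (interior (cell S)) := fun r =>
    integrableOn_cell_of_continuous S (((continuous_gradient_polyFun r).comp
      (continuous_iff_continuousAt.2 fun x => (hasFDerivAt_affine A x).continuousAt)).norm.pow 2)
  have hup : energy S P ≤ a ^ 2 * ∫ x in interior (cell S), ‖gradient (polyFun p) (A x)‖ ^ 2 := by
    rw [← integral_const_mul]
    refine setIntegral_mono (integrableOn_norm_gradient_sq S P) ((hint p).const_mul _) fun x => ?_
    rw [← mul_pow]
    exact pow_le_pow_left₀ (norm_nonneg _) (norm_gradient_compAffine_le p A ha0.le hAn x) 2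
  have hlow : ∫ x in interior (cell S), ‖gradient (polyFun (p - q)) (A x)‖ ^ 2 ≤
      a' ^ 2 * energy S (P - Q) := by
    unfold energy
    rw [← integral_const_mul]
    refine setIntegral_mono (hint _) ((integrableOn_norm_gradient_sq S _).const_mul _) fun x => ?_
    rw [← mul_pow]
    refine pow_le_pow_left₀ (norm_nonneg _) ?_ 2
    have h1 := norm_gradient_compAffine_le (P - Q) A' ha'0.le hA'n (A x)
    have h2 : polyFun (compAffine (P - Q) A') = polyFun (p - q) := by
      funext z
      rw [polyFun_compAffine, polyFun_sub, polyFun_sub, hP, hQ, polyFun_compAffine,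
        polyFun_compAffine, hAA']
    rwa [h2, hA'A] at h1
  set J := ∫ x in interior (cell S), ‖gradient (polyFun p) (A x)‖ ^ 2 with hJ
  have hE : energy T p = D * J := hD _
  have hE' : energy T (p - q) = D * ∫ x in interior (cell S),
    ‖gradient (polyFun (p - q)) (A x)‖ ^ 2 := hD _
  rw [hE, hE']
  calc _ ≤ D * (a' ^ 2 * (1 / 4 / C ^ 2 * (a ^ 2 * J))) := by
        refine mul_le_mul_of_nonneg_left (hlow.trans ?_) hD0
        refine mul_le_mul_of_nonneg_left (hmain.trans ?_) (by positivity)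
        exact mul_le_mul_of_nonneg_left hup (by positivity)
    _ = 1 / 4 * (D * J) := by
        rw [← haa']
        field_simp

/-- Coercivity on an element, for polynomials that are close in energy. -/
theorem half_energy_le_integral_inner {T : Finset Pt} {p q : MvPolynomial (Fin 3) ℝ}
    (h : energy T (p - q) ≤ 1 / 4 * energy T p) :
    1 / 2 * energy T p ≤ ∫ x in interior (cell T),
      inner ℝ (gradient (polyFun p) x) (gradient (polyFun q) x) := by
  have h1 : ∫ x in interior (cell T), (3 / 4 * ‖gradient (polyFun p) x‖ ^ 2 -
      ‖gradient (polyFun (p - q)) x‖ ^ 2) = 3 / 4 * energy T p - energy T (p - q) := by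
    rw [integral_sub ((integrableOn_norm_gradient_sq T p).const_mul _)
      (integrableOn_norm_gradient_sq T _), integral_const_mul]
    rfl
  have h2 : ∫ x in interior (cell T), (3 / 4 * ‖gradient (polyFun p) x‖ ^ 2 -
      ‖gradient (polyFun (p - q)) x‖ ^ 2) ≤ ∫ x in interior (cell T),
      inner ℝ (gradient (polyFun p) x) (gradient (polyFun q) x) := by
    refine setIntegral_mono (((integrableOn_norm_gradient_sq T p).const_mul _).sub
      (integrableOn_norm_gradient_sq T _)) (integrableOn_inner_gradient T p q) fun x => ?_
    dsimp only
    rw [gradient_polyFun_sub, norm_sub_sq_real]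
    set u := gradient (polyFun p) x
    set v := gradient (polyFun q) x
    -- The pointwise bound `3 / 4 * ‖u‖ ^ 2 - ‖u - v‖ ^ 2 ≤ ⟪u, v⟫` is the expansion of this square.
    have h3 := sq_nonneg (‖(1 / 2 : ℝ) • u - v‖)
    rw [norm_sub_sq_real, norm_smul, real_inner_smul_left, mul_pow] at h3
    norm_num at h3
    linarith
  linarith

/-! ### Combinatorics and topology of the boundary of the mesh. -/

namespace TetMesh

theorem isTet (M : TetMesh) {T : Finset Pt} (hT : T ∈ M.elems) : IsTet T :=
  ⟨M.card_eq T hT, M.affineIndep T hT⟩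

theorem isClosed_polyhedron (M : TetMesh) : IsClosed M.polyhedron :=
  M.elems.finite_toSet.isClosed_biUnion fun T _ => isClosed_cell T

theorem mem_polyhedron (M : TetMesh) {x : Pt} : x ∈ M.polyhedron ↔ ∃ T ∈ M.elems, x ∈ cell T := by
  simp [polyhedron]

theorem cell_subset_polyhedron (M : TetMesh) {T : Finset Pt} (hT : T ∈ M.elems) :
    cell T ⊆ M.polyhedron := fun _ hx => M.mem_polyhedron.2 ⟨T, hT, hx⟩

theorem interior_cell_subset_dom (M : TetMesh) {T : Finset Pt} (hT : T ∈ M.elems) :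
    interior (cell T) ⊆ M.dom := interior_mono (M.cell_subset_polyhedron hT)

theorem closure_dom (M : TetMesh) : closure M.dom = M.polyhedron := by
  refine Set.Subset.antisymm (closure_minimal interior_subset M.isClosed_polyhedron) ?_
  intro x hx
  obtain ⟨T, hT, hxT⟩ := M.mem_polyhedron.1 hx
  rw [← (M.isTet hT).closure_interior_cell] at hxT
  exact closure_mono (M.interior_cell_subset_dom hT) hxT

theorem isOpen_dom (M : TetMesh) : IsOpen M.dom := isOpen_interior

theorem bdry_eq (M : TetMesh) : M.bdry = M.polyhedron \ M.dom := by
  rw [bdry, frontier, M.closure_dom, M.isOpen_dom.interior_eq]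

/-- By compatibility `x` is in the hull of the common vertices, so its coordinates at unshared
vertices vanish. -/
theorem mem_of_bary_ne_zero (M : TetMesh) {S T : Finset Pt} (hS : S ∈ M.elems) (hT : T ∈ M.elems)
    {x y : Pt} (hxS : x ∈ cell S) (hxT : x ∈ cell T) (hy : y ∈ S) (hxy : bary S y x ≠ 0) :
    y ∈ T := by
  by_contra hyT
  have h1 := M.compatible S hS T hT ⟨hxS, hxT⟩
  rw [(M.isTet hS).mem_convexHull_iff Set.inter_subset_left] at h1
  exact hxy (h1.2 y hy fun hh => hyT (by exact_mod_cast hh.2))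

/-- The coordinates of `x` in `S` live on the common vertices, hence are also affine weights on `T`,
where weights are unique. `key` transports both the total mass and the barycentre. -/
theorem bary_eq_ite (M : TetMesh) {S T : Finset Pt} (hS : S ∈ M.elems) (hT : T ∈ M.elems)
    {x y : Pt} (hxS : x ∈ cell S) (hxT : x ∈ cell T) (hy : y ∈ T) :
    bary T y x = if y ∈ S then bary S y x else 0 := by
  have key : ∀ {E : Type} [AddCommMonoid E] (f : Pt → ℝ → E), (∀ y, f y 0 = 0) →
      ∑ y ∈ T, f y (if y ∈ S then bary S y x else 0) = ∑ y ∈ S, f y (bary S y x) := by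
    intro E _ f hf
    rw [← Finset.sum_subset (Finset.inter_subset_left : T ∩ S ⊆ T),
      ← Finset.sum_subset (Finset.inter_subset_right : T ∩ S ⊆ S)]
    · exact Finset.sum_congr rfl fun y hy => by rw [if_pos (Finset.mem_inter.1 hy).2]
    · intro y hy hyn
      have h0 : bary S y x = 0 := by
        by_contra hne
        exact hyn (Finset.mem_inter.2 ⟨M.mem_of_bary_ne_zero hS hT hxS hxT hy hne, hy⟩)
      rw [h0, hf]
    · intro y hy hyn
      rw [if_neg fun hh => hyn (Finset.mem_inter.2 ⟨hy, hh⟩), hf]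
  have h1 := key (fun _ t => t) fun _ => rfl
  have h2 := key (fun y t => t • y) fun _ => zero_smul _ _
  rw [(M.isTet hS).sum_bary] at h1
  rw [(M.isTet hS).sum_bary_smul] at h2
  conv_lhs => rw [← h2]
  exact (M.isTet hT).bary_apply_sum (fun y => if y ∈ S then bary S y x else 0) h1 hy

theorem eventually_mem_cell (M : TetMesh) (x : Pt) :
    ∀ᶠ z in nhds x, ∀ T ∈ M.elems, z ∈ cell T → x ∈ cell T := by
  rw [Filter.eventually_all_finset]
  intro T _
  by_cases hx : x ∈ cell T
  · exact Filter.Eventually.of_forall fun _ _ => hx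
  · filter_upwards [(isClosed_cell T).isOpen_compl.mem_nhds hx] with z hz hzT
    exact absurd hzT hz

/-- Points of a tetrahedron in the relative interior of the same face are simultaneously
interior points of the polyhedron. -/
theorem mem_dom_of_same_support (M : TetMesh) {T : Finset Pt} (hT : T ∈ M.elems) {x y : Pt}
    (hx : x ∈ cell T) (hy : y ∈ cell T) (hxy : ∀ v ∈ T, bary T v x = 0 ↔ bary T v y = 0)
    (hxd : x ∈ M.dom) : y ∈ M.dom := by
  have hyT' : ∀ T' ∈ M.elems, x ∈ cell T' → y ∈ cell T' := by
    intro T' hT' hxT'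
    have h1 : y ∈ convexHull ℝ ((T : Set Pt) ∩ (T' : Set Pt)) := by
      rw [(M.isTet hT).mem_convexHull_iff Set.inter_subset_left]
      refine ⟨(M.isTet hT).mem_cell_iff.1 hy, fun v hv hvn => ?_⟩
      rw [← hxy v hv]
      by_contra hne
      exact hvn ⟨by exact_mod_cast hv,
        by exact_mod_cast M.mem_of_bary_ne_zero hT hT' hx hxT' hv hne⟩
    exact convexHull_mono Set.inter_subset_right h1
  have hpos : ∀ T' ∈ M.elems, ∀ v ∈ T', x ∈ cell T' → bary T' v x ≠ 0 → 0 < bary T' v y := by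
    intro T' hT' v hv hxT' hne
    have hvT := M.mem_of_bary_ne_zero hT' hT hxT' hx hv hne
    have e1 := M.bary_eq_ite hT hT' hx hxT' hv
    have e2 := M.bary_eq_ite hT hT' hy (hyT' T' hT' hxT') hv
    rw [if_pos hvT] at e1 e2
    rw [e2]
    refine lt_of_le_of_ne ((M.isTet hT).mem_cell_iff.1 hy v hvT) (Ne.symm ?_)
    rw [e1] at hne
    exact fun h0 => hne ((hxy v hvT).2 h0)
  have hxn : M.polyhedron ∈ nhds x := mem_interior_iff_mem_nhds.1 hxd
  -- A point `z` near `y` is compared with its translate near `x`, which lies in a cell `T'`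
  -- containing `x`. Coordinates of `T'` that vanish at `x` are nonnegative at the translate and
  -- hence at `z`; the others are positive at `y`, hence at `z`.
  have htend : Filter.Tendsto (fun z => z + (x - y)) (nhds y) (nhds x) := by
    have : Continuous fun z : Pt => z + (x - y) := by fun_prop
    have h1 := this.tendsto y
    rwa [add_sub_cancel] at h1
  have hev : ∀ᶠ z in nhds y, ∀ T' ∈ M.elems, ∀ v ∈ T', 0 < bary T' v y → 0 < bary T' v z := by
    rw [Filter.eventually_all_finset]
    intro T' _
    rw [Filter.eventually_all_finset]
    intro v _
    by_cases h0 : 0 < bary T' v y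
    · filter_upwards [(continuous_bary T' v).continuousAt.eventually (lt_mem_nhds h0)] with z hz _
      exact hz
    · exact Filter.Eventually.of_forall fun _ hh => absurd hh h0
  refine mem_interior_iff_mem_nhds.2 ?_
  filter_upwards [htend.eventually hxn, htend.eventually (M.eventually_mem_cell x), hev]
    with z hz1 hz2 hz3
  obtain ⟨T', hT', hzT'⟩ := M.mem_polyhedron.1 hz1
  have hxT' := hz2 T' hT' hzT'
  refine M.cell_subset_polyhedron hT' ((M.isTet hT').mem_cell_iff.2 fun v hv => ?_)
  by_cases h0 : bary T' v x = 0
  · have h1 := (M.isTet hT').mem_cell_iff.1 hzT' v hv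
    have h2 := (M.isTet hT').mem_cell_iff.1 (hyT' T' hT' hxT') v hv
    rw [bary_add, bary_sub, h0] at h1
    linarith
  · exact (hz3 T' hT' v hv (hpos T' hT' v hv hxT' h0)).le

/-- The face of a tetrahedron whose relative interior contains a point of the boundary of the
polyhedron is contained in that boundary. -/
theorem subcell_subset_bdry (M : TetMesh) {S T : Finset Pt} (hT : T ∈ M.elems) (hST : S ⊆ T) {x : Pt}
    (hx : x ∈ cell T) (hxb : x ∈ M.bdry) (hS : ∀ v ∈ T, v ∈ S ↔ bary T v x ≠ 0) :
    cell S ⊆ M.bdry := by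
  intro y hy
  rw [M.bdry_eq] at hxb ⊢
  have hyT := cell_mono hST hy
  refine ⟨M.cell_subset_polyhedron hT hyT, fun hyd => hxb.2 ?_⟩
  -- A point slightly off `y` towards `x` has the same support as `x`; were `y` interior to the
  -- polyhedron, so would be this point and then `x`.
  have hcont : Continuous fun t : ℝ => (1 - t) • y + t • x := by fun_prop
  have h1 : ∀ᶠ t : ℝ in nhds 0, (1 - t) • y + t • x ∈ M.dom := by
    refine hcont.continuousAt.eventually (M.isOpen_dom.mem_nhds ?_)
    simpa using hyd
  obtain ⟨ε, hε, hball⟩ := Metric.eventually_nhds_iff.1 h1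
  set t := min (ε / 2) 1 with ht
  have ht0 : 0 < t := by positivity
  have ht1 : t ≤ 1 := min_le_right _ _
  have htd := hball (y := t) (by
    rw [Real.dist_eq, sub_zero, abs_of_pos ht0]
    exact (min_le_left _ _).trans_lt (half_lt_self hε))
  have hconv : Convex ℝ (cell T) := convex_convexHull ℝ _
  refine M.mem_dom_of_same_support hT (hconv hyT hx (by linarith) ht0.le (by ring)) hx
    (fun v hv => ?_) htd
  rw [bary_combo _ _ _ _ (by ring)]
  have hxv := (M.isTet hT).mem_cell_iff.1 hx v hv
  have hyv := (M.isTet hT).mem_cell_iff.1 hyT v hv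
  constructor
  · intro h0
    have h2 : 0 ≤ (1 - t) * bary T v y := mul_nonneg (by linarith) hyv
    have h3 : 0 ≤ t * bary T v x := mul_nonneg ht0.le hxv
    have h4 : t * bary T v x = 0 := by linarith
    exact (mul_eq_zero.1 h4).resolve_left ht0.ne'
  · intro h0
    have hvS : v ∉ S := fun hh => (hS v hv).1 hh h0
    rw [h0, ((M.isTet hT).mem_subcell_iff hST).1 hy |>.2 v hv hvS]
    simp

/-- A vertex of the mesh that lies in a tetrahedron is a vertex of it. -/
theorem mem_of_mem_vertices (M : TetMesh) {T : Finset Pt} (hT : T ∈ M.elems) {x : Pt}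
    (hx : x ∈ cell T) (hv : x ∈ M.vertices) : x ∈ T := by
  obtain ⟨S, hS, hxS⟩ := hv
  refine M.mem_of_bary_ne_zero hS hT (mem_cell_of_mem hxS) hx hxS ?_
  rw [(M.isTet hS).bary_self hxS]
  exact one_ne_zero

/-- An edge of the mesh contained in the boundary of the polyhedron belongs to two distinct faces
contained in that boundary. -/
theorem exists_two_bdryFaces (M : TetMesh) {T₀ e : Finset Pt} (he : M.IsBdryEdge T₀ e) :
    ∃ T T' F F', M.IsBdryFace T F ∧ M.IsBdryFace T' F' ∧ F ≠ F' ∧ e ⊆ F ∧ e ⊆ F' := by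
  by_contra hcon
  obtain ⟨hT₀, heT₀, hecard, heb⟩ := he
  have huniq : ∀ T T' F F', M.IsBdryFace T F → M.IsBdryFace T' F' → e ⊆ F → e ⊆ F' → F = F' := by
    intro T T' F F' h1 h2 h3 h4
    by_contra hne
    exact hcon ⟨T, T', F, F', h1, h2, hne, h3, h4⟩
  -- `F` is the only boundary face through `e` or, if there is none, an arbitrary face through `e`.
  obtain ⟨T, F, hT, hFT, hF3, heF, hF⟩ : ∃ T F, T ∈ M.elems ∧ F ⊆ T ∧ F.card = 3 ∧ e ⊆ F ∧
      ∀ T' F', M.IsBdryFace T' F' → e ⊆ F' → F' = F := by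
    by_cases hex : ∃ T F, M.IsBdryFace T F ∧ e ⊆ F
    · obtain ⟨T, F, hTF, heF⟩ := hex
      exact ⟨T, F, hTF.1, hTF.2.1, hTF.2.2.1, heF, fun T' F' h1 h2 => huniq T' T F' F h1 hTF h2 heF⟩
    · obtain ⟨F, heF, hFT, hF3⟩ := Finset.exists_subsuperset_card_eq heT₀ (n := 3)
        (by omega) (by rw [M.card_eq T₀ hT₀]; norm_num)
      exact ⟨T₀, F, hT₀, hFT, hF3, heF, fun T' F' h1 h2 => absurd ⟨T', F', h1, h2⟩ hex⟩
  have hTet := M.isTet hT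
  obtain ⟨O, hOT, hOF⟩ : ∃ O ∈ T, O ∉ F := by
    by_contra! hh
    have := Finset.card_le_card hh
    rw [hTet.1] at this
    omega
  obtain ⟨c, hcF, hce⟩ : ∃ c ∈ F, c ∉ e := by
    by_contra! hh
    have := Finset.card_le_card hh
    omega
  have hcT := hFT hcF
  have heT := heF.trans hFT
  have hcO : c ≠ O := fun hh => hOF (hh ▸ hcF)
  -- The midpoint of `e`, which will turn out to be interior to the polyhedron.
  set x : Pt := ∑ v ∈ T, (if v ∈ e then (1 / 2 : ℝ) else 0) • v with hx
  have hxb : ∀ v ∈ T, bary T v x = if v ∈ e then 1 / 2 else 0 := by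
    refine fun v hv => hTet.bary_apply_sum (fun v => if v ∈ e then (1 / 2 : ℝ) else 0) ?_ hv
    rw [← Finset.sum_filter, Finset.sum_const, Finset.filter_mem_eq_inter,
      Finset.inter_eq_right.2 heT, hecard]
    norm_num
  have hxe : x ∈ cell e := by
    rw [hTet.mem_subcell_iff heT]
    refine ⟨fun v hv => ?_, fun v hv hve => ?_⟩
    · rw [hxb v hv]
      split_ifs <;> norm_num
    · rw [hxb v hv, if_neg hve]
  have hxT := cell_mono heT hxe
  have hxbd := heb hxe
  have hxO : bary T O x = 0 := by rw [hxb O hOT, if_neg fun hh => hOF (heF hh)]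
  have hxc : bary T c x = 0 := by rw [hxb c hcT, if_neg hce]
  have hxT' : ∀ T' ∈ M.elems, x ∈ cell T' → e ⊆ T' := fun T' hT' hxT' v hv =>
    M.mem_of_bary_ne_zero hT hT' hxT hxT' (heT hv) (by rw [hxb v (heT hv), if_pos hv]; norm_num)
  have hev : ∀ᶠ z in nhds x, ∀ T' ∈ M.elems, ∀ v ∈ e, x ∈ cell T' → 0 < bary T' v z := by
    rw [Filter.eventually_all_finset]
    intro T' hT'
    rw [Filter.eventually_all_finset]
    intro v hv
    by_cases h0 : x ∈ cell T'
    · have h1 : 0 < bary T' v x := by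
        rw [M.bary_eq_ite hT hT' hxT h0 (hxT' T' hT' h0 hv), if_pos (heT hv), hxb v (heT hv),
          if_pos hv]
        norm_num
      filter_upwards [(continuous_bary T' v).continuousAt.eventually (lt_mem_nhds h1)] with z hz _
      exact hz
    · exact Filter.Eventually.of_forall fun _ hh => absurd hh h0
  obtain ⟨ρ, hρ, hball⟩ := Metric.eventually_nhds_iff.1 (hev.and (M.eventually_mem_cell x))
  -- The half-plane bounded by the line of `e` that contains `F`. In a small ball about `x`,
  -- boundary points lie on it.
  set H : Set Pt := {z | bary T O z = 0 ∧ 0 ≤ bary T c z} with hH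
  set D : Set Pt := Metric.ball x ρ \ H with hD
  have hFH : cell F ⊆ H := fun z hz => by
    rw [hTet.mem_subcell_iff hFT] at hz
    exact ⟨hz.2 O hOT hOF, hz.1 c hcT⟩
  have hDdom : ∀ z ∈ D, z ∈ M.polyhedron → z ∈ M.dom := by
    rintro z ⟨hzb, hzH⟩ hzp
    by_contra hzd
    have hzbd : z ∈ M.bdry := by
      rw [M.bdry_eq]
      exact ⟨hzp, hzd⟩
    obtain ⟨T', hT', hzT'⟩ := M.mem_polyhedron.1 hzp
    obtain ⟨hb1, hb2⟩ := hball (y := z) hzb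
    have hxT'' := hb2 T' hT' hzT'
    have heT' := hxT' T' hT' hxT''
    -- The face carrying `z` contains `e` and lies in the boundary, so it is not the whole
    -- tetrahedron. It is `e` or a boundary face through `e`, hence contained in `F`.
    set S := T'.filter fun v => bary T' v z ≠ 0 with hS
    have hST' : S ⊆ T' := Finset.filter_subset _ _
    have heS : e ⊆ S := fun v hv =>
      Finset.mem_filter.2 ⟨heT' hv, (hb1 T' hT' v hv hxT'').ne'⟩
    have hSb : cell S ⊆ M.bdry := M.subcell_subset_bdry hT' hST' hzT' hzbd fun v hv => by
      simp [hS, hv]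
    have hzS : z ∈ cell S := by
      rw [(M.isTet hT').mem_subcell_iff hST']
      refine ⟨(M.isTet hT').mem_cell_iff.1 hzT', fun v hv hvS => ?_⟩
      by_contra hne
      exact hvS (Finset.mem_filter.2 ⟨hv, hne⟩)
    have hS4 : S.card ≠ 4 := by
      intro h4
      have hSeq : S = T' := Finset.eq_of_subset_of_card_le hST' (by rw [M.card_eq T' hT', h4])
      obtain ⟨w, hw⟩ := (M.isTet hT').exists_interior_point
      have h1 := hSb (hSeq ▸ interior_subset hw)
      rw [M.bdry_eq] at h1
      exact h1.2 (M.interior_cell_subset_dom hT' hw)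
    have hSF : S ⊆ F := by
      have h1 := Finset.card_le_card hST'
      have h2 := Finset.card_le_card heS
      rw [M.card_eq T' hT'] at h1
      by_cases h3 : S.card = 3
      · exact (hF T' S ⟨hT', hST', h3, hSb⟩ heS).le
      · rw [← Finset.eq_of_subset_of_card_le heS (by omega)]
        exact heF
    exact hzH (hFH (cell_mono hSF hzS))
  have hDopen : D ⊆ M.dom ∪ M.polyhedronᶜ := fun z hz => by
    by_cases hzp : z ∈ M.polyhedron
    · exact Or.inl (hDdom z hz hzp)
    · exact Or.inr hzp
  have hsmall : ∀ w u : Pt, w ∈ Metric.ball x ρ →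
      ∀ᶠ t : ℝ in nhdsWithin 0 (Set.Ioi 0), w + t • u ∈ Metric.ball x ρ := by
    intro w u hw
    have hc : Continuous fun t : ℝ => w + t • u := by fun_prop
    refine nhdsWithin_le_nhds (hc.continuousAt.eventually (Metric.isOpen_ball.mem_nhds ?_))
    simpa using hw
  have hpre : IsPreconnected D := by
    obtain ⟨η, hη1, hη2⟩ := ((hsmall x (x - c) (Metric.mem_ball_self hρ)).and
      self_mem_nhdsWithin).exists
    have hη0 : 0 < η := hη2
    -- On the other side of the edge in the plane of `F`; the ball without the half-plane is
    -- star-shaped about this point.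
    set z0 := x + η • (x - c) with hz0
    have h1 : bary T O z0 = 0 := by
      rw [hz0, bary_add, map_smul, bary_sub, hxO, hTet.bary_ne hOT hcT hcO.symm]
      simp
    have h2 : bary T c z0 = -η := by
      rw [hz0, bary_add, map_smul, bary_sub, hxc, hTet.bary_self hcT]
      simp
    have hz0H : z0 ∉ H := fun hh => by
      have := hh.2
      rw [h2] at this
      linarith
    have hstar : StarConvex ℝ z0 D := by
      rintro w ⟨hwb, hwH⟩ a b ha hb hab
      refine ⟨(convex_ball x ρ) hη1 hwb ha hb hab, fun hq => hwH ?_⟩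
      have hq1 := hq.1
      have hq2 := hq.2
      rw [bary_combo _ _ _ _ hab, h1] at hq1
      rw [bary_combo _ _ _ _ hab, h2] at hq2
      have hb0 : 0 < b := by
        rcases hb.lt_or_eq with hlt | heq
        · exact hlt
        · rw [← heq] at hab hq2
          have : a = 1 := by linarith
          rw [this] at hq2
          linarith
      refine ⟨?_, ?_⟩
      · rw [mul_zero, zero_add] at hq1
        exact (mul_eq_zero.1 hq1).resolve_left hb0.ne'
      · by_contra! hneg
        have := mul_neg_of_pos_of_neg hb0 hneg
        have := mul_nonneg ha hη0.le
        linarith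
    exact (hstar.isPathConnected ⟨hη1, hz0H⟩).isConnected.isPreconnected
  have hnotH : ∀ w : Pt, 0 ≤ bary T O w → ∀ t : ℝ, 0 < t → w + t • (O - x) ∉ H := by
    intro w hw t ht hh
    have := hh.1
    rw [bary_add, map_smul, bary_sub, hTet.bary_self hOT, hxO, smul_eq_mul] at this
    linarith
  -- Being connected, `D` is inside the domain or disjoint from the polyhedron; points slightly off
  -- `x` towards `O` rule out the latter.
  have hDsub : D ⊆ M.dom := by
    rcases hpre.subset_or_subset M.isOpen_dom M.isClosed_polyhedron.isOpen_compl
      (Set.disjoint_left.2 fun z hz hz' => hz' (interior_subset hz)) hDopen with h1 | h1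
    · exact h1
    · exfalso
      obtain ⟨t, ⟨ht1, ht2⟩, ht3⟩ := (((hsmall x (O - x) (Metric.mem_ball_self hρ)).and
        self_mem_nhdsWithin).and (nhdsWithin_le_nhds (Iio_mem_nhds one_pos))).exists
      have ht0 : 0 < t := ht2
      have ht1' : t < 1 := ht3
      refine h1 ⟨ht1, hnotH x hxO.ge t ht0⟩ (M.cell_subset_polyhedron hT ?_)
      have hconv : Convex ℝ (cell T) := convex_convexHull ℝ _
      have := hconv hxT (mem_cell_of_mem hOT) (sub_nonneg.2 ht1'.le) ht0.le (by ring)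
      convert this using 1
      module
  -- Points of the half-plane are limits of points of `D`, reached in the direction `O - x`.
  have hballsub : Metric.ball x ρ ⊆ M.polyhedron := by
    intro z hz
    by_cases hzH : z ∈ H
    · have hc : Continuous fun t : ℝ => z + t • (O - x) := by fun_prop
      have h1 : Filter.Tendsto (fun t : ℝ => z + t • (O - x)) (nhdsWithin 0 (Set.Ioi 0))
          (nhds z) := by
        have h2 := hc.tendsto 0
        rw [zero_smul, add_zero] at h2
        exact h2.mono_left nhdsWithin_le_nhds
      refine M.isClosed_polyhedron.mem_of_tendsto h1 ?_
      filter_upwards [hsmall z (O - x) hz, self_mem_nhdsWithin] with t ht1 ht2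
      exact interior_subset (hDsub ⟨ht1, hnotH z hzH.1.ge t ht2⟩)
    · exact interior_subset (hDsub ⟨hz, hzH⟩)
  rw [M.bdry_eq] at hxbd
  exact hxbd.2 (interior_maximal hballsub Metric.isOpen_ball (Metric.mem_ball_self hρ))

end TetMesh

/-! ### Uniform cone condition and nearest intersections. -/

/-- Near `a`, the set `Ω` satisfies a cone condition with axis `n`: from a point of its closure,
moving inside the cone of directions at an angle of more than `π / 2 + arcsin δ` with `n` leads
to points of `Ω`. -/
def ConeAt (Ω : Set Pt) (δ r : ℝ) (a n : Pt) : Prop :=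
  ‖n‖ = 1 ∧ ∀ y ∈ Metric.ball a r, ∀ z ∈ Metric.ball a r, y ∈ closure Ω →
    inner ℝ n (z - y) < -(δ * ‖z - y‖) → z ∈ Ω

/-- Strict differentiability bounds the error of `ψ z - ψ y ≈ L (z - y)` by `δ * ‖L‖ * ‖z - y‖`.
With `n` the normalised gradient, the cone gives `ψ z < ψ y ≤ 0`, the last inequality holding on
`closure Ω` by continuity. -/
theorem exists_coneAt_of_mem_frontier {Ω : Set Pt} (hC1 : HasC1Boundary Ω) {δ : ℝ} (hδ : 0 < δ)
    {x : Pt} (hx : x ∈ frontier Ω) : ∃ r > 0, ∃ n : Pt, ConeAt Ω δ r x n := by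
  obtain ⟨U, ψ, hU, hxU, hψ, hne, hΩ⟩ := hC1 x hx
  set L := fderiv ℝ ψ x with hL
  have hL0 : 0 < ‖L‖ := norm_pos_iff.2 hne
  have hstrict : HasStrictFDerivAt ψ L x :=
    (hψ.contDiffAt (hU.mem_nhds hxU)).hasStrictFDerivAt one_ne_zero
  have hev := hstrict.isLittleO.bound (c := δ * ‖L‖) (by positivity)
  rw [nhds_prod_eq, Filter.eventually_iff, Filter.mem_prod_same_iff] at hev
  obtain ⟨V, hV, hVsub⟩ := hev
  obtain ⟨r, hr, hrsub⟩ := Metric.mem_nhds_iff.1 (Filter.inter_mem hV (hU.mem_nhds hxU))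
  set n : Pt := ‖L‖⁻¹ • (InnerProductSpace.toDual ℝ Pt).symm L with hn
  have hinner : ∀ u, inner ℝ n u = ‖L‖⁻¹ * L u := by
    intro u
    rw [hn, real_inner_smul_left, InnerProductSpace.toDual_symm_apply]
  refine ⟨r, hr, n, ?_, fun y hy z hz hyΩ hin => ?_⟩
  · rw [hn, norm_smul, LinearIsometryEquiv.norm_map, norm_inv, norm_norm,
      inv_mul_cancel₀ hL0.ne']
  · have hyU := (hrsub hy).2
    have hzU := (hrsub hz).2
    have hψy : ψ y ≤ 0 := by
      by_contra! hpos
      have hc : ContinuousAt ψ y := (hψ.contDiffAt (hU.mem_nhds hyU)).continuousAt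
      have h1 : ∀ᶠ w in nhds y, 0 < ψ w ∧ w ∈ U :=
        (hc.eventually (lt_mem_nhds hpos)).and (hU.mem_nhds hyU)
      obtain ⟨w, hw, hwΩ⟩ := mem_closure_iff_nhds.1 hyΩ _ h1
      have h2 : w ∈ {y ∈ U | ψ y < 0} := hΩ ▸ ⟨hwΩ, hw.2⟩
      exact absurd h2.2 hw.1.not_gt
    have h3 := hVsub (Set.mk_mem_prod (hrsub hz).1 (hrsub hy).1)
    simp only [Set.mem_ofPred_eq, Real.norm_eq_abs] at h3
    rw [hinner, inv_mul_lt_iff₀ hL0] at hin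
    have h4 := (abs_le.1 h3).2
    have h5 : z ∈ {y ∈ U | ψ y < 0} := ⟨hzU, by linarith⟩
    rw [← hΩ] at h5
    exact h5.1

/-- The cone condition holds uniformly along a compact `C¹` boundary. -/
theorem exists_coneAt {Ω : Set Pt} (hbdd : Bornology.IsBounded Ω) (hC1 : HasC1Boundary Ω) {δ : ℝ}
    (hδ : 0 < δ) : ∃ r > 0, ∀ a ∈ frontier Ω, ∃ n : Pt, ConeAt Ω δ r a n := by
  have hcomp : IsCompact (frontier Ω) :=
    (hbdd.isCompact_closure).of_isClosed_subset isClosed_frontier frontier_subset_closure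
  choose! r hr n hn using fun x (hx : x ∈ frontier Ω) => exists_coneAt_of_mem_frontier hC1 hδ hx
  -- The direction used at `a` is that of the centre of a covering ball containing the ball of
  -- radius `ρ` about `a`; it need not be the normal at `a`.
  obtain ⟨ρ, hρ, hcov⟩ := lebesgue_number_lemma_of_metric (s := frontier Ω)
    (c := fun x : frontier Ω => Metric.ball x.1 (r x.1)) hcomp
    (fun _ => Metric.isOpen_ball)
    fun x hx => Set.mem_iUnion.2 ⟨⟨x, hx⟩, Metric.mem_ball_self (hr x hx)⟩
  refine ⟨ρ, hρ, fun a ha => ?_⟩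
  obtain ⟨x, hx⟩ := hcov a ha
  exact ⟨n x, (hn x x.2).1, fun y hy z hz => (hn x x.2).2 y (hx hy) z (hx hz)⟩

/-- A larger inner product of either sign would put one of the two points in `Ω` by the cone
condition, but an open set misses its frontier. -/
theorem ConeAt.abs_inner_le {Ω : Set Pt} (hΩ : IsOpen Ω) {δ r : ℝ} {a n : Pt}
    (h : ConeAt Ω δ r a n) {y z : Pt} (hy : y ∈ frontier Ω) (hz : z ∈ frontier Ω)
    (hyr : y ∈ Metric.ball a r) (hzr : z ∈ Metric.ball a r) :
    |inner ℝ n (z - y)| ≤ δ * ‖z - y‖ := by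
  rw [hΩ.frontier_eq] at hy hz
  rw [abs_le]
  constructor
  · by_contra! hlt
    exact hz.2 (h.2 y hyr z hzr hy.1 hlt)
  · by_contra! hlt
    refine hy.2 (h.2 z hzr y hyr hz.1 ?_)
    rw [← neg_sub z y, inner_neg_right, norm_neg]
    linarith

/-- A line through a point close to the boundary, in a direction that is not nearly tangent,
has a unique nearest intersection with the boundary, and it is close to that point. -/
theorem ConeAt.exists_nearest {Ω : Set Pt} (hΩ : IsOpen Ω) {δ r : ℝ} {a n : Pt} (hδ : 0 < δ)
    (h : ConeAt Ω δ r a n) (ha : a ∈ frontier Ω) {H κ ε : ℝ} (hH : 0 < H) (hHr : 2 * H < r)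
    (hε : 0 < ε) (hε1 : ε ≤ 1) (hδε : 3 * δ < ε * κ) {x d : Pt} (hxa : ‖x - a‖ ≤ H)
    (hxn : |inner ℝ n (x - a)| ≤ δ * H) (hd : d ≠ 0) (hdn : κ * ‖d‖ ≤ |inner ℝ n d|) :
    ∃ P, IsNearestIntersection (frontier Ω) x d P ∧ dist P x ≤ ε * H ∧
      ∀ P', IsNearestIntersection (frontier Ω) x d P' → P' = P := by
  have hd0 : 0 < ‖d‖ := norm_pos_iff.2 hd
  -- Normalise the direction and orient it outwards.
  obtain ⟨c, hc0, hu1, hun⟩ : ∃ c : ℝ, c ≠ 0 ∧ ‖c • d‖ = 1 ∧ κ ≤ inner ℝ n (c • d) := by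
    rcases le_total 0 (inner ℝ n d) with h0 | h0
    · refine ⟨‖d‖⁻¹, by positivity, ?_, ?_⟩
      · rw [norm_smul, norm_inv, norm_norm, inv_mul_cancel₀ hd0.ne']
      · rw [real_inner_smul_right, le_inv_mul_iff₀ hd0]
        rw [abs_of_nonneg h0] at hdn
        linarith
    · refine ⟨-‖d‖⁻¹, neg_ne_zero.2 (by positivity), ?_, ?_⟩
      · rw [norm_smul, norm_neg, norm_inv, norm_norm, inv_mul_cancel₀ hd0.ne']
      · rw [real_inner_smul_right, neg_mul, ← mul_neg, le_inv_mul_iff₀ hd0]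
        rw [abs_of_nonpos h0] at hdn
        linarith
  set u := c • d with hu
  have hline : ∀ P : Pt, (∃ t : ℝ, P = x + t • d) ↔ ∃ t : ℝ, P = x + t • u := by
    intro P
    constructor
    · rintro ⟨t, rfl⟩
      exact ⟨t * c⁻¹, by rw [hu, smul_smul, mul_assoc, inv_mul_cancel₀ hc0, mul_one]⟩
    · rintro ⟨t, rfl⟩
      exact ⟨t * c, by rw [hu, smul_smul]⟩
  have hεH : ε * H ≤ H := by nlinarith
  have hεH0 : 0 < ε * H := by positivity
  have hκ : δ < κ := by nlinarith
  -- Moving by `ε * H` along `u` gains a height `ε * H * κ`. It must exceed the initial height `δ *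
  -- H` plus the opening `δ * (H + ε * H)` of the cone; this is where `3 * δ < ε * κ` enters.
  have hkey : 2 * (δ * H) + δ * (ε * H) < ε * H * κ := by
    have h1 : 3 * δ * H < ε * κ * H := mul_lt_mul_of_pos_right hδε hH
    have h2 : δ * (ε * H) ≤ δ * H := mul_le_mul_of_nonneg_left hεH hδ.le
    nlinarith
  have hpt : ∀ t : ℝ, |t| ≤ H → x + t • u ∈ Metric.ball a r := by
    intro t ht
    rw [Metric.mem_ball, dist_eq_norm, add_sub_right_comm]
    refine (norm_add_le _ _).trans_lt ?_
    rw [norm_smul, hu1, mul_one, Real.norm_eq_abs]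
    linarith
  have hball : a ∈ Metric.ball a r := Metric.mem_ball_self (by linarith)
  have haΩ : a ∉ Ω := by
    rw [hΩ.frontier_eq] at ha
    exact ha.2
  have hxn' := abs_le.1 hxn
  have hstep : ε * H * κ ≤ ε * H * inner ℝ n u := mul_le_mul_of_nonneg_left hun hεH0.le
  have hnorm : ∀ t : ℝ, |t| = ε * H → δ * ‖x + t • u - a‖ ≤ δ * H + δ * (ε * H) := by
    intro t ht
    rw [← mul_add]
    refine mul_le_mul_of_nonneg_left ?_ hδ.le
    rw [add_sub_right_comm]
    refine (norm_add_le _ _).trans ?_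
    rw [norm_smul, hu1, mul_one, Real.norm_eq_abs, ht]
    linarith
  have hout : x + (ε * H) • u ∉ Ω := by
    intro hin
    refine haΩ (h.2 _ (hpt _ (by rwa [abs_of_pos hεH0])) a hball (subset_closure hin) ?_)
    have h1 := hnorm (ε * H) (abs_of_pos hεH0)
    rw [← neg_sub, inner_neg_right, norm_neg, add_sub_right_comm, inner_add_right,
      real_inner_smul_right]
    rw [add_sub_right_comm] at h1
    linarith
  have hin : x + (-(ε * H)) • u ∈ Ω := by
    refine h.2 a hball _ (hpt _ (by rwa [abs_neg, abs_of_pos hεH0])) (frontier_subset_closure ha) ?_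
    have h1 := hnorm (-(ε * H)) (by rw [abs_neg, abs_of_pos hεH0])
    rw [add_sub_right_comm, inner_add_right, real_inner_smul_right]
    rw [add_sub_right_comm] at h1
    linarith
  have hcont : Continuous fun t : ℝ => x + t • u := by fun_prop
  have hpre : IsPreconnected ((fun t : ℝ => x + t • u) '' Set.Icc (-(ε * H)) (ε * H)) :=
    isPreconnected_Icc.image _ hcont.continuousOn
  obtain ⟨P, ⟨t, ht, rfl⟩, hPΓ⟩ : (((fun t : ℝ => x + t • u) '' Set.Icc (-(ε * H)) (ε * H)) ∩
      frontier Ω).Nonempty := by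
    by_contra hemp
    have hsub : (fun t : ℝ => x + t • u) '' Set.Icc (-(ε * H)) (ε * H) ⊆ Ω ∪ (closure Ω)ᶜ := by
      intro z hz
      by_contra hz'
      rw [Set.mem_union, not_or, Set.mem_compl_iff, not_not] at hz'
      refine hemp ⟨z, hz, ?_⟩
      rw [hΩ.frontier_eq]
      exact ⟨hz'.2, hz'.1⟩
    rcases hpre.subset_or_subset hΩ isClosed_closure.isOpen_compl
      (Set.disjoint_left.2 fun z hz hz' => hz' (subset_closure hz)) hsub with h1 | h1
    · exact hout (h1 ⟨_, ⟨by linarith, le_rfl⟩, rfl⟩)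
    · exact h1 ⟨_, ⟨le_rfl, by linarith⟩, rfl⟩ (subset_closure hin)
  have htle : |t| ≤ ε * H := abs_le.2 ht
  have hdist : ∀ t' : ℝ, dist x (x + t' • u) = |t'| := by
    intro t'
    rw [dist_eq_norm, sub_add_cancel_left, norm_neg, norm_smul, hu1, mul_one, Real.norm_eq_abs]
  -- Two boundary points on the line within `H` would differ by a vector that is almost tangent,
  -- whereas `κ > δ`. Intersections beyond `H` are farther away than the one found.
  have hlt : ∀ t1 t2 : ℝ, |t1| ≤ H → |t2| ≤ H → x + t1 • u ∈ frontier Ω →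
      x + t2 • u ∈ frontier Ω → ¬ t1 < t2 := by
    intro t1 t2 h1 h2 hf1 hf2 hlt
    have h3 := h.abs_inner_le hΩ hf1 hf2 (hpt _ h1) (hpt _ h2)
    rw [add_sub_add_left_eq_sub, ← sub_smul, real_inner_smul_right, norm_smul, hu1, mul_one,
      Real.norm_eq_abs, abs_of_pos (sub_pos.2 hlt)] at h3
    have h4 := (le_abs_self _).trans h3
    have h5 : (t2 - t1) * κ ≤ (t2 - t1) * inner ℝ n u :=
      mul_le_mul_of_nonneg_left hun (sub_pos.2 hlt).le
    nlinarith [sub_pos.2 hlt]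
  have huniq : ∀ t' : ℝ, |t'| ≤ H → x + t' • u ∈ frontier Ω → x + t' • u = x + t • u := by
    intro t' ht' hf
    have h1 := hlt t t' (htle.trans hεH) ht' hPΓ hf
    have h2 := hlt t' t ht' (htle.trans hεH) hf hPΓ
    rw [le_antisymm (not_lt.1 h1) (not_lt.1 h2)]
  refine ⟨x + t • u, ⟨⟨hPΓ, (hline _).2 ⟨t, rfl⟩⟩, fun P' hP' hP'line => ?_⟩, ?_, ?_⟩
  · obtain ⟨t', rfl⟩ := (hline _).1 hP'line
    by_cases ht' : |t'| ≤ H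
    · rw [huniq t' ht' hP']
    · rw [hdist, hdist]
      linarith [not_le.1 ht']
  · rw [dist_comm, hdist]
    exact htle
  · rintro P' ⟨⟨hP'Γ, hP'line⟩, hP'min⟩
    have h1 := hP'min _ hPΓ ((hline _).2 ⟨t, rfl⟩)
    obtain ⟨t', rfl⟩ := (hline _).1 hP'line
    rw [hdist, hdist] at h1
    exact huniq t' (h1.trans (htle.trans hεH)) hP'Γ

/-! ### Tetrahedra with a face inscribed in the boundary. -/

theorem dist_le_diam_of_mem {T : Finset Pt} {x y : Pt} (hx : x ∈ T) (hy : y ∈ T) :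
    ‖x - y‖ ≤ Metric.diam (cell T) := by
  rw [← dist_eq_norm]
  exact dist_le_diam_cell (mem_cell_of_mem hx) (mem_cell_of_mem hy)

/-- A tetrahedron of diameter `h`, with barycentric coordinates that are Lipschitz with constant
`σ / h`, that is small compared with the range of the cone condition at the vertex `a`, with
vertices in the closure of `Ω`, and with three vertices, `a` among them, on its boundary. -/
structure SkinTet (Ω : Set Pt) (σ δ r : ℝ) (a n : Pt) (T F : Finset Pt) : Prop where
  isTet : IsTet T
  lip : ∀ y ∈ T, ∀ u, |(bary T y).linear u| ≤ σ / Metric.diam (cell T) * ‖u‖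
  subset : F ⊆ T
  card : F.card = 3
  mem_closure : ∀ y ∈ T, y ∈ closure Ω
  mem_frontier : ∀ y ∈ F, y ∈ frontier Ω
  mem : a ∈ F
  diam_lt : 2 * Metric.diam (cell T) < r
  cone : ConeAt Ω δ r a n

namespace SkinTet

variable {Ω : Set Pt} {σ δ r : ℝ} {a n : Pt} {T F : Finset Pt}

theorem mem_ball (h : SkinTet Ω σ δ r a n T F) {y : Pt} (hy : y ∈ T) : y ∈ Metric.ball a r := by
  rw [Metric.mem_ball]
  have h1 := dist_le_diam_cell (mem_cell_of_mem hy) (mem_cell_of_mem (h.subset h.mem))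
  linarith [h.diam_lt, h.isTet.diam_pos]

theorem abs_inner_le (h : SkinTet Ω σ δ r a n T F) (hΩ : IsOpen Ω) {y z : Pt} (hy : y ∈ F)
    (hz : z ∈ F) : |inner ℝ n (z - y)| ≤ δ * ‖z - y‖ :=
  h.cone.abs_inner_le hΩ (h.mem_frontier y hy) (h.mem_frontier z hz) (h.mem_ball (h.subset hy))
    (h.mem_ball (h.subset hz))

theorem abs_inner_le_diam (h : SkinTet Ω σ δ r a n T F) (hΩ : IsOpen Ω) (hδ : 0 < δ) {y : Pt}
    (hy : y ∈ F) : |inner ℝ n (y - a)| ≤ δ * Metric.diam (cell T) :=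
  (h.abs_inner_le hΩ h.mem hy).trans (mul_le_mul_of_nonneg_left
    (dist_le_diam_of_mem (h.subset hy) (h.subset h.mem)) hδ.le)

/-- This is `sum_bary_linear_smul` based at `a`, with the opposite vertex isolated because only its
height over the tangent plane is not small. -/
theorem inner_eq (h : SkinTet Ω σ δ r a n T F) {O : Pt} (hO : O ∈ T) (hOF : O ∉ F) (u : Pt) :
    inner ℝ n u = (bary T O).linear u * inner ℝ n (O - a) +
      ∑ y ∈ F, (bary T y).linear u * inner ℝ n (y - a) := by
  have hT : T = insert O F := by
    refine (Finset.eq_of_subset_of_card_le (Finset.insert_subset hO h.subset) ?_).symm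
    rw [Finset.card_insert_of_notMem hOF, h.card, h.isTet.1]
  conv_lhs => rw [← sum_bary_linear_smul h.isTet a u]
  rw [inner_sum]
  simp only [real_inner_smul_right]
  have h1 := Finset.sum_insert (f := fun y => (bary T y).linear u * inner ℝ n (y - a)) hOF
  rw [← hT] at h1
  exact h1

/-- Slopes of coordinates are at most `σ / diam`, heights of face vertices at most `δ * diam`, and
the diameters cancel. -/
theorem abs_sum_le (h : SkinTet Ω σ δ r a n T F) (hΩ : IsOpen Ω) (hδ : 0 < δ) (u : Pt) :
    |∑ y ∈ F, (bary T y).linear u * inner ℝ n (y - a)| ≤ 3 * σ * δ * ‖u‖ := by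
  have hd := h.isTet.diam_pos
  refine (Finset.abs_sum_le_sum_abs _ _).trans ((Finset.sum_le_card_nsmul F _
    (σ * δ * ‖u‖) fun y hy => ?_).trans (le_of_eq ?_))
  · rw [abs_mul]
    have h1 := h.lip y (h.subset hy) u
    calc _ ≤ σ / Metric.diam (cell T) * ‖u‖ * (δ * Metric.diam (cell T)) :=
          mul_le_mul h1 (h.abs_inner_le_diam hΩ hδ hy) (abs_nonneg _) ((abs_nonneg _).trans h1)
      _ = σ * δ * ‖u‖ := by
          field_simp
  · rw [h.card, nsmul_eq_mul]
    push_cast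
    ring

/-- The vertex opposite to a face inscribed in the boundary is well inside. -/
theorem inner_apex_le (h : SkinTet Ω σ δ r a n T F) (hΩ : IsOpen Ω) (hσ : 0 < σ) (hδ : 0 < δ)
    (hσδ : 8 * (σ * δ) ≤ 1) {O : Pt} (hO : O ∈ T) (hOF : O ∉ F) :
    inner ℝ n (O - a) ≤ -(Metric.diam (cell T) / (2 * σ)) := by
  have hd := h.isTet.diam_pos
  set D := Metric.diam (cell T) with hD
  have haT := h.subset h.mem
  have haΩ : a ∉ Ω := by
    have := h.mem_frontier a h.mem
    rw [hΩ.frontier_eq] at this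
    exact this.2
  -- Were `O` higher, `a` would be in the cone below a point of `closure Ω`, hence in `Ω`.
  have hup : inner ℝ n (O - a) ≤ δ * D := by
    have h1 : ¬ inner ℝ n (a - O) < -(δ * ‖a - O‖) := fun hlt =>
      haΩ (h.cone.2 O (h.mem_ball hO) a (h.mem_ball haT) (h.mem_closure O hO) hlt)
    rw [← neg_sub, inner_neg_right, norm_neg] at h1
    have h2 := mul_le_mul_of_nonneg_left (dist_le_diam_of_mem hO haT) hδ.le
    linarith
  -- Expanding `n` itself, the left side is `1` and the face contributes at most `3 / 8`, so the
  -- opposite vertex supplies at least half.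
  have h1 := h.inner_eq hO hOF n
  rw [real_inner_self_eq_norm_sq, h.cone.1] at h1
  have h2 := h.abs_sum_le hΩ hδ n
  have h3 := h.lip O hO n
  rw [h.cone.1, mul_one] at h2 h3
  have h4 : (bary T O).linear n * inner ℝ n (O - a) ≤ σ / D * |inner ℝ n (O - a)| :=
    (le_abs_self _).trans (by
      rw [abs_mul]
      exact mul_le_mul_of_nonneg_right h3 (abs_nonneg _))
  have h5 : 1 / 2 ≤ σ / D * |inner ℝ n (O - a)| := by
    have := (abs_le.1 h2).2
    linarith
  have h6 : D / (2 * σ) ≤ |inner ℝ n (O - a)| := by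
    rw [div_mul_eq_mul_div, le_div_iff₀ hd] at h5
    rw [div_le_iff₀ (by positivity)]
    linarith
  have h7 : δ * D < D / (2 * σ) := by
    rw [lt_div_iff₀ (by positivity)]
    nlinarith [mul_pos hσ hδ]
  rcases le_total 0 (inner ℝ n (O - a)) with h8 | h8
  · rw [abs_of_nonneg h8] at h6
    linarith
  · rw [abs_of_nonpos h8] at h6
    linarith

theorem abs_inner_le_of_mem_cell (h : SkinTet Ω σ δ r a n T F) (hΩ : IsOpen Ω) (hδ : 0 < δ) {x : Pt}
    (hx : x ∈ cell F) : |inner ℝ n (x - a)| ≤ δ * Metric.diam (cell T) := by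
  have hconv : Convex ℝ {x : Pt | |inner ℝ n (x - a)| ≤ δ * Metric.diam (cell T)} := by
    intro y hy z hz s t hs ht hst
    have h1 : s • y + t • z - a = s • (y - a) + t • (z - a) := by
      rw [smul_sub, smul_sub, sub_add_sub_comm, ← add_smul, hst, one_smul]
    rw [Set.mem_ofPred_eq] at hy hz ⊢
    rw [h1, inner_add_right, real_inner_smul_right, real_inner_smul_right]
    refine (abs_add_le _ _).trans ?_
    rw [abs_mul, abs_mul, abs_of_nonneg hs, abs_of_nonneg ht]
    calc _ ≤ s * (δ * Metric.diam (cell T)) + t * (δ * Metric.diam (cell T)) :=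
          add_le_add (mul_le_mul_of_nonneg_left hy hs) (mul_le_mul_of_nonneg_left hz ht)
      _ = _ := by rw [← add_mul, hst, one_mul]
  exact convexHull_min (fun y hy => h.abs_inner_le_diam hΩ hδ (by exact_mod_cast hy)) hconv hx

theorem norm_sub_le (h : SkinTet Ω σ δ r a n T F) {x : Pt}
    (hx : x ∈ cell F) : ‖x - a‖ ≤ Metric.diam (cell T) := by
  rw [← dist_eq_norm]
  exact dist_le_diam_cell (cell_mono h.subset hx) (mem_cell_of_mem (h.subset h.mem))

/-- The lines joining the opposite vertex to the points of a face inscribed in the boundary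
meet the boundary once near the face. -/
theorem exists_nearest_face (h : SkinTet Ω σ δ r a n T F) (hΩ : IsOpen Ω) (hσ : 0 < σ) (hδ : 0 < δ)
    (hσδ : 8 * (σ * δ) ≤ 1) {ε : ℝ} (hε : 0 < ε) (hε1 : ε ≤ 1) (hδε : 12 * (σ * δ) < ε) {O : Pt}
    (hO : O ∈ T) (hOF : O ∉ F) {x : Pt} (hx : x ∈ cell F) :
    ∃ P, IsNearestIntersection (frontier Ω) x (x - O) P ∧ dist P x ≤ ε * Metric.diam (cell T) ∧
      ∀ P', IsNearestIntersection (frontier Ω) x (x - O) P' → P' = P := by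
  have hd := h.isTet.diam_pos
  set D := Metric.diam (cell T) with hD
  have hxa := h.norm_sub_le hx
  have hxn := h.abs_inner_le_of_mem_cell hΩ hδ hx
  have hap := h.inner_apex_le hΩ hσ hδ hσδ hO hOF
  -- The depth `D / (2 * σ)` of the apex less the height `δ * D` of `x`.
  have h1 : D / (4 * σ) ≤ inner ℝ n (x - O) := by
    have h2 : x - O = (x - a) - (O - a) := by abel
    rw [h2, inner_sub_right]
    have h3 := (abs_le.1 hxn).1
    have h4 : δ * D ≤ D / (4 * σ) := by
      rw [le_div_iff₀ (by positivity)]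
      nlinarith
    have h5 : D / (2 * σ) = 2 * (D / (4 * σ)) := by
      field_simp
      norm_num
    linarith
  have h2 : ‖x - O‖ ≤ D := by
    rw [← dist_eq_norm]
    exact dist_le_diam_cell (cell_mono h.subset hx) (mem_cell_of_mem hO)
  have hpos : 0 < D / (4 * σ) := by positivity
  refine h.cone.exists_nearest hΩ hδ (h.mem_frontier a h.mem) hd h.diam_lt hε hε1
    (κ := 1 / (4 * σ)) ?_ hxa hxn ?_ ?_
  · rw [mul_one_div, lt_div_iff₀ (by positivity)]
    linarith
  · intro h0
    rw [h0, inner_zero_right] at h1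
    linarith
  · rw [abs_of_nonneg (hpos.le.trans h1)]
    refine le_trans ?_ h1
    rw [one_div_mul_eq_div]
    exact div_le_div_of_nonneg_right h2 (by positivity)

end SkinTet

/-! ### Transversality of the skins. -/

/-- Properties of the vector of a face that is orthogonal to one of its edges and points inwards. -/
theorem inward_spec {a b c : Pt} {T : Finset Pt} (hT : IsTet T) (ha : a ∈ T) (hb : b ∈ T)
    (hc : c ∈ T) (hab : a ≠ b) (hac : a ≠ c) (hbc : b ≠ c) {σ : ℝ}
    (hlip : ∀ u, |(bary T c).linear u| ≤ σ / Metric.diam (cell T) * ‖u‖) :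
    ‖TetMesh.inward a b c‖ = 1 ∧ inner ℝ (TetMesh.inward a b c) (b - a) = 0 ∧
      1 / Metric.diam (cell T) ≤ (bary T c).linear (TetMesh.inward a b c) ∧
      (∀ O ∈ T, O ≠ a → O ≠ b → O ≠ c → (bary T O).linear (TetMesh.inward a b c) = 0) ∧
      ∀ (n : Pt) (δ : ℝ), |inner ℝ n (b - a)| ≤ δ * ‖b - a‖ → |inner ℝ n (c - a)| ≤ δ * ‖c - a‖ →
        0 ≤ δ → |inner ℝ n (TetMesh.inward a b c)| ≤ 2 * δ * σ := by
  have hd := hT.diam_pos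
  set D := Metric.diam (cell T) with hD
  have hba : 0 < ‖b - a‖ := norm_pos_iff.2 (sub_ne_zero.2 hab.symm)
  set β := inner ℝ (c - a) (b - a) / ‖b - a‖ ^ 2 with hβ
  set q : Pt := (c - a) - β • (b - a) with hq
  have hinw : TetMesh.inward a b c = ‖q‖⁻¹ • q := rfl
  have hqb : inner ℝ q (b - a) = 0 := by
    rw [hq, inner_sub_left, real_inner_smul_left, real_inner_self_eq_norm_sq, hβ]
    field_simp
    ring
  have hpyth : ‖c - a‖ ^ 2 = ‖q‖ ^ 2 + (|β| * ‖b - a‖) ^ 2 := by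
    have h1 : c - a = q + β • (b - a) := by rw [hq, sub_add_cancel]
    rw [h1, norm_add_sq_real, real_inner_smul_right, hqb, norm_smul, Real.norm_eq_abs]
    ring
  have hqle : ‖q‖ ≤ ‖c - a‖ := by
    refine abs_le_of_sq_le_sq' ?_ (norm_nonneg _) |>.2
    nlinarith [sq_nonneg (|β| * ‖b - a‖)]
  have hβle : |β| * ‖b - a‖ ≤ ‖c - a‖ := by
    refine abs_le_of_sq_le_sq' ?_ (norm_nonneg _) |>.2
    nlinarith [sq_nonneg ‖q‖]
  -- Coordinates at vertices other than `a` and `b` are constant along the edge, so the projection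
  -- does not affect them.
  have hlin : ∀ O ∈ T, O ≠ a → O ≠ b → (bary T O).linear q = bary T O c := by
    intro O hO hOa hOb
    rw [hq, map_sub, map_smul, bary_sub, bary_sub, hT.bary_ne hO ha hOa, hT.bary_ne hO hb hOb]
    simp
  have hlc : (bary T c).linear q = 1 := by rw [hlin c hc hac.symm hbc.symm, hT.bary_self hc]
  have hq0 : 0 < ‖q‖ := by
    refine norm_pos_iff.2 fun h0 => ?_
    rw [h0, map_zero] at hlc
    exact zero_ne_one hlc
  have hqlow : 1 ≤ σ / D * ‖q‖ := by
    have := hlip q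
    rwa [hlc, abs_one] at this
  have hcD : ‖c - a‖ ≤ D := dist_le_diam_of_mem hc ha
  refine ⟨?_, ?_, ?_, ?_, ?_⟩
  · rw [hinw, norm_smul, norm_inv, norm_norm, inv_mul_cancel₀ hq0.ne']
  · rw [hinw, real_inner_smul_left, hqb, mul_zero]
  · rw [hinw, map_smul, hlc, smul_eq_mul, mul_one, one_div]
    exact inv_anti₀ hq0 (hqle.trans hcD)
  · intro O hO hOa hOb hOc
    rw [hinw, map_smul, hlin O hO hOa hOb, hT.bary_ne hO hc hOc, smul_zero]
  · intro n δ h1 h2 hδ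
    have h3 : |inner ℝ n q| ≤ 2 * δ * D := by
      rw [hq, inner_sub_right, real_inner_smul_right]
      refine (abs_sub _ _).trans ?_
      rw [abs_mul]
      have h4 : |β| * |inner ℝ n (b - a)| ≤ δ * (|β| * ‖b - a‖) := by
        calc _ ≤ |β| * (δ * ‖b - a‖) := mul_le_mul_of_nonneg_left h1 (abs_nonneg _)
          _ = _ := by ring
      have h5 := mul_le_mul_of_nonneg_left (hβle.trans hcD) hδ
      have h6 := mul_le_mul_of_nonneg_left hcD hδ
      linarith
    rw [hinw, real_inner_smul_right, abs_mul, abs_inv, abs_norm, inv_mul_le_iff₀ hq0]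
    refine h3.trans ?_
    rw [div_mul_eq_mul_div, le_div_iff₀ hd] at hqlow
    nlinarith

/-- A unit vector orthogonal to `e` that makes an angle with the bisecting direction `m` bounded
away from zero is transversal to a surface that is nearly tangent to `m` and `e`. -/
theorem le_abs_inner_of_orthonormal {n ν m e : Pt} {s t : ℝ} (hn : ‖n‖ = 1) (hν : ‖ν‖ = 1)
    (hm : ‖m‖ = 1) (he : ‖e‖ = 1) (hme : inner ℝ m e = 0) (hνe : inner ℝ ν e = 0)
    (hs : |inner ℝ ν m| ≤ s) (ht : 0 < t) (hst : t ^ 2 + s ^ 2 = 1) (hnm : |inner ℝ n m| ≤ t / 4)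
    (hne : |inner ℝ n e| ≤ 1 / 2) : t / 4 ≤ |inner ℝ n ν| := by
  have hor : Orthonormal ℝ (({0, 1} : Set (Fin 3)).domRestrict (![m, e, 0] : Fin 3 → Pt)) := by
    constructor
    · rintro ⟨i, hi⟩
      rcases hi with rfl | rfl
      · simpa using hm
      · simpa using he
    · rintro ⟨i, hi⟩ ⟨j, hj⟩ hij
      rcases hi with rfl | rfl <;> rcases hj with rfl | rfl
      · exact absurd rfl hij
      · simpa using hme
      · rw [real_inner_comm]
        simpa using hme
      · exact absurd rfl hij
  -- In a basis `m, e, b 2`, the third components satisfy `|ν₂| ≥ t` and `|n₂| ≥ 1 / 2`. The `m`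
  -- components contribute at most `t / 4`, and the `e` component of `ν` is zero.
  obtain ⟨b, hb⟩ := hor.exists_orthonormalBasis_extension_of_card_eq (by simp)
  have hb0 : b 0 = m := hb 0 (by simp)
  have hb1 : b 1 = e := hb 1 (by simp)
  have hin : ∀ x y : Pt, inner ℝ x y = inner ℝ x m * inner ℝ y m + inner ℝ x e * inner ℝ y e +
      inner ℝ x (b 2) * inner ℝ y (b 2) := by
    intro x y
    rw [← b.sum_inner_mul_inner x y, Fin.sum_univ_three, hb0, hb1]
    simp only [real_inner_comm]
  have h1 := hin n n
  have h2 := hin ν ν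
  have h3 := hin n ν
  rw [real_inner_self_eq_norm_sq, hn] at h1
  rw [real_inner_self_eq_norm_sq, hν, hνe] at h2
  rw [hνe, mul_zero, add_zero] at h3
  set n0 := inner ℝ n m
  set n1 := inner ℝ n e
  set n2 := inner ℝ n (b 2)
  set v0 := inner ℝ ν m
  set v2 := inner ℝ ν (b 2)
  have ht1 : t ≤ 1 := by nlinarith [sq_nonneg s]
  have hv0 : v0 ^ 2 ≤ s ^ 2 := sq_le_sq.2 (hs.trans (le_abs_self s))
  have hv01 : |v0| ≤ 1 := by
    rw [abs_le_one_iff_mul_self_le_one]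
    nlinarith [sq_nonneg t]
  have hv2 : t ≤ |v2| := by
    refine abs_le_of_sq_le_sq' ?_ (abs_nonneg _) |>.2
    rw [sq_abs]
    nlinarith
  have hn2 : 1 / 2 ≤ |n2| := by
    refine abs_le_of_sq_le_sq' ?_ (abs_nonneg _) |>.2
    rw [sq_abs]
    have h4 := sq_le_sq' (abs_le.1 hnm).1 (abs_le.1 hnm).2
    have h5 := sq_le_sq' (abs_le.1 hne).1 (abs_le.1 hne).2
    nlinarith
  have h4 : t / 2 ≤ |n2 * v2| := by
    rw [abs_mul]
    nlinarith
  have h5 : |n0 * v0| ≤ t / 4 := by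
    rw [abs_mul]
    nlinarith [abs_nonneg n0, abs_nonneg v0]
  have h6 : |n2 * v2| ≤ |inner ℝ n ν| + |n0 * v0| := by
    have : n2 * v2 = inner ℝ n ν - n0 * v0 := by rw [h3]; ring
    rw [this]
    exact abs_sub _ _
  linarith

/-- Points slightly off the middle of an edge of an inscribed face, in directions leaning from the
face to the interior of `Ω`, are inside the tetrahedron. -/
theorem SkinTet.eventually_mem_interior {Ω : Set Pt} {σ δ r : ℝ} {a n b c : Pt} {T : Finset Pt}
    (h : SkinTet Ω σ δ r a n T {a, b, c}) (hΩ : IsOpen Ω) (hσ : 0 < σ) (hδ : 0 < δ)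
    (hσδ : 8 * (σ * δ) ≤ 1) (hab : a ≠ b) (hac : a ≠ c) (hbc : b ≠ c) {w : Pt} (hw : σ * ‖w‖ < 1)
    (hn : inner ℝ n (TetMesh.inward a b c + w) +
      3 * σ * δ * ‖TetMesh.inward a b c + w‖ < 0) :
    ∀ᶠ t : ℝ in nhdsWithin 0 (Set.Ioi 0),
      (1 / 2 : ℝ) • a + (1 / 2 : ℝ) • b + t • (TetMesh.inward a b c + w) ∈ interior (cell T) := by
  have hd := h.isTet.diam_pos
  have haT : a ∈ T := h.subset (by simp)
  have hbT : b ∈ T := h.subset (by simp)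
  have hcT : c ∈ T := h.subset (by simp)
  obtain ⟨-, -, hi1, hi2, -⟩ := inward_spec h.isTet haT hbT hcT hab hac hbc (h.lip c hcT)
  set u := TetMesh.inward a b c + w with hu
  set x : Pt := (1 / 2 : ℝ) • a + (1 / 2 : ℝ) • b with hx
  have hxb : ∀ y, bary T y x = 1 / 2 * bary T y a + 1 / 2 * bary T y b := fun y =>
    bary_combo T y a b (by norm_num)
  rw [h.isTet.interior_cell]
  simp only [Set.mem_ofPred_eq]
  rw [Filter.eventually_all_finset]
  intro y hy
  by_cases hpos : 0 < bary T y x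
  · have hc : Continuous fun t : ℝ => bary T y (x + t • u) :=
      (continuous_bary T y).comp (by fun_prop)
    refine nhdsWithin_le_nhds (hc.continuousAt.eventually (lt_mem_nhds ?_))
    simpa using hpos
  · have hya : y ≠ a := by
      rintro rfl
      rw [hxb, h.isTet.bary_self hy, h.isTet.bary_ne hy hbT hab] at hpos
      norm_num at hpos
    have hyb : y ≠ b := by
      rintro rfl
      rw [hxb, h.isTet.bary_self hy, h.isTet.bary_ne hy haT hab.symm] at hpos
      norm_num at hpos
    have hx0 : bary T y x = 0 := by
      rw [hxb, h.isTet.bary_ne hy haT hya, h.isTet.bary_ne hy hbT hyb]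
      norm_num
    -- At `c` the inward vector beats `w`. At the apex, the face cannot account for so negative an
    -- inner product with `n`; since the apex is below, its coefficient must be positive.
    have hlin : 0 < (bary T y).linear u := by
      by_cases hyc : y = c
      · subst hyc
        rw [hu, map_add]
        have h1 := (abs_le.1 (h.lip y hy w)).1
        have h2 : σ / Metric.diam (cell T) * ‖w‖ < 1 / Metric.diam (cell T) := by
          rw [div_mul_eq_mul_div]
          exact div_lt_div_of_pos_right hw hd
        linarith
      · have hyF : y ∉ ({a, b, c} : Finset Pt) := by simp [hya, hyb, hyc]
        have h1 := h.inner_eq hy hyF u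
        have h2 := (abs_le.1 (h.abs_sum_le hΩ hδ u)).1
        have h3 := h.inner_apex_le hΩ hσ hδ hσδ hy hyF
        have h4 : 0 < Metric.diam (cell T) / (2 * σ) := by positivity
        by_contra! hneg
        have h5 := mul_nonneg_of_nonpos_of_nonpos hneg (by linarith : inner ℝ n (y - a) ≤ 0)
        linarith
    filter_upwards [self_mem_nhdsWithin] with t ht
    rw [bary_add, hx0, zero_add, map_smul, smul_eq_mul]
    exact mul_pos ht hlin

/-- Two inscribed faces with a common edge that belong to tetrahedra whose interiors do not
overlap lie on different sides of the edge. -/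
theorem SkinTet.le_norm_inward_sub {Ω : Set Pt} {σ δ r : ℝ} {a n b c c' : Pt} {T T' : Finset Pt}
    (h : SkinTet Ω σ δ r a n T {a, b, c}) (h' : SkinTet Ω σ δ r a n T' {a, b, c'})
    (hΩ : IsOpen Ω) (hσ : 0 < σ) (hδ : 0 < δ) (hσδ : 8 * (σ * δ) ≤ 1)
    (hδ2 : 10 * (δ * σ ^ 2) + 3 * (δ * σ) < 1)
    (hab : a ≠ b) (hac : a ≠ c) (hbc : b ≠ c) (hac' : a ≠ c') (hbc' : b ≠ c') (hcc' : c ≠ c')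
    (hTT' : (interior (cell T) ∩ interior (cell T')).Nonempty → T = T') :
    1 / (4 * σ) ≤ ‖TetMesh.inward a b c - TetMesh.inward a b c'‖ := by
  by_contra! hlt
  have haT : a ∈ T := h.subset (by simp)
  have hbT : b ∈ T := h.subset (by simp)
  have hcT : c ∈ T := h.subset (by simp)
  obtain ⟨hτ1, -, -, -, hτn⟩ := inward_spec h.isTet haT hbT hcT hab hac hbc (h.lip c hcT)
  have hτn' := hτn n δ (h.abs_inner_le hΩ (by simp) (by simp))
    (h.abs_inner_le hΩ (by simp) (by simp)) hδ.le
  set τ := TetMesh.inward a b c with hτ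
  set τ' := TetMesh.inward a b c' with hτ'
  have hn1 := h.cone.1
  -- The inward vector is tilted by `-κ • n` into `Ω`. If the two inward vectors differed by less
  -- than `1 / (4 * σ)`, the same tilted ray would enter both tetrahedra: the perturbation `w` costs
  -- `1 / 2` for `T` and less than `3 / 4` for `T'`.
  set κ : ℝ := 1 / (2 * σ) with hκ
  have hκ0 : 0 < κ := by positivity
  have hσκ : σ * κ = 1 / 2 := by
    rw [hκ]
    field_simp
  set w : Pt := -(κ • n) with hw
  have hwn : ‖w‖ = κ := by rw [hw, norm_neg, norm_smul, hn1, mul_one, Real.norm_of_nonneg hκ0.le]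
  have hneg : inner ℝ n (τ + w) + 3 * σ * δ * ‖τ + w‖ < 0 := by
    have h1 : ‖τ + w‖ ≤ 1 + κ := (norm_add_le _ _).trans (by rw [hτ1, hwn])
    have h2 : inner ℝ n (τ + w) ≤ 2 * δ * σ - κ := by
      rw [inner_add_right, hw, inner_neg_right, real_inner_smul_right,
        real_inner_self_eq_norm_sq, hn1]
      linarith [(abs_le.1 hτn').2]
    have h3 : 3 * σ * δ * ‖τ + w‖ ≤ 3 * σ * δ * (1 + κ) :=
      mul_le_mul_of_nonneg_left h1 (by positivity)
    have h4 : 3 * σ * δ * (1 + κ) = 3 * (σ * δ) + 3 / 2 * δ := by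
      linear_combination 3 * δ * hσκ
    have h5 : κ = (2 * (σ * κ)) * κ := by rw [hσκ]; ring
    have h6 : (10 * (δ * σ ^ 2) + 3 * (δ * σ)) * κ < κ := by
      nlinarith
    have h7 : (10 * (δ * σ ^ 2) + 3 * (δ * σ)) * κ = 5 * (δ * σ) + 3 / 2 * δ := by
      linear_combination (10 * δ * σ + 3 * δ) * hσκ
    linarith
  have ev1 := h.eventually_mem_interior hΩ hσ hδ hσδ hab hac hbc (w := w)
    (by rw [hwn, hσκ]; norm_num) hneg
  have hsum : τ' + (τ - τ' + w) = τ + w := by abel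
  have ev2 := h'.eventually_mem_interior hΩ hσ hδ hσδ hab hac' hbc' (w := τ - τ' + w)
    (by
      have h1 : ‖τ - τ' + w‖ ≤ 1 / (4 * σ) + κ :=
        (norm_add_le _ _).trans (add_le_add hlt.le hwn.le)
      have h2 := mul_le_mul_of_nonneg_left h1 hσ.le
      have h3 : σ * (1 / (4 * σ) + κ) = 3 / 4 := by
        rw [mul_add, hσκ]
        field_simp
        norm_num
      linarith)
    (by rw [← hτ', hsum]; exact hneg)
  rw [← hτ', hsum] at ev2
  obtain ⟨t, ht1, ht2⟩ := (ev1.and ev2).exists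
  -- Then `c'` would be the vertex of `T` opposite to the face, too deep to lie on the boundary.
  have hT := hTT' ⟨_, ht1, ht2⟩
  have hc'T : c' ∈ T := hT ▸ h'.subset (by simp)
  have hc'F : c' ∉ ({a, b, c} : Finset Pt) := by
    simp [hac'.symm, hbc'.symm, hcc'.symm]
  have h1 := h.inner_apex_le hΩ hσ hδ hσδ hc'T hc'F
  have h2 := (abs_le.1 (h'.abs_inner_le_diam hΩ hδ (y := c') (by simp))).1
  rw [← hT] at h2
  have hd := h.isTet.diam_pos
  have h3 : δ * Metric.diam (cell T) < Metric.diam (cell T) / (2 * σ) := by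
    rw [lt_div_iff₀ (by positivity)]
    nlinarith [mul_pos hσ hδ]
  linarith

/-- Skins close to the bisecting planes are transversal to the boundary. -/
theorem SkinTet.le_abs_inner_skin {Ω : Set Pt} {σ δ r : ℝ} {a n b c c' : Pt} {T T' : Finset Pt}
    (h : SkinTet Ω σ δ r a n T {a, b, c}) (h' : SkinTet Ω σ δ r a n T' {a, b, c'})
    (hΩ : IsOpen Ω) (hσ : 0 < σ) (hδ : 0 < δ) (hσδ : 8 * (σ * δ) ≤ 1)
    (hδ2 : 10 * (δ * σ ^ 2) + 3 * (δ * σ) < 1) (hδ3 : δ ≤ 1 / 2)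
    (hab : a ≠ b) (hac : a ≠ c) (hbc : b ≠ c) (hac' : a ≠ c') (hbc' : b ≠ c') (hcc' : c ≠ c')
    (hTT' : (interior (cell T) ∩ interior (cell T')).Nonempty → T = T') {s t : ℝ}
    (ht : 0 < t) (hst : t ^ 2 + s ^ 2 = 1) (hδt : 16 * (δ * σ ^ 2) ≤ t / 4) {ν : Pt}
    (hν : ‖ν‖ = 1) (hνe : inner ℝ ν (b - a) = 0)
    (hs : |inner ℝ ν (TetMesh.inward a b c - TetMesh.inward a b c')| ≤
      s * ‖TetMesh.inward a b c - TetMesh.inward a b c'‖) : t / 4 ≤ |inner ℝ n ν| := by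
  have hlow := h.le_norm_inward_sub h' hΩ hσ hδ hσδ hδ2 hab hac hbc hac' hbc' hcc' hTT'
  obtain ⟨-, hi1, -, -, hi2⟩ := inward_spec h.isTet (h.subset (by simp)) (h.subset (by simp))
    (h.subset (by simp)) hab hac hbc (h.lip c (h.subset (by simp)))
  obtain ⟨-, hi1', -, -, hi2'⟩ := inward_spec h'.isTet (h'.subset (by simp)) (h'.subset (by simp))
    (h'.subset (by simp)) hab hac' hbc' (h'.lip c' (h'.subset (by simp)))
  have hnb := h.abs_inner_le hΩ (y := a) (z := b) (by simp) (by simp)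
  have h1 := hi2 n δ hnb (h.abs_inner_le hΩ (by simp) (by simp)) hδ.le
  have h2 := hi2' n δ hnb (h'.abs_inner_le hΩ (by simp) (by simp)) hδ.le
  set D := TetMesh.inward a b c - TetMesh.inward a b c' with hD
  have hD0 : 0 < ‖D‖ := lt_of_lt_of_le (by positivity) hlow
  have hba : 0 < ‖b - a‖ := norm_pos_iff.2 (sub_ne_zero.2 hab.symm)
  have hnD : |inner ℝ n D| ≤ 4 * (δ * σ) := by
    rw [hD, inner_sub_right]
    refine (abs_sub _ _).trans ?_
    linarith
  -- Normalising `D` costs a factor `4 * σ`, which turns `4 * (δ * σ)` into `16 * (δ * σ ^ 2)`.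
  refine le_abs_inner_of_orthonormal (m := ‖D‖⁻¹ • D) (e := ‖b - a‖⁻¹ • (b - a)) (s := s)
    h.cone.1 hν ?_ ?_ ?_ ?_ ?_ ht hst ?_ ?_
  · rw [norm_smul, norm_inv, norm_norm, inv_mul_cancel₀ hD0.ne']
  · rw [norm_smul, norm_inv, norm_norm, inv_mul_cancel₀ hba.ne']
  · rw [real_inner_smul_left, real_inner_smul_right, hD, inner_sub_left, hi1, hi1']
    simp
  · rw [real_inner_smul_right, hνe, mul_zero]
  · rw [real_inner_smul_right, abs_mul, abs_inv, abs_norm, inv_mul_le_iff₀ hD0]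
    linarith
  · rw [real_inner_smul_right, abs_mul, abs_inv, abs_norm, inv_mul_le_iff₀ hD0]
    refine hnD.trans ?_
    have h3 : 1 / (4 * σ) * (16 * (δ * σ ^ 2)) ≤ ‖D‖ * (t / 4) :=
      mul_le_mul hlow hδt (by positivity) hD0.le
    have h4 : 1 / (4 * σ) * (16 * (δ * σ ^ 2)) = 4 * (δ * σ) := by
      field_simp
      norm_num
    linarith
  · rw [real_inner_smul_right, abs_mul, abs_inv, abs_norm, inv_mul_le_iff₀ hba]
    refine hnb.trans ?_
    rw [mul_comm]
    exact mul_le_mul_of_nonneg_left hδ3 hba.le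

/-! ### Nearest intersections on fine meshes. -/

namespace TetMesh

theorem diam_le_meshSize (M : TetMesh) {T : Finset Pt} (hT : T ∈ M.elems) :
    Metric.diam (cell T) ≤ M.meshSize :=
  le_ciSup (f := fun T : M.elems => Metric.diam (cell (T : Finset Pt)))
    (Set.finite_range _).bddAbove ⟨T, hT⟩

theorem eq_of_interior_inter_nonempty (M : TetMesh) {T T' : Finset Pt} (hT : T ∈ M.elems)
    (hT' : T' ∈ M.elems) (h : (interior (cell T) ∩ interior (cell T')).Nonempty) : T = T' := by
  obtain ⟨x, hx, hx'⟩ := h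
  have hx0 := hx
  rw [(M.isTet hT).interior_cell] at hx0
  refine Finset.eq_of_subset_of_card_le (fun y hy => ?_)
    (by rw [M.card_eq T hT, M.card_eq T' hT'])
  exact M.mem_of_bary_ne_zero hT hT' (interior_subset hx) (interior_subset hx') hy
    (hx0 y hy).ne'

/-- On fine meshes, all lines that define the displaced nodes have a unique nearest intersection
with the boundary of `Ω`, and it is close to the original node. -/
theorem exists_nearest {Ω : Set Pt} (hΩ : IsOpen Ω) (hbdd : Bornology.IsBounded Ω)
    (hC1 : HasC1Boundary Ω) {σ : ℝ} (hσ : 0 < σ) {s : ℝ} (hs : s < 1) {ε : ℝ} (hε : 0 < ε) :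
    ∃ h₀ : ℝ, 0 < h₀ ∧ ∀ M : TetMesh, M.Fits Ω → M.ShapeRegular σ → M.meshSize ≤ h₀ →
      ∀ ν : Finset Pt → Pt, M.IsSkinChoice s ν →
      (∀ T F, M.IsBdryFace T F → ∀ O ∈ T, O ∉ F → ∀ x ∈ cell F,
        ∃ P, IsNearestIntersection (frontier Ω) x (x - O) P ∧
          dist P x ≤ ε * Metric.diam (cell T) ∧
          ∀ P', IsNearestIntersection (frontier Ω) x (x - O) P' → P' = P) ∧
      ∀ T e, M.IsBdryEdge T e → ∀ x ∈ cell e,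
        ∃ P, IsNearestIntersection (frontier Ω) x (ν e) P ∧
          dist P x ≤ ε * Metric.diam (cell T) ∧
          ∀ P', IsNearestIntersection (frontier Ω) x (ν e) P' → P' = P := by
  wlog hε1 : ε ≤ 1 generalizing ε
  · obtain ⟨h₀, hh₀, H⟩ := this one_pos le_rfl
    refine ⟨h₀, hh₀, fun M h1 h2 h3 ν h4 => ?_⟩
    obtain ⟨H1, H2⟩ := H M h1 h2 h3 ν h4
    have key : ∀ T : Finset Pt, 1 * Metric.diam (cell T) ≤ ε * Metric.diam (cell T) := fun T =>
      mul_le_mul_of_nonneg_right (not_le.1 hε1).le Metric.diam_nonneg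
    refine ⟨fun T F hF O hO hOF x hx => ?_, fun T e he x hx => ?_⟩
    · obtain ⟨P, hP1, hP2, hP3⟩ := H1 T F hF O hO hOF x hx
      exact ⟨P, hP1, hP2.trans (key T), hP3⟩
    · obtain ⟨P, hP1, hP2, hP3⟩ := H2 T e he x hx
      exact ⟨P, hP1, hP2.trans (key T), hP3⟩
  -- `s` may be negative; `s'` and `t` play the roles of a sine and a cosine.
  set s' := max s 0 with hs'
  have hs'0 : 0 ≤ s' := le_max_right _ _
  have hs'1 : s' < 1 := max_lt hs one_pos
  set t := √(1 - s' ^ 2) with ht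
  have ht0 : 0 < t := Real.sqrt_pos.2 (by nlinarith)
  have hst : t ^ 2 + s' ^ 2 = 1 := by
    rw [ht, Real.sq_sqrt (by nlinarith)]
    ring
  have ht1 : t ≤ 1 := by nlinarith
  -- Expanding `δ * (1 + σ) ^ 2 = ε * t / 100` makes every smallness condition below linear in `δ`,
  -- `δ * σ` and `δ * σ ^ 2`.
  set δ : ℝ := ε * t / (100 * (1 + σ) ^ 2) with hδ
  have hδ0 : 0 < δ := by positivity
  have hX : δ + 2 * (δ * σ) + δ * σ ^ 2 = ε * t / 100 := by
    rw [hδ]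
    field_simp
    ring
  have hδσ : 0 < δ * σ := by positivity
  have hδσ2 : 0 < δ * σ ^ 2 := by positivity
  have hεt : ε * t ≤ ε := by nlinarith
  have hεt' : ε * t ≤ t := by nlinarith
  have hεt0 : 0 < ε * t := by positivity
  obtain ⟨r, hr, hcone⟩ := exists_coneAt hbdd hC1 hδ0
  refine ⟨r / 4, by positivity, fun M hfit hreg hmesh ν hν => ?_⟩
  have hdiam : ∀ T ∈ M.elems, 2 * Metric.diam (cell T) < r := fun T hT => by
    have := M.diam_le_meshSize hT
    linarith
  have hfront : ∀ T ∈ M.elems, ∀ y ∈ T, y ∈ M.bdry → y ∈ frontier Ω := fun T hT y hy hyb =>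
    hfit.2 ⟨⟨T, hT, hy⟩, hyb⟩
  have hskin : ∀ T F, M.IsBdryFace T F → ∀ a ∈ F, ∀ n, ConeAt Ω δ r a n →
      SkinTet Ω σ δ r a n T F := by
    intro T F hF a ha n hn
    obtain ⟨hT, hFT, hF3, hFb⟩ := hF
    obtain ⟨c, hc⟩ := hreg T hT
    exact ⟨M.isTet hT, fun y hy u => (M.isTet hT).abs_bary_linear_le hσ hc hy u, hFT, hF3,
      fun y hy => hfit.1 ⟨T, hT, hy⟩,
      fun y hy => hfront T hT y (hFT hy) (hFb (mem_cell_of_mem hy)), ha, hdiam T hT, hn⟩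
  refine ⟨fun T F hF O hO hOF x hx => ?_, fun T₀ e he x hx => ?_⟩
  · obtain ⟨a, ha⟩ : F.Nonempty := Finset.card_pos.1 (by rw [hF.2.2.1]; norm_num)
    obtain ⟨n, hn⟩ := hcone a
      (hfront T hF.1 a (hF.2.1 ha) (hF.2.2.2 (mem_cell_of_mem ha)))
    exact (hskin T F hF a ha n hn).exists_nearest_face hΩ hσ hδ0 (by linarith) hε hε1
      (by linarith) hO hOF hx
  · obtain ⟨T, T', F, F', hF, hF', hFF', heF, heF'⟩ := M.exists_two_bdryFaces he
    obtain ⟨hT₀, heT₀, hecard, heb⟩ := he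
    obtain ⟨a, b, hab, rfl⟩ := Finset.card_eq_two.1 hecard
    have third : ∀ F : Finset Pt, F.card = 3 → {a, b} ⊆ F →
        ∃ c, a ≠ c ∧ b ≠ c ∧ F = {a, b, c} := by
      intro F hF3 heF
      obtain ⟨c, hcF, hce⟩ : ∃ c ∈ F, c ∉ ({a, b} : Finset Pt) := by
        by_contra! hh
        have := Finset.card_le_card hh
        omega
      rw [Finset.mem_insert, Finset.mem_singleton, not_or] at hce
      refine ⟨c, Ne.symm hce.1, Ne.symm hce.2, (Finset.eq_of_subset_of_card_le ?_ ?_).symm⟩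
      · intro y hy
        simp only [Finset.mem_insert, Finset.mem_singleton] at hy
        rcases hy with rfl | rfl | rfl
        · exact heF (by simp)
        · exact heF (by simp)
        · exact hcF
      · rw [hF3, Finset.card_eq_three.2 ⟨a, b, c, hab, Ne.symm hce.1, Ne.symm hce.2, rfl⟩]
    obtain ⟨c, hac, hbc, rfl⟩ := third F hF.2.2.1 heF
    obtain ⟨c', hac', hbc', rfl⟩ := third F' hF'.2.2.1 heF'
    have hcc' : c ≠ c' := fun hh => hFF' (by rw [hh])
    have haΓ : a ∈ frontier Ω := hfront T₀ hT₀ a (heT₀ (by simp)) (heb (mem_cell_of_mem (by simp)))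
    -- One direction at the common vertex `a` serves both boundary faces and the tetrahedron `T₀`,
    -- which may be a third one.
    obtain ⟨n, hn⟩ := hcone a haΓ
    have hS := hskin T _ hF a (by simp) n hn
    have hS' := hskin T' _ hF' a (by simp) n hn
    obtain ⟨hν1, hν2⟩ := hν.1 T₀ {a, b} ⟨hT₀, heT₀, hecard, heb⟩
    have hνs := hν.2 T T' _ _ {a, b} hF hF' hFF' heF heF' hecard a (by simp) b (by simp) hab
      c (by simp) (by simp [hac.symm, hbc.symm]) c' (by simp) (by simp [hac'.symm, hbc'.symm])
    have hνn : t / 4 ≤ |inner ℝ n (ν {a, b})| :=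
      hS.le_abs_inner_skin hS' hΩ hσ hδ0 (by linarith) (by linarith) (by linarith) hab hac hbc
        hac' hbc' hcc' (M.eq_of_interior_inter_nonempty hF.1 hF'.1) ht0 hst (by linarith) hν1
        (hν2 a (by simp) b (by simp))
        (hνs.trans (mul_le_mul_of_nonneg_right (le_max_left _ _) (norm_nonneg _)))
    have hbD : ‖b - a‖ ≤ Metric.diam (cell T₀) :=
      dist_le_diam_of_mem (heT₀ (by simp)) (heT₀ (by simp))
    have hnb : |inner ℝ n (b - a)| ≤ δ * Metric.diam (cell T₀) :=
      (hS.abs_inner_le hΩ (by simp) (by simp)).trans (mul_le_mul_of_nonneg_left hbD hδ0.le)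
    obtain ⟨θ, hθ, rfl⟩ : ∃ θ ∈ Set.Icc (0 : ℝ) 1, a + θ • (b - a) = x := by
      have h1 : x ∈ segment ℝ a b := by
        rw [← convexHull_pair]
        simpa [cell] using hx
      rwa [segment_eq_image', Set.mem_image] at h1
    have hle : ∀ {A B : ℝ}, 0 ≤ A → A ≤ B → θ * A ≤ B := fun hA hAB => by
      nlinarith [hθ.1, hθ.2]
    refine hn.exists_nearest hΩ hδ0 haΓ (M.isTet hT₀).diam_pos (hdiam T₀ hT₀) hε hε1 (κ := t / 4)
      (by linarith) ?_ ?_ ?_ ?_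
    · rw [add_sub_cancel_left, norm_smul, Real.norm_of_nonneg hθ.1]
      exact hle (norm_nonneg _) hbD
    · rw [add_sub_cancel_left, real_inner_smul_right, abs_mul, abs_of_nonneg hθ.1]
      exact hle (abs_nonneg _) hnb
    · intro h0
      rw [h0, norm_zero] at hν1
      exact zero_ne_one hν1
    · rw [hν1, mul_one]
      exact hνn

end TetMesh

/-! ### Displaced nodes and the trial space. -/

/-- Cutting a multi-index off outside `T` does not move the node, and puts it in the finite set
`piAntidiag`. -/
theorem lagrangeNodes_eq (k : ℕ) (T : Finset Pt) :
    lagrangeNodes k T = {x | ∃ α ∈ T.piAntidiag k, node k T α = x} := by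
  ext x
  constructor
  · rintro ⟨α, hα, rfl⟩
    refine ⟨fun y => if y ∈ T then α y else 0, ?_, Finset.sum_congr rfl fun y hy => ?_⟩
    · rw [Finset.mem_piAntidiag]
      refine ⟨?_, fun y hy => ?_⟩
      · rw [← hα]
        exact Finset.sum_congr rfl fun y hy => if_pos hy
      · by_contra hyT
        exact hy (if_neg hyT)
    · simp only [if_pos hy]
  · rintro ⟨α, hα, rfl⟩
    exact ⟨α, (Finset.mem_piAntidiag.1 hα).1, rfl⟩

/-- The nodes in the relative interior of a face are the nodes of the tetrahedron supported by the
vertices of this face. -/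
theorem exists_of_mem_innerNodes {k : ℕ} {S T : Finset Pt} (hST : S ⊆ T) {x : Pt}
    (hx : x ∈ innerNodes k S) :
    ∃ α ∈ T.piAntidiag k, node k T α = x ∧ ∀ y ∈ T, y ∈ S ↔ α y ≠ 0 := by
  obtain ⟨α, hpos, hsum, rfl⟩ := hx
  refine ⟨fun y => if y ∈ S then α y else 0, ?_, ?_, fun y _ => ?_⟩
  · rw [Finset.mem_piAntidiag]
    refine ⟨?_, fun y hy => ?_⟩
    · rw [← hsum, ← Finset.sum_subset hST]
      · exact Finset.sum_congr rfl fun y hy => if_pos hy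
      · exact fun y _ hy => if_neg hy
    · by_contra hyT
      exact hy (if_neg fun hyS => hyT (hST hyS))
  · unfold node
    rw [← Finset.sum_subset hST]
    · exact Finset.sum_congr rfl fun y hy => by simp only [if_pos hy]
    · intro y _ hy
      simp [hy]
  · by_cases hy : y ∈ S
    · simp [hy, (hpos y hy).ne']
    · simp [hy]

theorem mem_innerNodes_of_support {k : ℕ} {S T : Finset Pt} (hST : S ⊆ T) {α : Pt → ℕ}
    (hα : α ∈ T.piAntidiag k) (hS : ∀ y ∈ T, y ∈ S ↔ α y ≠ 0) :
    node k T α ∈ innerNodes k S := by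
  have h0 : ∀ y ∈ T, y ∉ S → α y = 0 := fun y hy hyS => by
    by_contra hne
    exact hyS ((hS y hy).2 hne)
  refine ⟨α, fun y hy => Nat.pos_of_ne_zero ((hS y (hST hy)).1 hy), ?_, ?_⟩
  · rw [← (Finset.mem_piAntidiag.1 hα).1]
    exact Finset.sum_subset hST h0
  · unfold node
    refine (Finset.sum_subset hST fun y hy hyS => ?_).symm
    rw [h0 y hy hyS]
    simp

theorem innerNodes_subset_cell {k : ℕ} (hk : k ≠ 0) (S : Finset Pt) : innerNodes k S ⊆ cell S := by
  rintro x ⟨α, -, hsum, rfl⟩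
  exact (convex_convexHull ℝ _).sum_mem (fun y _ => by positivity) (sum_div_eq_one hk hsum)
    fun y hy => mem_cell_of_mem hy

theorem IsTet.support_of_node_eq_vertex {T : Finset Pt} (h : IsTet T) {k : ℕ} (hk : k ≠ 0)
    {α : Pt → ℕ} (hα : α ∈ T.piAntidiag k) {v : Pt} (hv : v ∈ T) (hαv : node k T α = v) :
    ∀ y ∈ T, y ∈ ({v} : Finset Pt) ↔ α y ≠ 0 := by
  intro y hy
  have h1 := h.bary_node hk hα hy
  have hk' : (k : ℝ) ≠ 0 := by exact_mod_cast hk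
  rw [hαv, eq_div_iff hk'] at h1
  rw [Finset.mem_singleton]
  by_cases hyv : y = v
  · subst hyv
    rw [h.bary_self hy, one_mul] at h1
    have : α y = k := by exact_mod_cast h1.symm
    simp [this, hk]
  · rw [h.bary_ne hy hv hyv, zero_mul] at h1
    have : α y = 0 := by exact_mod_cast h1.symm
    simp [this, hyv]

theorem exists_vertex_node {k : ℕ} (hk : k ≠ 0) {T : Finset Pt} {v : Pt} (hv : v ∈ T) :
    ∃ α ∈ T.piAntidiag k, node k T α = v := by
  have hk' : (k : ℝ) ≠ 0 := by exact_mod_cast hk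
  refine ⟨fun y => if y = v then k else 0, ?_, ?_⟩
  · rw [Finset.mem_piAntidiag]
    refine ⟨by simp [hv], fun y hy => ?_⟩
    have : y = v := by
      by_contra hne
      exact hy (if_neg hne)
    exact this ▸ hv
  · unfold node
    rw [Finset.sum_eq_single v]
    · simp [hk']
    · intro y _ hyv
      simp [hyv]
    · exact fun hh => absurd hv hh

/-- The support of a multi-index is the face carrying the node, so at most one face or edge
condition concerns a given node of `T`. -/
theorem eq_of_same_support {S S' T : Finset Pt} (hS : S ⊆ T) (hS' : S' ⊆ T) {α : Pt → ℕ}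
    (h : ∀ y ∈ T, y ∈ S ↔ α y ≠ 0) (h' : ∀ y ∈ T, y ∈ S' ↔ α y ≠ 0) : S = S' := by
  ext y
  exact ⟨fun hy => (h' y (hS hy)).2 ((h y (hS hy)).1 hy),
    fun hy => (h y (hS' hy)).2 ((h' y (hS' hy)).1 hy)⟩

namespace TetMesh

/-- A Lagrangian node on the boundary of the polyhedron is a vertex, or an inner node of a boundary
edge or of a boundary face. -/
theorem node_mem_bdry_cases (M : TetMesh) {T : Finset Pt} (hT : T ∈ M.elems) {k : ℕ} (hk : k ≠ 0)
    {α : Pt → ℕ} (hα : α ∈ T.piAntidiag k) (hb : node k T α ∈ M.bdry) :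
    (∃ v ∈ T, node k T α = v) ∨ (∃ F, M.IsBdryFace T F ∧ ∀ y ∈ T, y ∈ F ↔ α y ≠ 0) ∨
      ∃ e, M.IsBdryEdge T e ∧ ∀ y ∈ T, y ∈ e ↔ α y ≠ 0 := by
  have hTet := M.isTet hT
  -- The face carrying the node lies in the boundary as a whole, so it has one, two or three
  -- vertices.
  set S := T.filter fun y => α y ≠ 0 with hS
  have hST : S ⊆ T := Finset.filter_subset _ _
  have hSα : ∀ y ∈ T, y ∈ S ↔ α y ≠ 0 := fun y hy => by simp [hS, hy]
  have hk' : (k : ℝ) ≠ 0 := by exact_mod_cast hk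
  have hSb : cell S ⊆ M.bdry := M.subcell_subset_bdry hT hST (hTet.node_mem_cell hk hα) hb
    fun y hy => by
      rw [hSα y hy, hTet.bary_node hk hα hy]
      simp [hk']
  have hnode := innerNodes_subset_cell hk S (mem_innerNodes_of_support hST hα hSα)
  have hcard := Finset.card_le_card hST
  rw [hTet.1] at hcard
  have h4 : S.card ≠ 4 := by
    intro h4
    have hSeq : S = T := Finset.eq_of_subset_of_card_le hST (by rw [hTet.1, h4])
    obtain ⟨w, hw⟩ := hTet.exists_interior_point
    have h1 := hSb (hSeq ▸ interior_subset hw)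
    rw [M.bdry_eq] at h1
    exact h1.2 (M.interior_cell_subset_dom hT hw)
  have h0 : S.card ≠ 0 := by
    intro h0
    rw [Finset.card_eq_zero.1 h0] at hnode
    simp [cell] at hnode
  by_cases h3 : S.card = 3
  · exact Or.inr (Or.inl ⟨S, ⟨hT, hST, h3, hSb⟩, hSα⟩)
  by_cases h2 : S.card = 2
  · exact Or.inr (Or.inr ⟨S, ⟨hT, hST, h2, hSb⟩, hSα⟩)
  · obtain ⟨v, hv⟩ := Finset.card_eq_one.1 (by omega : S.card = 1)
    rw [hv] at hnode
    refine Or.inl ⟨v, hST (by simp [hv]), ?_⟩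
    simpa [cell] using hnode

/-- The points `X T α` are the nodes of the trial space: the Lagrangian nodes, except that those in
the relative interior of boundary faces and edges are moved to the boundary of `Ω`. -/
structure IsDisplacement (M : TetMesh) (Ω : Set Pt) (k : ℕ) (ν : Finset Pt → Pt)
    (X : Finset Pt → (Pt → ℕ) → Pt) : Prop where
  off_bdry : ∀ T ∈ M.elems, ∀ α ∈ T.piAntidiag k, node k T α ∉ M.bdry → X T α = node k T α
  vertex : ∀ T ∈ M.elems, ∀ α ∈ T.piAntidiag k, node k T α ∈ T → X T α = node k T α
  face : ∀ T F, M.IsBdryFace T F → ∀ O ∈ T, O ∉ F → ∀ α ∈ T.piAntidiag k,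
    (∀ y ∈ T, y ∈ F ↔ α y ≠ 0) → ∀ P,
      IsNearestIntersection (frontier Ω) (node k T α) (node k T α - O) P ↔ P = X T α
  edge : ∀ T e, M.IsBdryEdge T e → ∀ α ∈ T.piAntidiag k, (∀ y ∈ T, y ∈ e ↔ α y ≠ 0) → ∀ Q,
      IsNearestIntersection (frontier Ω) (node k T α) (ν e) Q ↔ Q = X T α

/-- The carrying face decides where the node goes. Comparing supports and their cardinalities shows
that the cases exclude one another. -/
theorem exists_isDisplacement (M : TetMesh) {Ω : Set Pt} {k : ℕ} (hk : k ≠ 0)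
    {ν : Finset Pt → Pt} {ε : ℝ} (hε : 0 < ε)
    (Hface : ∀ T F, M.IsBdryFace T F → ∀ O ∈ T, O ∉ F → ∀ x ∈ cell F,
        ∃ P, IsNearestIntersection (frontier Ω) x (x - O) P ∧
          dist P x ≤ ε * Metric.diam (cell T) ∧
          ∀ P', IsNearestIntersection (frontier Ω) x (x - O) P' → P' = P)
    (Hedge : ∀ T e, M.IsBdryEdge T e → ∀ x ∈ cell e,
        ∃ P, IsNearestIntersection (frontier Ω) x (ν e) P ∧
          dist P x ≤ ε * Metric.diam (cell T) ∧
          ∀ P', IsNearestIntersection (frontier Ω) x (ν e) P' → P' = P) :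
    ∃ X, M.IsDisplacement Ω k ν X ∧ ∀ T ∈ M.elems, ∀ α ∈ T.piAntidiag k,
      dist (X T α) (node k T α) ≤ ε * Metric.diam (cell T) := by
  have key : ∀ T ∈ M.elems, ∀ α ∈ T.piAntidiag k, ∃ P,
      (node k T α ∉ M.bdry → P = node k T α) ∧ (node k T α ∈ T → P = node k T α) ∧
      (∀ F, M.IsBdryFace T F → ∀ O ∈ T, O ∉ F → (∀ y ∈ T, y ∈ F ↔ α y ≠ 0) → ∀ P',
        IsNearestIntersection (frontier Ω) (node k T α) (node k T α - O) P' ↔ P' = P) ∧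
      (∀ e, M.IsBdryEdge T e → (∀ y ∈ T, y ∈ e ↔ α y ≠ 0) → ∀ Q,
        IsNearestIntersection (frontier Ω) (node k T α) (ν e) Q ↔ Q = P) ∧
      dist P (node k T α) ≤ ε * Metric.diam (cell T) := by
    intro T hT α hα
    have hTet := M.isTet hT
    by_cases hF : ∃ F, M.IsBdryFace T F ∧ ∀ y ∈ T, y ∈ F ↔ α y ≠ 0
    · obtain ⟨F, hF, hFα⟩ := hF
      have hx := innerNodes_subset_cell hk F (mem_innerNodes_of_support hF.2.1 hα hFα)
      obtain ⟨O, hO, hOF⟩ : ∃ O ∈ T, O ∉ F := by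
        by_contra! hh
        have := Finset.card_le_card hh
        rw [hTet.1, hF.2.2.1] at this
        omega
      obtain ⟨P, hP1, hP2, hP3⟩ := Hface T F hF O hO hOF _ hx
      refine ⟨P, fun hn => absurd (hF.2.2.2 hx) hn, fun hv => ?_, ?_, ?_, hP2⟩
      · have h1 := eq_of_same_support (by simpa using hv) hF.2.1
          (hTet.support_of_node_eq_vertex hk hα hv rfl) hFα
        have h2 := hF.2.2.1
        rw [← h1] at h2
        simp at h2
      · intro F' hF' O' hO' hOF' hFα' P'
        have h1 := eq_of_same_support hF.2.1 hF'.2.1 hFα hFα'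
        subst h1
        have h2 : O' = O := by
          by_contra hne
          have h3 : insert O' (insert O F) ⊆ T :=
            Finset.insert_subset hO' (Finset.insert_subset hO hF.2.1)
          have h4 := Finset.card_le_card h3
          rw [Finset.card_insert_of_notMem (by simp [hne, hOF']),
            Finset.card_insert_of_notMem hOF, hF.2.2.1, hTet.1] at h4
          omega
        subst h2
        exact ⟨hP3 P', fun hh => hh ▸ hP1⟩
      · intro e he heα
        have h1 := eq_of_same_support hF.2.1 he.2.1 hFα heα
        have h2 := hF.2.2.1
        rw [h1, he.2.2.1] at h2
        omega
    · by_cases he : ∃ e, M.IsBdryEdge T e ∧ ∀ y ∈ T, y ∈ e ↔ α y ≠ 0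
      · obtain ⟨e, he, heα⟩ := he
        have hx := innerNodes_subset_cell hk e (mem_innerNodes_of_support he.2.1 hα heα)
        obtain ⟨P, hP1, hP2, hP3⟩ := Hedge T e he _ hx
        refine ⟨P, fun hn => absurd (he.2.2.2 hx) hn, fun hv => ?_, ?_, ?_, hP2⟩
        · have h1 := eq_of_same_support (by simpa using hv) he.2.1
            (hTet.support_of_node_eq_vertex hk hα hv rfl) heα
          have h2 := he.2.2.1
          rw [← h1] at h2
          simp at h2
        · intro F hF' O _ _ hFα
          exact absurd ⟨F, hF', hFα⟩ hF
        · intro e' he' heα' Q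
          have h1 := eq_of_same_support he.2.1 he'.2.1 heα heα'
          subst h1
          exact ⟨hP3 Q, fun hh => hh ▸ hP1⟩
      · refine ⟨node k T α, fun _ => rfl, fun _ => rfl, fun F hF' O _ _ hFα =>
          absurd ⟨F, hF', hFα⟩ hF, fun e he' heα => absurd ⟨e, he', heα⟩ he, ?_⟩
        rw [dist_self]
        exact mul_nonneg hε.le Metric.diam_nonneg
  choose! X h1 h2 h3 h4 h5 using key
  exact ⟨X, ⟨h1, h2, fun T F hF O hO hOF α hα hs => h3 T hF.1 α hα F hF O hO hOF hs,
    fun T e he α hα hs => h4 T he.1 α hα e he hs⟩, h5⟩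

/-- The elements of the trial manifold are given by their values at the displaced nodes. -/
theorem IsDisplacement.isTrial_iff {M : TetMesh} {Ω : Set Pt} {k : ℕ} (hk : k ≠ 0)
    {ν : Finset Pt → Pt} {X : Finset Pt → (Pt → ℕ) → Pt} (hX : M.IsDisplacement Ω k ν X)
    (g : Pt → ℝ) (w : M.elems → MvPolynomial (Fin 3) ℝ) :
    M.IsTrial Ω k ν g w ↔ (∀ T, (w T).totalDegree ≤ k) ∧ ∃ ξ : Pt → ℝ, ∀ T : M.elems,
      ∀ α ∈ T.1.piAntidiag k, polyFun (w T) (X T α) =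
        if node k T.1 α ∈ M.bdry then g (X T α) else ξ (node k T.1 α) := by
  constructor
  · intro hw
    -- The value is read off in any tetrahedron having `x` as a node; single-valuedness makes the
    -- choice irrelevant off the boundary.
    refine ⟨hw.degree_le, fun x => if h : ∃ T : M.elems, x ∈ lagrangeNodes k T.1 then
      polyFun (w h.choose) x else 0, fun T α hα => ?_⟩
    have hmem : node k T.1 α ∈ lagrangeNodes k T.1 := by
      rw [lagrangeNodes_eq]
      exact ⟨α, hα, rfl⟩
    by_cases hb : node k T.1 α ∈ M.bdry
    · rw [if_pos hb]
      rcases M.node_mem_bdry_cases T.2 hk hα hb with ⟨v, hv, hαv⟩ | ⟨F, hF, hFα⟩ | ⟨e, he, heα⟩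
      · have h1 := hX.vertex T T.2 α hα (hαv ▸ hv)
        rw [h1, hαv]
        exact hw.vertex_value T v hv (hαv ▸ hb)
      · obtain ⟨O, hO, hOF⟩ : ∃ O ∈ T.1, O ∉ F := by
          by_contra! hh
          have := Finset.card_le_card hh
          rw [M.card_eq T T.2, hF.2.2.1] at this
          omega
        exact hw.face_value T F hF O hO hOF _ (mem_innerNodes_of_support hF.2.1 hα hFα) _
          ((hX.face T F hF O hO hOF α hα hFα _).2 rfl)
      · exact hw.edge_value T e he _ (mem_innerNodes_of_support he.2.1 hα heα) _
          ((hX.edge T e he α hα heα _).2 rfl)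
    · have hex' : ∃ T' : M.elems, node k T.1 α ∈ lagrangeNodes k T'.1 := ⟨T, hmem⟩
      rw [if_neg hb, hX.off_bdry T T.2 α hα hb]
      beta_reduce
      rw [dif_pos hex']
      exact hw.single_valued T _ _ ⟨hmem, hex'.choose_spec⟩ (Or.inl hb)
  · rintro ⟨hdeg, ξ, hξ⟩
    have hvert : ∀ T : M.elems, ∀ v ∈ T.1, v ∈ M.bdry → polyFun (w T) v = g v := by
      intro T v hv hvb
      obtain ⟨α, hα, hαv⟩ := exists_vertex_node hk hv
      have h1 := hξ T α hα
      rwa [hX.vertex T T.2 α hα (hαv ▸ hv), hαv, if_pos hvb] at h1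
    refine ⟨hdeg, ?_, hvert, ?_, ?_⟩
    · rintro T T' x ⟨hx, hx'⟩ hor
      rw [lagrangeNodes_eq] at hx hx'
      obtain ⟨α, hα, rfl⟩ := hx
      obtain ⟨α', hα', hαα'⟩ := hx'
      by_cases hb : node k T.1 α ∈ M.bdry
      · have hv := hor.resolve_left (not_not.2 hb)
        have hc := (M.isTet T.2).node_mem_cell hk hα
        have hc' := (M.isTet T'.2).node_mem_cell hk hα'
        rw [hαα'] at hc'
        rw [hvert T _ (M.mem_of_mem_vertices T.2 hc hv) hb,
          hvert T' _ (M.mem_of_mem_vertices T'.2 hc' hv) hb]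
      · have h1 := hξ T α hα
        have h2 := hξ T' α' hα'
        rw [hX.off_bdry T T.2 α hα hb, if_neg hb] at h1
        rw [hX.off_bdry T' T'.2 α' hα' (hαα' ▸ hb), hαα', if_neg hb] at h2
        rw [h1, h2]
    · intro T F hF O hO hOF x hx P hP
      obtain ⟨α, hα, rfl, hFα⟩ := exists_of_mem_innerNodes hF.2.1 hx
      have h1 := hξ T α hα
      rw [if_pos (hF.2.2.2 (innerNodes_subset_cell hk F hx)),
        ← (hX.face T F hF O hO hOF α hα hFα P).1 hP] at h1
      exact h1
    · intro T e he x hx Q hQ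
      obtain ⟨α, hα, rfl, heα⟩ := exists_of_mem_innerNodes he.2.1 hx
      have h1 := hξ T α hα
      rw [if_pos (he.2.2.2 (innerNodes_subset_cell hk e hx)),
        ← (hX.edge T e he α hα heα Q).1 hQ] at h1
      exact h1

end TetMesh

/-! ### Nodal coordinates on the test space. -/

theorem node_of_subset {k : ℕ} {S T : Finset Pt} (hST : S ⊆ T) {α : Pt → ℕ}
    (hα : α ∈ S.piAntidiag k) : node k T α = node k S α := by
  unfold node
  refine (Finset.sum_subset hST fun y _ hyS => ?_).symm
  rw [not_imp_comm.1 ((Finset.mem_piAntidiag.1 hα).2 y) hyS]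
  simp

theorem piAntidiag_subset {k : ℕ} {S T : Finset Pt} (hST : S ⊆ T) :
    S.piAntidiag k ⊆ T.piAntidiag k := by
  intro α hα
  rw [Finset.mem_piAntidiag] at hα ⊢
  refine ⟨?_, fun y hy => hST (hα.2 y hy)⟩
  rw [← hα.1]
  exact (Finset.sum_subset hST fun y _ hyS => not_imp_comm.1 (hα.2 y) hyS).symm

/-- On a face, the interpolant only depends on the nodal values on this face. -/
theorem polyFun_interp_of_support (k : ℕ) {S T : Finset Pt} (hST : S ⊆ T) {x : Pt}
    (hx : ∀ y ∈ T, y ∉ S → bary T y x = 0) (ζ : Pt → ℝ) :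
    polyFun (interp k T fun α => ζ (node k T α)) x =
      ∑ α ∈ S.piAntidiag k, ζ (node k S α) * ∏ y ∈ S, binom (k * bary T y x) (α y) := by
  rw [polyFun_interp, ← Finset.sum_subset (piAntidiag_subset hST)]
  · refine Finset.sum_congr rfl fun α hα => ?_
    rw [node_of_subset hST hα, polyFun_lagrangePoly, ← Finset.prod_subset hST]
    intro y _ hyS
    rw [not_imp_comm.1 ((Finset.mem_piAntidiag.1 hα).2 y) hyS]
    simp [binom]
  · intro α hα hαS
    obtain ⟨y, hy, hyS⟩ : ∃ y, α y ≠ 0 ∧ y ∉ S := by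
      by_contra! hh
      refine hαS (Finset.mem_piAntidiag.2 ⟨?_, hh⟩)
      rw [← (Finset.mem_piAntidiag.1 hα).1]
      refine Finset.sum_subset hST fun y _ hyS => ?_
      by_contra hne
      exact hyS (hh y hne)
    have hyT := (Finset.mem_piAntidiag.1 hα).2 y hy
    rw [lagrangePoly_eq_zero k hyT (hx y hyT hyS) hy, mul_zero]

theorem interp_add (k : ℕ) (T : Finset Pt) (c c' : (Pt → ℕ) → ℝ) :
    interp k T (c + c') = interp k T c + interp k T c' := by
  simp only [interp, Pi.add_apply, add_smul, Finset.sum_add_distrib]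

theorem interp_smul (k : ℕ) (T : Finset Pt) (r : ℝ) (c : (Pt → ℕ) → ℝ) :
    interp k T (r • c) = r • interp k T c := by
  simp only [interp, Pi.smul_apply, smul_eq_mul, mul_smul, Finset.smul_sum]

namespace TetMesh

variable (M : TetMesh) (k : ℕ)

/-- The Lagrangian nodes of the mesh that are not on the boundary of the polyhedron. -/
def freeNodes : Finset Pt :=
  (M.elems.biUnion fun T => (T.piAntidiag k).image (node k T)).filter fun x => x ∉ M.bdry

theorem node_mem_freeNodes {T : Finset Pt} (hT : T ∈ M.elems) {α : Pt → ℕ}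
    (hα : α ∈ T.piAntidiag k) (hb : node k T α ∉ M.bdry) : node k T α ∈ M.freeNodes k :=
  Finset.mem_filter.2 ⟨Finset.mem_biUnion.2 ⟨T, hT, Finset.mem_image_of_mem _ hα⟩, hb⟩

/-- Extension by zero of a function given at the free nodes. -/
def extendZero : (M.freeNodes k → ℝ) →ₗ[ℝ] (Pt → ℝ) where
  toFun ξ x := if h : x ∈ M.freeNodes k then ξ ⟨x, h⟩ else 0
  map_add' ξ η := by
    funext x
    by_cases h : x ∈ M.freeNodes k <;> simp [h]
  map_smul' c ξ := by
    funext x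
    by_cases h : x ∈ M.freeNodes k <;> simp [h]

variable {k}

theorem extendZero_apply (ξ : M.freeNodes k → ℝ) (x : M.freeNodes k) :
    M.extendZero k ξ x = ξ x := by
  simp [extendZero]

theorem extendZero_of_notMem (ξ : M.freeNodes k → ℝ) {x : Pt} (hx : x ∉ M.freeNodes k) :
    M.extendZero k ξ x = 0 := by
  simp [extendZero, hx]

theorem extendZero_of_mem_bdry (ξ : M.freeNodes k → ℝ) {x : Pt} (hx : x ∈ M.bdry) :
    M.extendZero k ξ x = 0 :=
  M.extendZero_of_notMem ξ fun hh => (Finset.mem_filter.1 hh).2 hx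

variable (k)

/-- The polynomial on the tetrahedron `T` of the test function with given values at the free
nodes. -/
def testPoly (T : Finset Pt) : (M.freeNodes k → ℝ) →ₗ[ℝ] PolyLE k where
  toFun ξ := ⟨interp k T fun α => M.extendZero k ξ (node k T α),
    mem_polyLE.2 (totalDegree_interp_le _ _ _)⟩
  map_add' ξ η := by
    apply Subtype.ext
    simp only [map_add, Submodule.coe_add, ← interp_add]
    rfl
  map_smul' c ξ := by
    apply Subtype.ext
    simp only [map_smul, RingHom.id_apply, Submodule.coe_smul, ← interp_smul]
    rfl

variable {k}

theorem testPoly_node (hk : k ≠ 0) {T : Finset Pt} (hT : T ∈ M.elems) (ξ : M.freeNodes k → ℝ)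
    {α : Pt → ℕ} (hα : α ∈ T.piAntidiag k) :
    polyFun (M.testPoly k T ξ).1 (node k T α) = M.extendZero k ξ (node k T α) :=
  (M.isTet hT).interp_node hk (fun α => M.extendZero k ξ (node k T α)) hα

/-- On the face of common vertices both interpolants are the same expression in the shared nodal
values and shared coordinates. -/
theorem testPoly_eq_of_mem {T T' : Finset Pt} (hT : T ∈ M.elems) (hT' : T' ∈ M.elems)
    (ξ : M.freeNodes k → ℝ) {x : Pt} (hx : x ∈ cell T) (hx' : x ∈ cell T') :
    polyFun (M.testPoly k T ξ).1 x = polyFun (M.testPoly k T' ξ).1 x := by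
  have h1 : ∀ {S S' : Finset Pt}, S ∈ M.elems → S' ∈ M.elems → x ∈ cell S → x ∈ cell S' →
      ∀ y ∈ S, y ∉ S ∩ S' → bary S y x = 0 := by
    intro S S' hS hS' hxS hxS' y hy hyn
    by_contra hne
    exact hyn (Finset.mem_inter.2 ⟨hy, M.mem_of_bary_ne_zero hS hS' hxS hxS' hy hne⟩)
  have h2 := h1 hT' hT hx' hx
  rw [Finset.inter_comm] at h2
  refine (polyFun_interp_of_support k Finset.inter_subset_left (h1 hT hT' hx hx') _).trans
    (Eq.trans ?_ (polyFun_interp_of_support k Finset.inter_subset_right h2 _).symm)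
  refine Finset.sum_congr rfl fun α _ => congrArg _ (Finset.prod_congr rfl fun y hy => ?_)
  rw [M.bary_eq_ite hT hT' hx hx' (Finset.mem_inter.1 hy).2, if_pos (Finset.mem_inter.1 hy).1]

/-- The face carrying `x` lies in the boundary, so all nodal values on it are zero. -/
theorem testPoly_eq_zero (hk : k ≠ 0) {T : Finset Pt} (hT : T ∈ M.elems)
    (ξ : M.freeNodes k → ℝ) {x : Pt} (hx : x ∈ cell T) (hxb : x ∈ M.bdry) :
    polyFun (M.testPoly k T ξ).1 x = 0 := by
  set S := T.filter fun y => bary T y x ≠ 0 with hS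
  have hST : S ⊆ T := Finset.filter_subset _ _
  have hSb := M.subcell_subset_bdry hT hST hx hxb fun v hv => by simp [hS, hv]
  refine (polyFun_interp_of_support k hST (fun y hy hyS => ?_) _).trans
    (Finset.sum_eq_zero fun α hα => ?_)
  · by_contra hne
    exact hyS (Finset.mem_filter.2 ⟨hy, hne⟩)
  · have hmem : node k S α ∈ cell S :=
      (convex_convexHull ℝ _).sum_mem (fun y _ => by positivity)
        (sum_div_eq_one hk (Finset.mem_piAntidiag.1 hα).1) fun y hy => mem_cell_of_mem hy
    rw [M.extendZero_of_mem_bdry ξ (hSb hmem), zero_mul]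

/-- The test function with given values at the free nodes. -/
def testFun (ξ : M.freeNodes k → ℝ) (x : Pt) : ℝ :=
  if h : ∃ T ∈ M.elems, x ∈ cell T then polyFun (M.testPoly k h.choose ξ).1 x else 0

theorem testFun_of_mem {T : Finset Pt} (hT : T ∈ M.elems) (ξ : M.freeNodes k → ℝ) {x : Pt}
    (hx : x ∈ cell T) : M.testFun ξ x = polyFun (M.testPoly k T ξ).1 x := by
  have h : ∃ T ∈ M.elems, x ∈ cell T := ⟨T, hT, hx⟩
  unfold testFun
  rw [dif_pos h]
  exact M.testPoly_eq_of_mem h.choose_spec.1 hT ξ h.choose_spec.2 hx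

theorem testFun_add (ξ η : M.freeNodes k → ℝ) (x : Pt) :
    M.testFun (ξ + η) x = M.testFun ξ x + M.testFun η x := by
  unfold testFun
  split_ifs
  · rw [map_add, Submodule.coe_add, polyFun_add]
  · rw [add_zero]

theorem testFun_smul (c : ℝ) (ξ : M.freeNodes k → ℝ) (x : Pt) :
    M.testFun (c • ξ) x = c * M.testFun ξ x := by
  unfold testFun
  split_ifs
  · rw [map_smul, Submodule.coe_smul, polyFun_smul]
  · rw [mul_zero]

theorem testFun_mem_testSpace (hk : k ≠ 0) (ξ : M.freeNodes k → ℝ) :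
    M.testFun ξ ∈ M.testSpace k := by
  refine ⟨?_, fun x hx => ?_, fun T hT => ⟨(M.testPoly k T ξ).1,
    mem_polyLE.1 (M.testPoly k T ξ).2, fun x hx => M.testFun_of_mem hT ξ hx⟩⟩
  · have h1 : M.polyhedron = ⋃ T : M.elems, cell T.1 := by
      ext x
      simp [polyhedron]
    rw [h1]
    refine (locallyFinite_of_finite _).continuousOn_iUnion (fun T => isClosed_cell T.1) fun T => ?_
    exact (polyFun_continuous _).continuousOn.congr fun x hx => M.testFun_of_mem T.2 ξ hx
  · by_cases hxp : x ∈ M.polyhedron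
    · obtain ⟨T, hT, hxT⟩ := M.mem_polyhedron.1 hxp
      rw [M.testFun_of_mem hT ξ hxT]
      refine M.testPoly_eq_zero hk hT ξ hxT ?_
      rw [M.bdry_eq]
      exact ⟨hxp, hx⟩
    · unfold testFun
      rw [dif_neg fun h => hxp (M.mem_polyhedron.2 h)]

/-- On each cell a test function is determined by its nodal values, and those on the boundary
vanish; its values at free nodes are thus coordinates. -/
theorem exists_eq_testFun (hk : k ≠ 0) {v : Pt → ℝ} (hv : v ∈ M.testSpace k) :
    ∃ ξ : M.freeNodes k → ℝ, v = M.testFun ξ := by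
  obtain ⟨-, hv0, hvp⟩ := hv
  refine ⟨fun x => v x, funext fun x => ?_⟩
  by_cases hxp : x ∈ M.polyhedron
  · obtain ⟨T, hT, hxT⟩ := M.mem_polyhedron.1 hxp
    obtain ⟨p, hp, hpv⟩ := hvp T hT
    rw [M.testFun_of_mem hT _ hxT, hpv x hxT]
    congr 1
    refine (M.isTet hT).eq_of_node hk hp (mem_polyLE.1 (M.testPoly k T _).2) fun α hα => ?_
    rw [M.testPoly_node hk hT _ hα, ← hpv _ ((M.isTet hT).node_mem_cell hk hα)]
    by_cases hb : node k T α ∈ M.bdry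
    · rw [M.extendZero_of_mem_bdry _ hb]
      rw [M.bdry_eq] at hb
      exact hv0 _ hb.2
    · exact (M.extendZero_apply (fun x : M.freeNodes k => v x)
        ⟨_, M.node_mem_freeNodes k hT hα hb⟩).symm
  · rw [hv0 x fun hh => hxp (interior_subset hh)]
    unfold testFun
    rw [dif_neg fun h => hxp (M.mem_polyhedron.2 h)]

/-- The bilinear form of the discrete problem is the sum of the Dirichlet forms of the
tetrahedra. -/
theorem aForm_testFun (u : M.elems → PolyLE k) (ξ : M.freeNodes k → ℝ) :
    M.aForm (fun T => (u T).1) (M.testFun ξ) =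
      ∑ T : M.elems, dirichletForm k T.1 (u T) (M.testPoly k T.1 ξ) := by
  have h1 : ∀ x, inner ℝ (M.brokenGrad (fun T => (u T).1) x) (gradient (M.testFun ξ) x) =
      ∑ T : M.elems, (interior (cell T.1)).indicator (fun x => inner ℝ
        (gradient (polyFun (u T).1) x) (gradient (polyFun (M.testPoly k T.1 ξ).1) x)) x := by
    intro x
    rw [brokenGrad, sum_inner]
    refine Finset.sum_congr rfl fun T _ => ?_
    by_cases hx : x ∈ interior (cell T.1)
    · rw [Set.indicator_of_mem hx, Set.indicator_of_mem hx]
      have h2 : M.testFun ξ =ᶠ[nhds x] polyFun (M.testPoly k T.1 ξ).1 := by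
        filter_upwards [isOpen_interior.mem_nhds hx] with z hz
        exact M.testFun_of_mem T.2 ξ (interior_subset hz)
      have h3 : gradient (M.testFun ξ) x = gradient (polyFun (M.testPoly k T.1 ξ).1) x := by
        unfold gradient
        rw [h2.fderiv_eq]
      rw [h3]
    · rw [Set.indicator_of_notMem hx, Set.indicator_of_notMem hx, inner_zero_left]
  unfold aForm
  simp only [h1]
  rw [integral_finsetSum]
  · refine Finset.sum_congr rfl fun T _ => ?_
    rw [setIntegral_indicator isOpen_interior.measurableSet,
      Set.inter_eq_right.2 (M.interior_cell_subset_dom T.2), dirichletForm_apply]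
  · intro T _
    exact ((integrableOn_inner_gradient T.1 _ _).integrable_indicator
      isOpen_interior.measurableSet).integrableOn

/-- The products of data in `L²` with test functions are integrable. -/
theorem integrableOn_mul_of_mem_testSpace {Ω : Set Pt} (hΩ : IsOpen Ω)
    (hbdd : Bornology.IsBounded Ω) {f : Pt → ℝ} (hf : MemLp f 2 (volume.restrict Ω)) {v : Pt → ℝ}
    (hv : v ∈ M.testSpace k) : IntegrableOn (fun x => Ω.indicator f x * v x) M.dom := by
  have hfin : IsFiniteMeasure (volume.restrict Ω) :=
    isFiniteMeasure_restrict.2 hbdd.measure_lt_top.ne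
  have h1 : Integrable (Ω.indicator f) :=
    IntegrableOn.integrable_indicator (hf.integrable one_le_two) hΩ.measurableSet
  have hcomp : IsCompact M.polyhedron :=
    M.elems.finite_toSet.isCompact_biUnion fun T _ => isCompact_cell T
  obtain ⟨C, hC⟩ := hcomp.exists_bound_of_continuousOn hv.1
  refine h1.integrableOn.mul_bdd
    ((hv.1.mono interior_subset).aestronglyMeasurable M.isOpen_dom.measurableSet) (c := C) ?_
  exact ae_restrict_of_forall_mem M.isOpen_dom.measurableSet fun x hx => hC x (interior_subset hx)

end TetMesh

/-! ### Unisolvence, coercivity and well-posedness. -/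

/-- Interpolation at the points `X` is unisolvent for polynomials of degree at most `k` if the
displacement bound holds. -/
theorem IsTet.evalAt_bijective {T : Finset Pt} (h : IsTet T) {k : ℕ} (hk : k ≠ 0)
    {X : (Pt → ℕ) → Pt}
    (H : ∀ p q : MvPolynomial (Fin 3) ℝ, p.totalDegree ≤ k → q.totalDegree ≤ k →
      (∀ α ∈ T.piAntidiag k, polyFun q (node k T α) = polyFun p (X α)) →
      energy T (p - q) ≤ 1 / 4 * energy T p) :
    Function.Bijective (evalAt k T X) := by
  refine h.evalAt_bijective_of_injective hk ?_
  rw [← LinearMap.ker_eq_bot, LinearMap.ker_eq_bot']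
  intro p hp
  have hpX : ∀ α ∈ T.piAntidiag k, polyFun p.1 (X α) = 0 := fun α hα => congrFun hp ⟨α, hα⟩
  -- Comparison with zero gives `energy T p ≤ 1 / 4 * energy T p`, so `p` is constant, and it
  -- vanishes at a displaced node.
  have h1 := H p.1 0 (mem_polyLE.1 p.2) (by simp) fun α hα => by rw [hpX α hα, polyFun_zero]
  rw [sub_zero] at h1
  have h2 := energy_nonneg T p.1
  obtain ⟨c, hc⟩ := h.eq_C_of_energy_eq_zero (p := p.1) (by linarith)
  obtain ⟨v, hv⟩ : T.Nonempty := Finset.card_pos.1 (by rw [h.1]; norm_num)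
  obtain ⟨α, hα, -⟩ := exists_vertex_node hk hv
  have h3 := hpX α hα
  rw [hc, polyFun_C] at h3
  apply Subtype.ext
  rw [hc, h3]
  simp

namespace TetMesh

variable (M : TetMesh) {k : ℕ}

/-- A piecewise constant function that is single-valued at the mesh vertices and zero at the
vertices on the boundary of the polyhedron is zero. -/
theorem eq_zero_of_vertex_values {c : M.elems → ℝ} {val : Pt → ℝ}
    (hc : ∀ T : M.elems, ∀ v ∈ T.1, c T = val v) (hval : ∀ v ∈ M.bdry, val v = 0) (T : M.elems) :
    c T = 0 := by
  by_contra hT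
  set K : Set Pt := ⋃ T' : {T' : M.elems // c T' = c T}, cell T'.1.1 with hK
  have hKc : IsCompact K := isCompact_iUnion fun T' => isCompact_cell T'.1.1
  have hKo : IsOpen K := by
    rw [isOpen_iff_mem_nhds]
    intro x hx
    obtain ⟨⟨T', hT'⟩, hxT'⟩ := Set.mem_iUnion.1 hx
    have hTet := M.isTet T'.2
    have hxT'' : x ∈ cell T'.1 := hxT'
    obtain ⟨v, hv, hvx⟩ : ∃ v ∈ T'.1, bary T'.1 v x ≠ 0 := by
      by_contra! hh
      have := hTet.sum_bary x
      rw [Finset.sum_eq_zero hh] at this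
      exact zero_ne_one this
    -- On the boundary, the face carrying `x` would have a boundary vertex, where the value is zero.
    -- Cells around an interior `x` share the vertex `v`, hence the value.
    have hxd : x ∈ M.dom := by
      by_contra hxd
      have hxb : x ∈ M.bdry := by
        rw [M.bdry_eq]
        exact ⟨M.cell_subset_polyhedron T'.2 hxT'', hxd⟩
      have hsub := M.subcell_subset_bdry T'.2
        (Finset.filter_subset (fun v => bary T'.1 v x ≠ 0) T'.1) hxT'' hxb
        fun w hw => by simp [hw]
      have hvb := hsub (mem_cell_of_mem (Finset.mem_filter.2 ⟨hv, hvx⟩))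
      exact hT (by rw [← hT', hc T' v hv, hval v hvb])
    filter_upwards [mem_interior_iff_mem_nhds.1 hxd, M.eventually_mem_cell x] with z hz1 hz2
    obtain ⟨S, hS, hzS⟩ := M.mem_polyhedron.1 hz1
    have hvS := M.mem_of_bary_ne_zero T'.2 hS hxT'' (hz2 S hS hzS) hv hvx
    refine Set.mem_iUnion.2 ⟨⟨⟨S, hS⟩, ?_⟩, hzS⟩
    rw [hc ⟨S, hS⟩ v hvS, ← hc T' v hv, hT']
  obtain ⟨w, hw⟩ := (M.isTet T.2).exists_interior_point
  have huniv := IsClopen.eq_univ ⟨hKc.isClosed, hKo⟩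
    ⟨w, Set.mem_iUnion.2 ⟨⟨T, rfl⟩, interior_subset hw⟩⟩
  exact noncompact_univ Pt (huniv ▸ hKc)

/-- The discrete problem is well posed if the nodes are displaced by a small amount. -/
theorem existsUnique_isDiscreteSolution {Ω : Set Pt} (hΩ : IsOpen Ω)
    (hbdd : Bornology.IsBounded Ω) (hk : k ≠ 0) {ν : Finset Pt → Pt}
    {X : Finset Pt → (Pt → ℕ) → Pt} (hX : M.IsDisplacement Ω k ν X)
    (H : ∀ T ∈ M.elems, ∀ p q : MvPolynomial (Fin 3) ℝ, p.totalDegree ≤ k → q.totalDegree ≤ k →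
      (∀ α ∈ T.piAntidiag k, polyFun q (node k T α) = polyFun p (X T α)) →
      energy T (p - q) ≤ 1 / 4 * energy T p)
    {f g : Pt → ℝ} (hf : MemLp f 2 (volume.restrict Ω)) :
    ∃! u : M.elems → MvPolynomial (Fin 3) ℝ, M.IsDiscreteSolution Ω k ν f g u := by
  let E : ∀ T : M.elems, PolyLE k ≃ₗ[ℝ] (T.1.piAntidiag k → ℝ) := fun T =>
    LinearEquiv.ofBijective (evalAt k T.1 (X T.1)) ((M.isTet T.2).evalAt_bijective hk (H T.1 T.2))
  have hE : ∀ T c, ∀ α (hα : α ∈ T.1.piAntidiag k),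
      polyFun ((E T).symm c).1 (X T.1 α) = c ⟨α, hα⟩ := fun T c α hα =>
    congrFun ((E T).apply_symm_apply c) ⟨α, hα⟩
  let R : ∀ T : M.elems, (M.freeNodes k → ℝ) →ₗ[ℝ] (T.1.piAntidiag k → ℝ) := fun T =>
    (LinearMap.funLeft ℝ ℝ fun α : T.1.piAntidiag k => node k T.1 α.1).comp (M.extendZero k)
  -- The homogeneous trial polynomial whose values at the displaced nodes are the nodal values of
  -- `testPoly`; `w0` lifts the data `g`.
  let W : ∀ T : M.elems, (M.freeNodes k → ℝ) →ₗ[ℝ] PolyLE k := fun T =>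
    ((E T).symm : (T.1.piAntidiag k → ℝ) →ₗ[ℝ] PolyLE k).comp (R T)
  have hW : ∀ T ξ, ∀ α ∈ T.1.piAntidiag k,
      polyFun (W T ξ).1 (X T.1 α) = M.extendZero k ξ (node k T.1 α) := fun T ξ α hα =>
    hE T (R T ξ) α hα
  let w0 : ∀ T : M.elems, PolyLE k := fun T => (E T).symm fun α =>
    if node k T.1 α.1 ∈ M.bdry then g (X T.1 α.1) else 0
  have hw0 : ∀ T, ∀ α ∈ T.1.piAntidiag k, polyFun (w0 T).1 (X T.1 α) =
      if node k T.1 α ∈ M.bdry then g (X T.1 α) else 0 := fun T α hα => hE T _ α hα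
  have htrial : ∀ u : M.elems → MvPolynomial (Fin 3) ℝ, M.IsTrial Ω k ν g u ↔
      ∃ ξ : M.freeNodes k → ℝ, u = fun T => (w0 T + W T ξ).1 := by
    intro u
    rw [hX.isTrial_iff hk]
    constructor
    · rintro ⟨hdeg, ξ, hξ⟩
      refine ⟨fun x => ξ x, funext fun T => ?_⟩
      have h1 : (⟨u T, mem_polyLE.2 (hdeg T)⟩ : PolyLE k) = w0 T + W T fun x => ξ x := by
        refine (E T).injective (funext fun α => ?_)
        change polyFun (u T) (X T.1 α.1) = polyFun (w0 T + W T fun x => ξ x).1 (X T.1 α.1)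
        rw [hξ T α.1 α.2, Submodule.coe_add, polyFun_add, hw0 T α.1 α.2, hW T _ α.1 α.2]
        by_cases hb : node k T.1 α.1 ∈ M.bdry
        · rw [if_pos hb, if_pos hb, M.extendZero_of_mem_bdry _ hb, add_zero]
        · rw [if_neg hb, if_neg hb, zero_add]
          exact (M.extendZero_apply (fun x : M.freeNodes k => ξ x)
            ⟨_, M.node_mem_freeNodes k T.2 α.2 hb⟩).symm
      exact congrArg Subtype.val h1
    · rintro ⟨ξ, rfl⟩
      refine ⟨fun T => mem_polyLE.1 (w0 T + W T ξ).2, M.extendZero k ξ, fun T α hα => ?_⟩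
      change polyFun (w0 T + W T ξ).1 (X T.1 α) = _
      rw [Submodule.coe_add, polyFun_add, hw0 T α hα, hW T ξ α hα]
      by_cases hb : node k T.1 α ∈ M.bdry
      · rw [if_pos hb, if_pos hb, M.extendZero_of_mem_bdry _ hb, add_zero]
      · rw [if_neg hb, if_neg hb, zero_add]
  -- Both spaces are parametrised by the same free values, which makes the system square.
  let Φ : (M.freeNodes k → ℝ) →ₗ[ℝ] (M.freeNodes k → ℝ) →ₗ[ℝ] ℝ :=
    ∑ T : M.elems, (dirichletForm k T.1).compl₁₂ (W T) (M.testPoly k T.1)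
  have hΦ : ∀ ξ η, Φ ξ η = ∑ T : M.elems, dirichletForm k T.1 (W T ξ) (M.testPoly k T.1 η) := by
    intro ξ η
    simp [Φ, LinearMap.sum_apply]
  have hinj : Function.Injective Φ := by
    rw [← LinearMap.ker_eq_bot, LinearMap.ker_eq_bot']
    intro ξ hξ
    have h0 : ∑ T : M.elems, dirichletForm k T.1 (W T ξ) (M.testPoly k T.1 ξ) = 0 := by
      rw [← hΦ, hξ, LinearMap.zero_apply]
    -- Testing with the function that has the same free values makes each elementwise term coercive,
    -- so all energies vanish.
    have h1 : ∀ T : M.elems, 1 / 2 * energy T.1 (W T ξ).1 ≤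
        dirichletForm k T.1 (W T ξ) (M.testPoly k T.1 ξ) := fun T =>
      half_energy_le_integral_inner (H T.1 T.2 _ _ (mem_polyLE.1 (W T ξ).2)
        (mem_polyLE.1 (M.testPoly k T.1 ξ).2) fun α hα => by
          rw [M.testPoly_node hk T.2 ξ hα, hW T ξ α hα])
    have h2 : ∀ T : M.elems, energy T.1 (W T ξ).1 = 0 := by
      intro T
      have h3 := (Finset.sum_eq_zero_iff_of_nonneg fun T _ =>
        (mul_nonneg (by norm_num) (energy_nonneg _ _)).trans (h1 T)).1 h0 T (Finset.mem_univ T)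
      linarith [h1 T, energy_nonneg T.1 (W T ξ).1]
    choose c hc using fun T : M.elems => (M.isTet T.2).eq_C_of_energy_eq_zero (h2 T)
    have hcval : ∀ T : M.elems, ∀ α ∈ T.1.piAntidiag k,
        c T = M.extendZero k ξ (node k T.1 α) := by
      intro T α hα
      rw [← hW T ξ α hα, hc T, polyFun_C]
    have hc0 := M.eq_zero_of_vertex_values (c := c) (val := M.extendZero k ξ)
      (fun T v hv => by
        obtain ⟨α, hα, hαv⟩ := exists_vertex_node hk hv
        rw [hcval T α hα, hαv])
      fun v hv => M.extendZero_of_mem_bdry ξ hv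
    funext x
    obtain ⟨hx1, -⟩ := Finset.mem_filter.1 x.2
    obtain ⟨T, hT, hx2⟩ := Finset.mem_biUnion.1 hx1
    obtain ⟨α, hα, hαx⟩ := Finset.mem_image.1 hx2
    rw [← M.extendZero_apply ξ x, ← hαx, ← hcval ⟨T, hT⟩ α hα, hc0]
    rfl
  have hbij : Function.Bijective Φ := ⟨hinj, (LinearMap.injective_iff_surjective_of_finrank_eq_finrank
    (Subspace.dual_finrank_eq (K := ℝ) (V := M.freeNodes k → ℝ)).symm).1 hinj⟩
  have hint : ∀ ξ : M.freeNodes k → ℝ,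
      IntegrableOn (fun x => Ω.indicator f x * M.testFun ξ x) M.dom := fun ξ =>
    M.integrableOn_mul_of_mem_testSpace hΩ hbdd hf (M.testFun_mem_testSpace hk ξ)
  let L : (M.freeNodes k → ℝ) →ₗ[ℝ] ℝ :=
    { toFun := fun ξ => M.lForm Ω f (M.testFun ξ)
      map_add' := fun ξ η => by
        unfold lForm
        simp only [M.testFun_add, mul_add]
        exact integral_add (hint ξ) (hint η)
      map_smul' := fun r ξ => by
        unfold lForm
        simp only [M.testFun_smul, mul_left_comm, RingHom.id_apply, smul_eq_mul]
        exact integral_const_mul _ _ }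
  -- The load after moving the contribution of `w0` to the right-hand side.
  let l : (M.freeNodes k → ℝ) →ₗ[ℝ] ℝ :=
    L - ∑ T : M.elems, (dirichletForm k T.1 (w0 T)).comp (M.testPoly k T.1)
  have hl : ∀ η, l η = M.lForm Ω f (M.testFun η) -
      ∑ T : M.elems, dirichletForm k T.1 (w0 T) (M.testPoly k T.1 η) := by
    intro η
    simp [l, L, LinearMap.sum_apply]
  have hsol : ∀ ξ : M.freeNodes k → ℝ, (∀ v ∈ M.testSpace k,
      M.aForm (fun T => (w0 T + W T ξ).1) v = M.lForm Ω f v) ↔ Φ ξ = l := by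
    intro ξ
    have key : ∀ η, M.aForm (fun T => (w0 T + W T ξ).1) (M.testFun η) =
        (∑ T : M.elems, dirichletForm k T.1 (w0 T) (M.testPoly k T.1 η)) + Φ ξ η := by
      intro η
      rw [M.aForm_testFun (fun T => w0 T + W T ξ) η, hΦ, ← Finset.sum_add_distrib]
      exact Finset.sum_congr rfl fun T _ => by rw [map_add, LinearMap.add_apply]
    constructor
    · intro h1
      refine LinearMap.ext fun η => ?_
      have h2 := h1 _ (M.testFun_mem_testSpace hk η)
      rw [key] at h2
      rw [hl]
      linarith
    · intro h1 v hv
      obtain ⟨η, rfl⟩ := M.exists_eq_testFun hk hv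
      rw [key, h1, hl]
      ring
  obtain ⟨ξ, hξ⟩ := hbij.2 l
  refine ⟨fun T => (w0 T + W T ξ).1, ⟨(htrial _).2 ⟨ξ, rfl⟩, (hsol ξ).2 hξ⟩, ?_⟩
  rintro u ⟨hu1, hu2⟩
  obtain ⟨ξ', rfl⟩ := (htrial u).1 hu1
  rw [hbij.1 (((hsol ξ').1 hu2).trans hξ.symm)]

end TetMesh

end CurvedFEM

end

theorem mainTheorem8 (Ω : Set CurvedFEM.Pt) (hΩ_open : IsOpen Ω) (hΩ_bdd : Bornology.IsBounded Ω)
    (hΩ_C1 : CurvedFEM.HasC1Boundary Ω) (k : ℕ) (hk : 2 ≤ k) (σ : ℝ) (hσ : 0 < σ)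
    (s : ℝ) (hs : s < 1) :
    ∃ h₀ : ℝ, 0 < h₀ ∧ ∀ M : CurvedFEM.TetMesh,
      M.Fits Ω → M.ShapeRegular σ → M.OneEdgeOrFace → M.meshSize ≤ h₀ →
      ∀ ν : Finset CurvedFEM.Pt → CurvedFEM.Pt, M.IsSkinChoice s ν →
      ∀ f g : CurvedFEM.Pt → ℝ,
        MeasureTheory.MemLp f 2 (MeasureTheory.volume.restrict Ω) →
        ContinuousOn g (frontier Ω) →
        ∃! u : M.elems → MvPolynomial (Fin 3) ℝ, M.IsDiscreteSolution Ω k ν f g u := by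
  have hk0 : k ≠ 0 := by omega
  -- `ε` depends on `k` and `σ` only; `Ω` and `s` enter through the mesh size that keeps the
  -- displacements below it.
  obtain ⟨ε, hε, hdisp⟩ := CurvedFEM.exists_displacement_bound hk0 hσ
  obtain ⟨h₀, hh₀, hnear⟩ := CurvedFEM.TetMesh.exists_nearest hΩ_open hΩ_bdd hΩ_C1 hσ hs hε
  refine ⟨h₀, hh₀, fun M hfit hreg _ hmesh ν hν f g hf _ => ?_⟩
  obtain ⟨Hface, Hedge⟩ := hnear M hfit hreg hmesh ν hν
  obtain ⟨X, hX, hXd⟩ := M.exists_isDisplacement hk0 hε Hface Hedge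
  exact M.existsUnique_isDiscreteSolution hΩ_open hΩ_bdd hk0 hX
    (fun T hT p q hp hq => hdisp T (M.isTet hT) (hreg T hT) p q hp hq (X T) (hXd T hT)) hf
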